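/- Let $k$ be a field, $d\ge 2$, $R=k[[x_1,\dots,x_d,y_1,\dots,y_d]]$, $g_i=x_i^d+y_i^d$, $\mathfrak a=(g_1,\dots,g_d)$ and $S=R/\mathfrak a$. Put $f_i=\prod_{j\ne i}x_j$, and let $M$ be the pushout of the inclusion $(x_1^{d-1},\dots,x_d^{d-1})\hookrightarrow S$ of $S$-modules and the $S$-linear map $$\eta\colon (x_1^{d-1},\dots,x_d^{d-1})\to S/(y_1^{d-1},\dots,y_d^{d-1}),\qquad \eta(x_i^{d-1})=-f_i .$$ Definitions. A lifting system for $M$ is a family $\{M_n\}_{n\ge1}$ of $R$-modules of finite length with $M_1\cong M$, $\mathfrak a^nM_n=0$, and isomorphisms $M_{n+1}/\mathfrak a^nM_{n+1}\cong M_n$ for all $n\ge1$; these isomorphisms make it an inverse system. A naive lift of $M$ is a finitely generated $R$-module $L$ with $L\otimes_RS\cong M$ as $S$-modules. $M$ lifts to $R$ if some naive lift $L$ satisfies $\operatorname{Tor}^R_i(L,S)=0$ for all $i>0$, and $M$ Serre lifts to $R$ if the maximal dimension of a naive lift of $M$ equals $\dim R-\dim S$. We write $\operatorname{Fitt}_0^R$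 for the zeroth Fitting ideal, and $u(n)\approx n^d$ if there are polynomials $p,q$ of degree $d$ with positive leading coefficients such that $p(n)\le u(n)\le q(n)$ for all $n\gg0$. Theorem. The sequence $g_1,\dots,g_d$ is $R$-regular, so that $S$ is a complete intersection, and $\dim S=d$. The $S$-module $M$ has finite length and finite projective dimension. Moreover: (1) There is a lifting system $\{M_n\}_{n\ge1}$ for $M$ such that $\ell_R(R/\operatorname{Fitt}_0^R(M_n))$ is finite for $n\gg0$ and $\ell_R(R/\operatorname{Fitt}_0^R(M_n))\approx n^d$; and $M$ Serre lifts to $R$. (2) Every lifting system $\{M_n\}_{n\ge1}$ for $M$ satisfies $\varprojlim_n\operatorname{Tor}^R_1(M_n,S)\ne0$; and $M$ does not lift to $R$. -/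

import Mathlib

open CategoryTheory CategoryTheory.Limits

universe u

namespace SerreLifting

noncomputable section

/-! ### Lifting along a quotient map `R → R ⧸ a` -/

section General

variable {R : Type u} [CommRing R]

/-- `L` is a naive lift of the `R ⧸ a`-module `M`: it is a finitely generated `R`-module whose
base change to `R ⧸ a` is isomorphic to `M`. -/
def IsNaiveLift (a : Ideal R) (M : Type u) [AddCommGroup M] [Module (R ⧸ a) M]
    (L : ModuleCat.{u} R) : Prop :=
  Module.Finite R L ∧ Nonempty (TensorProduct R (R ⧸ a) L ≃ₗ[R ⧸ a] M)

/-- `M` lifts to `R`: it has a naive lift `L` with `Tor_i^R(L, R ⧸ a) = 0` for all `i > 0`. -/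
def IsLiftable (a : Ideal R) (M : Type u) [AddCommGroup M] [Module (R ⧸ a) M] : Prop :=
  ∃ L : ModuleCat.{u} R, IsNaiveLift a M L ∧
    ∀ i : ℕ, 0 < i → IsZero (((Tor (ModuleCat.{u} R) i).obj L).obj (ModuleCat.of R (R ⧸ a)))

/-- The set of Krull dimensions of the naive lifts of `M`; its maximum is the liftable dimension
of `M`. -/
def naiveLiftDims (a : Ideal R) (M : Type u) [AddCommGroup M] [Module (R ⧸ a) M] :
    Set (WithBot ℕ∞) :=
  {r | ∃ L : ModuleCat.{u} R, IsNaiveLift a M L ∧ Module.supportDim R L = r}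

/-- `M` Serre lifts to `R`: its liftable dimension (the maximal dimension of a naive lift) exists
and equals `dim R - dim (R ⧸ a)`. -/
def IsSerreLiftable (a : Ideal R) (M : Type u) [AddCommGroup M] [Module (R ⧸ a) M] : Prop :=
  ∃ r : WithBot ℕ∞, IsGreatest (naiveLiftDims a M) r ∧ r + ringKrullDim (R ⧸ a) = ringKrullDim R

/-- A lifting system `{M_n}` for `M` along `R → R ⧸ a`. The term `obj n` is `M_n`. For `n = 0` the
conditions hold exactly when `obj 0 = 0` (as `a ^ 0 = R`), so that a family indexed by `n ≥ 1` is
the same thing as a family indexed by all natural numbers. -/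
structure LiftingSystem (a : Ideal R) (M : Type u) [AddCommGroup M] [Module R M] where
  /-- the module `M_n` -/
  obj : ℕ → ModuleCat.{u} R
  /-- each `M_n` has finite length -/
  finite_length : ∀ n, IsFiniteLength R (obj n)
  /-- `a ^ n` annihilates `M_n` -/
  le_annihilator : ∀ n, a ^ n ≤ Module.annihilator R (obj n)
  /-- the isomorphism `M_{n+1} / a ^ n M_{n+1} ≅ M_n` -/
  iso : ∀ n, (obj (n + 1) ⧸ (a ^ n • ⊤ : Submodule R (obj (n + 1)))) ≃ₗ[R] obj n
  /-- the identification `M_1 = M` -/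
  base : obj 1 ≃ₗ[R] M

/-- The transition map `M_{n+1} → M_{n+1} / a ^ n M_{n+1} ≅ M_n` of a lifting system. -/
def LiftingSystem.transition {a : Ideal R} {M : Type u} [AddCommGroup M] [Module R M]
    (E : LiftingSystem a M) (n : ℕ) : E.obj (n + 1) ⟶ E.obj n :=
  ModuleCat.ofHom ((E.iso n).toLinearMap ∘ₗ Submodule.mkQ _)

/-- A lifting system as an inverse system `⋯ → M_2 → M_1 → M_0 = 0`. -/
def LiftingSystem.toFunctor {a : Ideal R} {M : Type u} [AddCommGroup M] [Module R M]
    (E : LiftingSystem a M) : ℕᵒᵖ ⥤ ModuleCat.{u} R :=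
  Functor.ofOpSequence E.transition

/-- The inverse limit of the modules `Tor_i^R(M_n, R ⧸ a)` of a lifting system. -/
def LiftingSystem.limTor {a : Ideal R} {M : Type u} [AddCommGroup M] [Module R M]
    (E : LiftingSystem a M) (i : ℕ) : ModuleCat.{u} R :=
  limit (E.toFunctor ⋙ (Tor (ModuleCat.{u} R) i).flip.obj (ModuleCat.of R (R ⧸ a)))

/-- The zeroth Fitting ideal of a finitely generated module `M`: for a finite generating family
`v_1, …, v_m` of `M` it is generated by the determinants of the `m × m` matrices whose rows are
relations among the `v_j`. (These are the maximal minors of a presentation matrix, and the ideal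
does not depend on the generating family.) -/
def fittingIdealZero (R : Type u) [CommRing R] (M : Type u) [AddCommGroup M] [Module R M] :
    Ideal R :=
  Ideal.span {r | ∃ (m : ℕ) (v : Fin m → M) (A : Matrix (Fin m) (Fin m) R),
    Submodule.span R (Set.range v) = ⊤ ∧ (∀ i, ∑ j, A i j • v j = 0) ∧ A.det = r}

/-- `u n ≈ n ^ r`: for all large `n`, the value `u n` is finite and lies between `f(n)` and `g(n)`,
where `f` and `g` are polynomials of degree `r` with positive leading coefficient. -/
def GrowsLikePow (u : ℕ → ℕ∞) (r : ℕ) : Prop :=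
  ∃ f g : Polynomial ℝ, f.natDegree = r ∧ 0 < f.leadingCoeff ∧
    g.natDegree = r ∧ 0 < g.leadingCoeff ∧
    ∀ᶠ n : ℕ in Filter.atTop, ∃ l : ℕ, u n = (l : ℕ∞) ∧
      f.eval (n : ℝ) ≤ (l : ℝ) ∧ (l : ℝ) ≤ g.eval (n : ℝ)

/-- The pushout of `f : A → B` and `g : A → C`, as the quotient of `B × C` by the submodule of all
`(f t, - g t)`. -/
abbrev PushoutModule {A B C : Type u} [AddCommGroup A] [AddCommGroup B] [AddCommGroup C]
    [Module R A] [Module R B] [Module R C] (f : A →ₗ[R] B) (g : A →ₗ[R] C) : Type u :=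
  (B × C) ⧸ LinearMap.range (f.prod (-g))

end General

/-! ### The rings `R` and `S`, the map `η` and the module `M` -/

section Example

variable (k : Type u) [Field k] (d : ℕ)

/-- `R = k[[x_1, …, x_d, y_1, …, y_d]]`. -/
abbrev ringR : Type u := MvPowerSeries (Fin d ⊕ Fin d) k

/-- The variable `x_i`. -/
def varX (i : Fin d) : ringR k d := MvPowerSeries.X (Sum.inl i)

/-- The variable `y_i`. -/
def varY (i : Fin d) : ringR k d := MvPowerSeries.X (Sum.inr i)

/-- `g_i = x_i ^ d + y_i ^ d`. -/
def polyG (i : Fin d) : ringR k d := varX k d i ^ d + varY k d i ^ d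

/-- `f_i`, the product of all `x_j` with `j ≠ i`. -/
def monF (i : Fin d) : ringR k d := ∏ j ∈ Finset.univ.erase i, varX k d j

/-- The ideal `(g_1, …, g_d)` of `R`. -/
def idealA : Ideal (ringR k d) := Ideal.span (Set.range (polyG k d))

/-- `S = R / (g_1, …, g_d)`. -/
abbrev ringS : Type u := ringR k d ⧸ idealA k d

/-- The image in `S` of an element of `R`. -/
abbrev toS : ringR k d →+* ringS k d := Ideal.Quotient.mk (idealA k d)

/-- The ideal `(x_1 ^ (d-1), …, x_d ^ (d-1))` of `S`. -/
def idealX : Ideal (ringS k d) := Ideal.span (Set.range fun i => toS k d (varX k d i ^ (d - 1)))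

/-- The ideal `(y_1 ^ (d-1), …, y_d ^ (d-1))` of `S`. -/
def idealY : Ideal (ringS k d) := Ideal.span (Set.range fun i => toS k d (varY k d i ^ (d - 1)))

variable {k d}

/-- A power series all of whose monomials are divisible by one of finitely many given monomials
lies in the ideal that these generate. -/
theorem mem_span_monomial {σ ι : Type*} [Fintype ι] (e : ι → σ →₀ ℕ) (p : MvPowerSeries σ k)
    (h : ∀ m, MvPowerSeries.coeff m p ≠ 0 → ∃ i, e i ≤ m) :
    p ∈ Ideal.span (Set.range fun i => MvPowerSeries.monomial (e i) (1 : k)) := by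
  classical
  let q : ι → MvPowerSeries σ k := fun i m =>
    if hm : ∃ j, e j ≤ e i + m then
      if hm.choose = i then MvPowerSeries.coeff (e i + m) p else 0
    else 0
  have hp : p = ∑ i, q i * MvPowerSeries.monomial (e i) (1 : k) := by
    ext m
    rw [map_sum]
    have key : ∀ i, MvPowerSeries.coeff m (q i * MvPowerSeries.monomial (e i) (1 : k)) =
        if hm : ∃ j, e j ≤ m then (if hm.choose = i then MvPowerSeries.coeff m p else 0)
        else 0 := by
      intro i
      rw [MvPowerSeries.coeff_mul_monomial]
      by_cases hi : e i ≤ m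
      · rw [if_pos hi, mul_one]
        have : MvPowerSeries.coeff (m - e i) (q i) = q i (m - e i) := rfl
        rw [this]
        simp only [q, add_tsub_cancel_of_le hi]
      · rw [if_neg hi]
        split_ifs with h1 h2
        · exact absurd (h2 ▸ h1.choose_spec) hi
        · rfl
        · rfl
    simp only [key]
    by_cases hm : ∃ j, e j ≤ m
    · simp [hm]
    · simp only [hm, dite_false, Finset.sum_const_zero]
      by_contra hc
      exact hm (h m hc)
  rw [hp]
  exact Ideal.sum_mem _ fun i _ =>
    Ideal.mul_mem_left _ _ (Ideal.subset_span ⟨i, rfl⟩)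

/-- The exponent of the monomial `f_i`. -/
def expF (i : Fin d) : (Fin d ⊕ Fin d) →₀ ℕ :=
  ∑ j ∈ Finset.univ.erase i, Finsupp.single (Sum.inl j) 1

theorem f_eq (i : Fin d) : monF k d i = MvPowerSeries.monomial (expF i) (1 : k) := by
  classical
  unfold monF expF
  induction (Finset.univ.erase i : Finset (Fin d)) using Finset.induction_on with
  | empty => simp
  | insert a s ha ih =>
    rw [Finset.prod_insert ha, Finset.sum_insert ha, ih, varX, MvPowerSeries.X_def,
      MvPowerSeries.monomial_mul_monomial, mul_one]

theorem expF_inl (i j : Fin d) : expF i (Sum.inl j) = if j = i then 0 else 1 := by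
  classical
  simp [expF, Finsupp.finsetSum_apply, Finsupp.single_apply, eq_comm]

theorem expF_inr (i j : Fin d) : expF i (Sum.inr j) = 0 := by
  classical
  simp [expF, Finsupp.finsetSum_apply]

theorem coeff_mul_x_pow (s : ringR k d) (j : Fin d) (n : ℕ) (m : (Fin d ⊕ Fin d) →₀ ℕ) :
    MvPowerSeries.coeff m (s * varX k d j ^ n) =
      if n ≤ m (Sum.inl j) then MvPowerSeries.coeff (m - Finsupp.single (Sum.inl j) n) s
      else 0 := by
  rw [varX, MvPowerSeries.X_pow_eq, MvPowerSeries.coeff_mul_monomial, mul_one]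
  simp only [Finsupp.single_le_iff]

theorem coeff_mul_y_pow (s : ringR k d) (j : Fin d) (n : ℕ) (m : (Fin d ⊕ Fin d) →₀ ℕ) :
    MvPowerSeries.coeff m (s * varY k d j ^ n) =
      if n ≤ m (Sum.inr j) then MvPowerSeries.coeff (m - Finsupp.single (Sum.inr j) n) s
      else 0 := by
  rw [varY, MvPowerSeries.X_pow_eq, MvPowerSeries.coeff_mul_monomial, mul_one]
  simp only [Finsupp.single_le_iff]

theorem coeff_relation (s t : Fin d → ringR k d)
    (h : ∑ i, s i * varX k d i ^ (d - 1) = ∑ i, t i * polyG k d i) (m : (Fin d ⊕ Fin d) →₀ ℕ)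
    (hx : ∀ i, m (Sum.inl i) < d) (hy : ∀ i, m (Sum.inr i) < d - 1) :
    MvPowerSeries.coeff m (∑ i, s i * monF k d i) = 0 := by
  have H : ∀ n : (Fin d ⊕ Fin d) →₀ ℕ,
      ∑ j, MvPowerSeries.coeff n (s j * varX k d j ^ (d - 1)) =
        ∑ j, MvPowerSeries.coeff n (t j * varX k d j ^ d) +
          ∑ j, MvPowerSeries.coeff n (t j * varY k d j ^ d) := by
    intro n
    have := congrArg (MvPowerSeries.coeff n) h
    simpa only [polyG, mul_add, map_sum, map_add, Finset.sum_add_distrib] using this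
  rw [map_sum]
  refine Finset.sum_eq_zero fun i _ => ?_
  rw [f_eq, MvPowerSeries.coeff_mul_monomial, mul_one]
  split_ifs with hF
  swap
  · rfl
  obtain ⟨n, rfl⟩ := exists_add_of_le hF
  rw [add_tsub_cancel_left]
  have hx' : ∀ j, (if j = i then 0 else 1) + n (Sum.inl j) < d := by
    intro j
    have := hx j
    rwa [Finsupp.add_apply, expF_inl] at this
  have hy' : ∀ j, n (Sum.inr j) < d - 1 := by
    intro j
    have := hy j
    rwa [Finsupp.add_apply, expF_inr, zero_add] at this
  have hxi : n (Sum.inl i) < d := by simpa using hx' i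
  have hxj : ∀ j, j ≠ i → n (Sum.inl j) < d - 1 := by
    intro j hj
    have := hx' j
    rw [if_neg hj] at this
    omega
  -- compare coefficients at `n + (d-1) x_i`
  have E := H (n + Finsupp.single (Sum.inl i) (d - 1))
  simp only [coeff_mul_x_pow, coeff_mul_y_pow] at E
  rw [Finset.sum_eq_single i, Finset.sum_eq_single i, Finset.sum_eq_zero] at E
  · simp only [Finsupp.add_apply, Finsupp.single_eq_same, le_add_iff_nonneg_left, zero_le,
      if_true, add_tsub_cancel_right, add_zero] at E
    rw [E]
    split_ifs with hd
    swap
    · rfl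
    set n' := n + Finsupp.single (Sum.inl i) (d - 1) - Finsupp.single (Sum.inl i) d with hn'
    have hn'x : ∀ j, n' (Sum.inl j) < d - 1 := by
      intro j
      by_cases hj : j = i
      · subst hj
        simp only [hn', Finsupp.tsub_apply, Finsupp.add_apply, Finsupp.single_eq_same]
        omega
      · have h1 := hxj j hj
        have h2 : (Sum.inl i : Fin d ⊕ Fin d) ≠ Sum.inl j := fun h => hj (Sum.inl.inj h).symm
        simp only [hn', Finsupp.tsub_apply, Finsupp.add_apply, Finsupp.single_eq_of_ne' h2]
        omega
    have hn'y : ∀ j, n' (Sum.inr j) < d - 1 := by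
      intro j
      have h1 := hy' j
      simpa [hn'] using h1
    -- compare coefficients at `n' + d y_i`
    have E' := H (n' + Finsupp.single (Sum.inr i) d)
    simp only [coeff_mul_x_pow, coeff_mul_y_pow] at E'
    rw [Finset.sum_eq_zero, Finset.sum_eq_zero, Finset.sum_eq_single i] at E'
    · simpa using E'.symm
    · intro j _ hj
      have h1 := hn'y j
      have h2 : (Sum.inr i : Fin d ⊕ Fin d) ≠ Sum.inr j := fun h => hj (Sum.inr.inj h).symm
      rw [if_neg]
      simp only [Finsupp.add_apply, Finsupp.single_eq_of_ne' h2]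
      omega
    · simp
    · intro j _
      have h1 := hn'x j
      rw [if_neg]
      simp
      omega
    · intro j _
      have h1 := hn'x j
      rw [if_neg]
      simp
      omega
  · intro j _
    have h1 := hy' j
    rw [if_neg]
    simp
    omega
  · intro j _ hj
    have h1 := hxj j hj
    have h2 : (Sum.inl i : Fin d ⊕ Fin d) ≠ Sum.inl j := fun h => hj (Sum.inl.inj h).symm
    rw [if_neg]
    simp only [Finsupp.add_apply, Finsupp.single_eq_of_ne' h2]
    omega
  · simp
  · intro j _ hj
    have h1 := hxj j hj
    have h2 : (Sum.inl i : Fin d ⊕ Fin d) ≠ Sum.inl j := fun h => hj (Sum.inl.inj h).symm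
    rw [if_neg]
    simp only [Finsupp.add_apply, Finsupp.single_eq_of_ne' h2]
    omega
  · simp

/-- Every relation `∑ s_i x_i ^ (d-1) = 0` in `S` satisfies `∑ s_i f_i ∈ (y_1 ^ (d-1), …)`; this
is what makes `η` well defined. -/
theorem sum_mul_f_mem (s : Fin d → ringS k d)
    (h : ∑ i, s i * toS k d (varX k d i ^ (d - 1)) = 0) :
    ∑ i, s i * toS k d (monF k d i) ∈ idealY k d := by
  choose s' hs' using fun i => Ideal.Quotient.mk_surjective (s i)
  obtain rfl : (fun i => toS k d (s' i)) = s := funext hs'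
  simp only [← map_mul, ← map_sum] at h ⊢
  rw [Ideal.Quotient.eq_zero_iff_mem, idealA, Ideal.mem_span_range_iff_exists_fun] at h
  obtain ⟨t, ht⟩ := h
  let e : Fin d ⊕ Fin d → (Fin d ⊕ Fin d) →₀ ℕ :=
    Sum.elim (fun i => Finsupp.single (Sum.inl i) d) (fun i => Finsupp.single (Sum.inr i) (d - 1))
  have hmem := mem_span_monomial e (∑ i, s' i * monF k d i) (by
    intro m hm
    by_contra! hc
    refine hm (coeff_relation s' t ht.symm m (fun i => ?_) (fun i => ?_))
    · have := hc (Sum.inl i)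
      simp only [e, Sum.elim_inl, Finsupp.single_le_iff] at this
      omega
    · have := hc (Sum.inr i)
      simp only [e, Sum.elim_inr, Finsupp.single_le_iff] at this
      omega)
  have hle : Ideal.span (Set.range fun i => MvPowerSeries.monomial (e i) (1 : k)) ≤
      (idealY k d).comap (toS k d) := by
    rw [Ideal.span_le]
    rintro _ ⟨i | i, rfl⟩
    · have hY : toS k d (varY k d i ^ d) ∈ idealY k d := by
        have hd : d = (d - 1) + 1 := by have := i.pos; omega
        have h1 : varY k d i ^ d = varY k d i * varY k d i ^ (d - 1) := by
          rw [← pow_succ', ← hd]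
        rw [h1, map_mul]
        exact Ideal.mul_mem_left _ _ (Ideal.subset_span ⟨i, rfl⟩)
      have hg : toS k d (polyG k d i) = 0 :=
        Ideal.Quotient.eq_zero_iff_mem.2 (Ideal.subset_span ⟨i, rfl⟩)
      have hX : MvPowerSeries.monomial (e (Sum.inl i)) (1 : k) = polyG k d i - varY k d i ^ d := by
        simp [e, polyG, varX, MvPowerSeries.X_pow_eq]
      change toS k d (MvPowerSeries.monomial (e (Sum.inl i)) (1 : k)) ∈ idealY k d
      rw [hX, map_sub, hg, zero_sub]
      exact neg_mem hY
    · have hX : MvPowerSeries.monomial (e (Sum.inr i)) (1 : k) = varY k d i ^ (d - 1) := by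
        simp [e, varY, MvPowerSeries.X_pow_eq]
      change toS k d (MvPowerSeries.monomial (e (Sum.inr i)) (1 : k)) ∈ idealY k d
      rw [hX]
      exact Ideal.subset_span ⟨i, rfl⟩
  exact hle hmem

variable (k d)

/-- The map `S ^ d → S` with `e_i ↦ x_i ^ (d-1)`, whose image is `idealX`. -/
def combX : (Fin d → ringS k d) →ₗ[ringS k d] ringS k d :=
  Fintype.linearCombination (ringS k d) fun i => toS k d (varX k d i ^ (d - 1))

/-- The map `S ^ d → S / (y_1 ^ (d-1), …, y_d ^ (d-1))` with `e_i ↦ - f_i`. -/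
def combF : (Fin d → ringS k d) →ₗ[ringS k d] (ringS k d ⧸ idealY k d) :=
  Fintype.linearCombination (ringS k d) fun i => -Ideal.Quotient.mk (idealY k d) (toS k d (monF k d i))

theorem range_combX : LinearMap.range (combX k d) = idealX k d := by
  rw [combX, Fintype.range_linearCombination]
  rfl

theorem ker_combX_le : LinearMap.ker (combX k d) ≤ LinearMap.ker (combF k d) := by
  intro s hs
  rw [LinearMap.mem_ker] at hs ⊢
  have h1 := sum_mul_f_mem s (by simpa [combX, Fintype.linearCombination_apply] using hs)
  have h2 : combF k d s =
      -Ideal.Quotient.mk (idealY k d) (∑ i, s i * toS k d (monF k d i)) := by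
    rw [combF, Fintype.linearCombination_apply, map_sum, ← Finset.sum_neg_distrib]
    refine Finset.sum_congr rfl fun i _ => ?_
    rw [smul_neg, map_mul]
    rfl
  rw [h2, Ideal.Quotient.eq_zero_iff_mem.2 h1, neg_zero]

/-- The `S`-linear map `η : (x_1 ^ (d-1), …, x_d ^ (d-1)) → S / (y_1 ^ (d-1), …, y_d ^ (d-1))`
with `η (x_i ^ (d-1)) = - f_i` (see `eta_apply`). -/
def eta : idealX k d →ₗ[ringS k d] (ringS k d ⧸ idealY k d) :=
  (LinearMap.ker (combX k d)).liftQ (combF k d) (ker_combX_le k d) ∘ₗ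
    ((LinearEquiv.ofEq _ _ (range_combX k d)).symm.trans
      (combX k d).quotKerEquivRange.symm).toLinearMap

theorem eta_apply (i : Fin d) :
    eta k d ⟨toS k d (varX k d i ^ (d - 1)), Ideal.subset_span ⟨i, rfl⟩⟩ =
      -Ideal.Quotient.mk (idealY k d) (toS k d (monF k d i)) := by
  have h : ((LinearEquiv.ofEq _ _ (range_combX k d)).symm.trans
      (combX k d).quotKerEquivRange.symm)
        ⟨toS k d (varX k d i ^ (d - 1)), Ideal.subset_span ⟨i, rfl⟩⟩ =
      Submodule.Quotient.mk (Pi.single i 1) := by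
    rw [LinearEquiv.trans_apply, LinearEquiv.symm_apply_eq]
    apply Subtype.ext
    rw [LinearMap.quotKerEquivRange_apply_mk]
    have h1 : combX k d (Pi.single i 1) = toS k d (varX k d i ^ (d - 1)) := by
      rw [combX, Fintype.linearCombination_apply_single, one_smul]
    exact h1.symm
  rw [eta, LinearMap.comp_apply, LinearEquiv.coe_coe, h]
  simp [combF]

/-- The `S`-module `M`: the pushout of the inclusion `(x_1 ^ (d-1), …, x_d ^ (d-1)) → S` and of
`η : (x_1 ^ (d-1), …, x_d ^ (d-1)) → S / (y_1 ^ (d-1), …, y_d ^ (d-1))`. -/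
abbrev moduleM : Type u := PushoutModule (Submodule.subtype (idealX k d)) (eta k d)

end Example

end

end SerreLifting

open SerreLifting

/-! Put F = R². Over R the module M is F/(N + 𝔞F), where N (`relModule`) is generated by the
(x_i^(d-1), f_i) and the (0, y_i^(d-1)). These generators are forms of degree d-1, while 𝔞 lies in
𝔪^d, so a submodule K with K + 𝔞F = N + 𝔞F has the same relations as N up to terms of higher degree.

Both negative assertions rest on `not_inf_smul_top_le`: no such K satisfies K ∩ 𝔞F ⊆ 𝔞K, that is,
Tor_1(F/K, S) never vanishes. Suppose that it does, and compute dim_k F/(K + 𝔞^n F) in two ways.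
From below: the g_i are quasi-regular on F, so the 𝔞-adic associated graded module of F/K is a
polynomial module over M. As M contains 2(d-1)^d d^d independent monomials, the dimension is at
least 2(d-1)^d d^d times the number of α with |α| < n, which grows like 2(d-1)^d d^d n^d/d!. From
above: 𝔪^(dn+2d²)F lies in K + 𝔞^n F, so monomials of degree below dn+2d² span. In the first
coordinate the x-exponents may be taken below d-1, which gives about (d-1)^d (dn)^d/d! of them. In
the second coordinate the y-exponents may be taken below d-1, and x_i^(d-1)(x_j^(d-1), f_j) -
x_j^(d-1)(x_i^(d-1), f_i) = (0, x_i^(d-1) f_j - x_j^(d-1) f_i) allows lowering an x-exponent below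
d. Only O(n^(d-1)) monomials remain there. This is the purpose of the twist by f_i: it halves the
leading term, and the two bounds contradict each other.

A naive lift has the form F/K by Nakayama. By completeness of R a lifting system is {F/(K + 𝔞^n F)}
for some K. An x in K ∩ 𝔞F outside 𝔞K gives compatible Tor_1 classes, and if all of them vanished,
then x would lie in 𝔞K + 𝔞^(n+2)F for all n, hence in 𝔞K by Krull's intersection theorem.

On the positive side, division by the g_i gives all regularity statements; M is an extension of
S/(x_i^(d-1)) by S/(y_i^(d-1)), hence has finite projective dimension; and F/N provides both the
lifting system and a naive lift of dimension d. -/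

namespace SerreLifting

noncomputable section

/-! ### Division of power series by X_p^n + X_q^n and by powers of a variable -/

section DivisionOperators

variable {σ k : Type*} [Field k]

theorem coeff_mul_X_pow (s : MvPowerSeries σ k) (v : σ) (n : ℕ) (m : σ →₀ ℕ) :
    MvPowerSeries.coeff m (s * MvPowerSeries.X v ^ n) =
      if n ≤ m v then MvPowerSeries.coeff (m - Finsupp.single v n) s else 0 := by
  classical
  rw [MvPowerSeries.X_pow_eq, MvPowerSeries.coeff_mul_monomial, mul_one]
  simp only [Finsupp.single_le_iff]

/-- The coefficient of index `j` in the expansion of `divOp`. -/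
def divCoeff (p q : σ) (n : ℕ) (h : MvPowerSeries σ k) (m : σ →₀ ℕ) (j : ℕ) : k :=
  if j * n ≤ m q then
    (-1) ^ j * MvPowerSeries.coeff
      (m + Finsupp.single p ((j + 1) * n) - Finsupp.single q (j * n)) h
  else 0

/-- The quotient in the division by `X p ^ n + X q ^ n` with respect to the variable `X p`. -/
def divOp (p q : σ) (n : ℕ) : MvPowerSeries σ k →+ MvPowerSeries σ k where
  toFun h := fun m => ∑ j ∈ Finset.range (m q + 1), divCoeff p q n h m j
  map_zero' := by
    funext m
    exact Finset.sum_eq_zero fun j _ => by simp [divCoeff]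
  map_add' h h' := by
    funext m
    change _ = (∑ j ∈ Finset.range (m q + 1), divCoeff p q n h m j) +
      ∑ j ∈ Finset.range (m q + 1), divCoeff p q n h' m j
    rw [← Finset.sum_add_distrib]
    refine Finset.sum_congr rfl fun j _ => ?_
    unfold divCoeff
    split_ifs
    · rw [map_add, mul_add]
    · rw [add_zero]

theorem coeff_divOp (p q : σ) {n : ℕ} (hn : 0 < n) (h : MvPowerSeries σ k) (m : σ →₀ ℕ) {N : ℕ}
    (hN : m q < N) :
    MvPowerSeries.coeff m (divOp p q n h) = ∑ j ∈ Finset.range N, divCoeff p q n h m j := by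
  change ∑ j ∈ Finset.range (m q + 1), divCoeff p q n h m j = _
  refine Finset.sum_subset (Finset.range_mono hN) fun j _ hj => ?_
  rw [Finset.mem_range, not_lt] at hj
  rw [divCoeff, if_neg]
  nlinarith

/-- The operator is multiplication by the expansion ∑ (-1)^j X_q^(jn) X_p^(-(j+1)n) of 1/(X_p^n +
X_q^n), keeping the nonnegative exponents of X_p. Each coefficient is a finite sum because jn cannot
exceed the exponent of X_q. Applied to a multiple of X_p^n + X_q^n, the sum telescopes. -/
theorem divOp_mul_add {p q : σ} (hpq : p ≠ q) {n : ℕ} (hn : 0 < n) (h : MvPowerSeries σ k) :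
    divOp p q n (h * (MvPowerSeries.X p ^ n + MvPowerSeries.X q ^ n)) = h := by
  classical
  ext m
  rw [coeff_divOp p q hn _ m (Nat.lt_succ_self _)]
  -- `A j` is the coefficient at m of (-1)^j X_q^(jn) X_p^(-jn) h. The sum telescopes to `A 0`,
  -- which is the coefficient of h itself.
  set A : ℕ → k := fun j => if j * n ≤ m q then
    (-1) ^ j * MvPowerSeries.coeff (m + Finsupp.single p (j * n) - Finsupp.single q (j * n)) h
    else 0 with hA
  have key : ∀ j, divCoeff p q n (h * (MvPowerSeries.X p ^ n + MvPowerSeries.X q ^ n)) m j =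
      A j - A (j + 1) := by
    intro j
    simp only [divCoeff, hA, mul_add, map_add, coeff_mul_X_pow]
    have h1 : (m + Finsupp.single p ((j + 1) * n) - Finsupp.single q (j * n)) p =
        m p + (j + 1) * n := by simp [hpq]
    have h2 : (m + Finsupp.single p ((j + 1) * n) - Finsupp.single q (j * n)) q =
        m q - j * n := by simp [hpq.symm]
    rw [h1, h2, if_pos (show n ≤ m p + (j + 1) * n by nlinarith)]
    have h3 : m + Finsupp.single p ((j + 1) * n) - Finsupp.single q (j * n) -
        Finsupp.single p n = m + Finsupp.single p (j * n) - Finsupp.single q (j * n) := by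
      ext v
      by_cases hv : p = v
      · subst hv; simp [hpq.symm, add_mul, ← add_assoc]
      · simp [Finsupp.single_eq_of_ne' hv]
    have h4 : m + Finsupp.single p ((j + 1) * n) - Finsupp.single q (j * n) -
        Finsupp.single q n = m + Finsupp.single p ((j + 1) * n) -
          Finsupp.single q ((j + 1) * n) := by
      rw [tsub_tsub, ← Finsupp.single_add, add_mul, one_mul]
    rw [h3, h4]
    by_cases c1 : (j + 1) * n ≤ m q
    · have c2 : j * n ≤ m q := le_trans (by nlinarith) c1
      have c3 : n ≤ m q - j * n := by
        have : (j + 1) * n = j * n + n := by ring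
        omega
      rw [if_pos c1, if_pos c2, if_pos c2, if_pos c3, pow_succ]
      ring
    · rw [if_neg c1]
      by_cases c2 : j * n ≤ m q
      · have c3 : ¬ n ≤ m q - j * n := by
          have : (j + 1) * n = j * n + n := by ring
          omega
        rw [if_pos c2, if_pos c2, if_neg c3]
        ring
      · rw [if_neg c2, if_neg c2, sub_zero]
  rw [Finset.sum_congr rfl fun j _ => key j, Finset.sum_range_sub']
  have h0 : A (m q + 1) = 0 := by
    simp only [hA]
    rw [if_neg]
    nlinarith
  rw [h0]
  simp [hA]

/-- Division with respect to X_p treats all other variables as scalars; this includes v = q, the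
second variable of the divisor. -/
theorem divOp_mul_X_pow {p q : σ} (hpq : p ≠ q) {n : ℕ} (hn : 0 < n) {v : σ} (hv : v ≠ p) (e : ℕ)
    (h : MvPowerSeries σ k) :
    divOp p q n (h * MvPowerSeries.X v ^ e) = divOp p q n h * MvPowerSeries.X v ^ e := by
  classical
  ext m
  rw [coeff_mul_X_pow, coeff_divOp p q hn _ m (Nat.lt_succ_self _)]
  have hm : (m - Finsupp.single v e) q < m q + 1 := by
    rw [Finsupp.tsub_apply]; omega
  rw [coeff_divOp p q hn _ _ hm]
  have hvp : ∀ j, (m + Finsupp.single p ((j + 1) * n) - Finsupp.single q (j * n)) v =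
      m v - Finsupp.single q (j * n) v := by
    intro j; simp [hv]
  have hsub : ∀ j, e ≤ m v → m + Finsupp.single p ((j + 1) * n) - Finsupp.single q (j * n) -
      Finsupp.single v e =
      m - Finsupp.single v e + Finsupp.single p ((j + 1) * n) - Finsupp.single q (j * n) := by
    intro j he
    ext w
    by_cases hw : v = w
    · subst hw
      simp [hv]
      omega
    · simp [Finsupp.single_eq_of_ne' hw]
  split_ifs with he
  · refine Finset.sum_congr rfl fun j _ => ?_
    simp only [divCoeff, coeff_mul_X_pow, hvp, hsub j he]
    by_cases hq : v = q
    · subst hq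
      simp only [Finsupp.single_eq_same, Finsupp.tsub_apply]
      by_cases c : j * n ≤ m v - e
      · rw [if_pos c, if_pos (by omega), if_pos (by omega)]
      · rw [if_neg c]
        split_ifs
        · omega
        · simp
        · rfl
    · simp [Finsupp.single_eq_of_ne hq, Finsupp.single_eq_of_ne' hq, he]
  · refine Finset.sum_eq_zero fun j _ => ?_
    simp only [divCoeff, coeff_mul_X_pow, hvp]
    rw [if_neg (show ¬ e ≤ m v - _ by omega), mul_zero, ite_self]

/-- The operator that divides the monomials divisible by `X v ^ e` by `X v ^ e` and kills the
others. -/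
def shiftOp (v : σ) (e : ℕ) : MvPowerSeries σ k →+ MvPowerSeries σ k where
  toFun h := fun m => MvPowerSeries.coeff (m + Finsupp.single v e) h
  map_zero' := by
    funext m
    exact map_zero _
  map_add' h h' := by
    funext m
    rw [map_add]
    rfl

theorem coeff_shiftOp (v : σ) (e : ℕ) (h : MvPowerSeries σ k) (m : σ →₀ ℕ) :
    MvPowerSeries.coeff m (shiftOp v e h) = MvPowerSeries.coeff (m + Finsupp.single v e) h := rfl

theorem shiftOp_mul_self (v : σ) (e : ℕ) (h : MvPowerSeries σ k) :
    shiftOp v e (h * MvPowerSeries.X v ^ e) = h := by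
  classical
  ext m
  rw [coeff_shiftOp, coeff_mul_X_pow]
  simp

theorem shiftOp_mul_X_pow {v w : σ} (hvw : w ≠ v) (e f : ℕ) (h : MvPowerSeries σ k) :
    shiftOp v e (h * MvPowerSeries.X w ^ f) = shiftOp v e h * MvPowerSeries.X w ^ f := by
  classical
  ext m
  rw [coeff_shiftOp, coeff_mul_X_pow, coeff_mul_X_pow, coeff_shiftOp]
  have h1 : (m + Finsupp.single v e) w = m w := by simp [hvw]
  rw [h1]
  split_ifs with hf
  · congr 2
    ext t
    by_cases ht : w = t
    · subst ht; simp [hvw]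
    · simp [Finsupp.single_eq_of_ne' ht]
  · rfl

end DivisionOperators

/-! ### Quasi-regularity and the 𝔞-adic associated graded module -/

section QuasiRegular

theorem division_mul_prod_pow {R ι : Type*} [CommRing R] [DecidableEq ι] {g : ι → R}
    {D : ι → R →+ R} (hc : ∀ i l, l ≠ i → ∀ h, D i (h * g l) = D i h * g l) (i : ι)
    (α : ι → ℕ) (s : Finset ι) (hs : i ∉ s) (h : R) :
    D i (h * ∏ l ∈ s, g l ^ α l) = D i h * ∏ l ∈ s, g l ^ α l := by
  have hp : ∀ l, l ≠ i → ∀ (e : ℕ) (h : R), D i (h * g l ^ e) = D i h * g l ^ e := by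
    intro l hl e
    induction e with
    | zero => simp
    | succ e ih =>
      intro h
      rw [pow_succ, ← mul_assoc, hc i l hl, ih, mul_assoc]
  induction s using Finset.induction_on generalizing h with
  | empty => simp
  | insert a s ha ih =>
    rw [Finset.prod_insert ha, ← mul_assoc, ih (fun hi => hs (Finset.mem_insert_of_mem hi)),
      hp a (fun hai => hs (hai ▸ Finset.mem_insert_self _ _)), mul_assoc]

variable {R ι : Type*} [CommRing R] [Fintype ι] [DecidableEq ι]

theorem span_range_pow_le (g : ι → R) (n : ℕ) :
    Ideal.span (Set.range g) ^ n ≤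
      Ideal.span ((fun α : ι → ℕ => ∏ i, g i ^ α i) '' (Finset.piAntidiag Finset.univ n : Finset (ι → ℕ))) := by
  induction n with
  | zero =>
    have h : (1 : R) ∈ Ideal.span ((fun α : ι → ℕ => ∏ i, g i ^ α i) ''
        (Finset.piAntidiag Finset.univ 0 : Finset (ι → ℕ))) :=
      Ideal.subset_span ⟨0, by simp, by simp⟩
    rw [(Ideal.eq_top_iff_one _).2 h]
    exact le_top
  | succ n ih =>
    rw [pow_succ]
    refine (Ideal.mul_mono_left ih).trans ?_
    rw [Ideal.span_mul_span', Ideal.span_le]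
    rintro _ ⟨_, ⟨α, hα, rfl⟩, _, ⟨i, rfl⟩, rfl⟩
    refine Ideal.subset_span ⟨α + Pi.single i 1, ?_, ?_⟩
    · simp only [Finset.mem_coe, Finset.mem_piAntidiag] at hα ⊢
      simp [Finset.sum_add_distrib, hα.1]
    · simp only [Pi.add_apply, pow_add, Finset.prod_mul_distrib]
      congr 1
      rw [Finset.prod_eq_single i]
      · simp
      · intro j _ hj; simp [hj]
      · simp

theorem prod_pow_mem_span_range_pow {R ι : Type*} [CommRing R] [Fintype ι] (g : ι → R) (α : ι → ℕ) :
    ∏ i, g i ^ α i ∈ Ideal.span (Set.range g) ^ ∑ i, α i := by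
  rw [← Finset.prod_pow_eq_pow_sum]
  have h := Ideal.prod_mem_prod (s := Finset.univ) (I := fun i => Ideal.span (Set.range g) ^ α i)
    (x := fun i => g i ^ α i) fun i _ => Ideal.pow_mem_pow (Ideal.subset_span (Set.mem_range_self i)) _
  exact h

theorem exists_eq_sum_of_mem_pow_smul {F : Type*} [AddCommGroup F] [Module R F] (g : ι → R)
    (n : ℕ) (N : Submodule R F) {z : F} (hz : z ∈ Ideal.span (Set.range g) ^ n • N) :
    ∃ c : (ι → ℕ) → F, (∀ α, c α ∈ N) ∧
      z = ∑ α ∈ Finset.piAntidiag Finset.univ n, (∏ i, g i ^ α i) • c α := by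
  induction hz using Submodule.smul_induction_on' with
  | smul r hr x hx =>
    have h := span_range_pow_le g n hr
    rw [Ideal.span, Submodule.mem_span_image_finset_iff_exists_fun'] at h
    obtain ⟨c, rfl⟩ := h
    refine ⟨fun α => c α • x, fun α => N.smul_mem _ hx, ?_⟩
    rw [Finset.sum_smul]
    refine Finset.sum_congr rfl fun α _ => ?_
    rw [smul_smul, smul_eq_mul, mul_comm]
  | add x _ y _ hx hy =>
    obtain ⟨c, hc, hx⟩ := hx
    obtain ⟨e, he, hy⟩ := hy
    exact ⟨fun α => c α + e α, fun α => N.add_mem (hc α) (he α), by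
      rw [hx, hy, ← Finset.sum_add_distrib]
      simp only [smul_add]⟩

section

variable {g : ι → R} {D : ι → R →+ R}

/-- Dividing by g_i costs at most one order: a product y g_i becomes y, and in y g_l with l ≠ i the
factor g_l survives and the induction applies to y. -/
theorem division_mem_span_pow (hD : ∀ i h, D i (h * g i) = h)
    (hc : ∀ i l, l ≠ i → ∀ h, D i (h * g l) = D i h * g l) (i : ι) (n : ℕ) {x : R}
    (hx : x ∈ Ideal.span (Set.range g) ^ (n + 1)) : D i x ∈ Ideal.span (Set.range g) ^ n := by
  induction n generalizing x with
  | zero => simp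
  | succ n ih =>
    rw [pow_succ] at hx
    refine Submodule.mul_induction_on hx (fun y hy s hs => ?_) (fun y z hy hz => ?_)
    · rw [Ideal.mem_span_range_iff_exists_fun] at hs
      obtain ⟨c, rfl⟩ := hs
      rw [Finset.mul_sum, map_sum]
      refine Ideal.sum_mem _ fun l _ => ?_
      rw [← mul_assoc]
      by_cases hl : l = i
      · subst hl
        rw [hD]
        exact Ideal.mul_mem_right _ _ hy
      · rw [hc i l hl, pow_succ]
        exact Ideal.mul_mem_mul (ih (Ideal.mul_mem_right _ _ hy)) (Ideal.subset_span ⟨l, rfl⟩)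
    · rw [map_add]
      exact Ideal.add_mem _ hy hz

/-- Induction on the degree of the form. To reach the coefficient of g^α, choose i with α_i > 0 and
apply D_i: this removes one g_i from every monomial containing it and yields a form of degree one
less. -/
theorem quasiRegular_of_division (hD : ∀ i h, D i (h * g i) = h)
    (hc : ∀ i l, l ≠ i → ∀ h, D i (h * g l) = D i h * g l) (n : ℕ) (T : Finset (ι → ℕ))
    (hT : ∀ α ∈ T, ∑ i, α i = n) (r : (ι → ℕ) → R)
    (h : ∑ α ∈ T, r α * ∏ i, g i ^ α i ∈ Ideal.span (Set.range g) ^ (n + 1)) :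
    ∀ α ∈ T, r α ∈ Ideal.span (Set.range g) := by
  induction n generalizing T r with
  | zero =>
    intro α hα
    have h0 : ∀ β ∈ T, β = 0 := by
      intro β hβ
      have := hT β hβ
      rw [Finset.sum_eq_zero_iff] at this
      exact funext fun i => this i (Finset.mem_univ i)
    have hT' : T = {0} := by
      refine Finset.eq_singleton_iff_unique_mem.2 ⟨h0 α hα ▸ hα, h0⟩
    rw [hT', Finset.sum_singleton] at h
    rw [h0 α hα]
    simpa using h
  | succ n ih =>
    intro α hα
    obtain ⟨i, hi⟩ : ∃ i, α i ≠ 0 := by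
      by_contra! hc
      have := hT α hα
      simp [hc] at this
    have key : ∀ β : ι → ℕ, β i ≠ 0 → ∏ l, g l ^ β l =
        (∏ l, g l ^ (β - Pi.single i 1 : ι → ℕ) l) * g i := by
      intro β hβ
      rw [← Finset.mul_prod_erase _ _ (Finset.mem_univ i),
        ← Finset.mul_prod_erase Finset.univ _ (Finset.mem_univ i)]
      have h1 : ∏ l ∈ Finset.univ.erase i, g l ^ (β - Pi.single i 1 : ι → ℕ) l =
          ∏ l ∈ Finset.univ.erase i, g l ^ β l := by
        refine Finset.prod_congr rfl fun l hl => ?_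
        simp [Finset.ne_of_mem_erase hl]
      rw [h1]
      have h2 : g i ^ β i = g i ^ (β - Pi.single i 1 : ι → ℕ) i * g i := by
        rw [← pow_succ]
        congr 1
        simp
        omega
      rw [h2]
      ring
    have h1 := division_mem_span_pow hD hc i (n + 1) h
    rw [map_sum, ← Finset.sum_filter_add_sum_filter_not T (fun β => β i ≠ 0)] at h1
    -- In the monomials free of g_i the operator passes to the coefficient and the full product
    -- stays, so these terms can be discarded.
    have h2 : ∑ β ∈ T with ¬ β i ≠ 0, D i (r β * ∏ l, g l ^ β l) ∈
        Ideal.span (Set.range g) ^ (n + 1) := by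
      refine Ideal.sum_mem _ fun β hβ => ?_
      obtain ⟨hβT, hβ⟩ := Finset.mem_filter.1 hβ
      rw [not_not] at hβ
      have h3 := prod_pow_mem_span_range_pow g β
      rw [hT β hβT] at h3
      rw [← Finset.mul_prod_erase _ _ (Finset.mem_univ i), hβ, pow_zero, one_mul] at h3 ⊢
      rw [division_mul_prod_pow hc i β _ (Finset.notMem_erase _ _)]
      exact Ideal.mul_mem_left _ _ h3
    have h3 := (Ideal.add_mem_iff_left _ h2).1 h1
    have hinj : Set.InjOn (fun β : ι → ℕ => β - Pi.single i 1) (T.filter fun β => β i ≠ 0) := by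
      intro β hβ γ hγ hβγ
      have hβ := (Finset.mem_filter.1 hβ).2
      have hγ := (Finset.mem_filter.1 hγ).2
      funext l
      have := congrFun hβγ l
      by_cases hl : l = i
      · subst hl; simp at this; omega
      · simpa [hl] using this
    have hadd : ∀ β : ι → ℕ, β i ≠ 0 → β - Pi.single i 1 + Pi.single i 1 = β := by
      intro β hβ
      funext l
      by_cases hl : l = i
      · subst hl; simp; omega
      · simp [hl]
    have h4 := ih ((T.filter fun β => β i ≠ 0).image fun β => β - Pi.single i 1)
      (by
        intro β' hβ'
        obtain ⟨β, hβ, rfl⟩ := Finset.mem_image.1 hβ'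
        obtain ⟨hβT, hβ⟩ := Finset.mem_filter.1 hβ
        have h5 := hT β hβT
        rw [← hadd β hβ] at h5
        simp only [Pi.add_apply, Finset.sum_add_distrib, Finset.sum_pi_single', Finset.mem_univ,
          if_true] at h5
        simpa using h5)
      (fun β => r (β + Pi.single i 1))
      (by
        rw [Finset.sum_image hinj]
        convert h3 using 1
        refine Finset.sum_congr rfl fun β hβ => ?_
        have hβ := (Finset.mem_filter.1 hβ).2
        rw [hadd β hβ, key β hβ, ← mul_assoc, hD])
      (α - Pi.single i 1) (Finset.mem_image_of_mem _ (Finset.mem_filter.2 ⟨hα, hi⟩))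
    simpa only [hadd α hi] using h4

end

theorem mem_smul_top_prod (I : Ideal R) (z : R × R) :
    z ∈ I • (⊤ : Submodule R (R × R)) ↔ z.1 ∈ I ∧ z.2 ∈ I := by
  constructor
  · intro hz
    refine Submodule.smul_induction_on hz (fun r hr x _ => ?_) (fun x y hx hy => ?_)
    · exact ⟨Ideal.mul_mem_right _ _ hr, Ideal.mul_mem_right _ _ hr⟩
    · exact ⟨I.add_mem hx.1 hy.1, I.add_mem hx.2 hy.2⟩
  · rintro ⟨h1, h2⟩
    have : z = z.1 • (1, 0) + z.2 • (0, 1) := by ext <;> simp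
    rw [this]
    exact Submodule.add_mem _ (Submodule.smul_mem_smul h1 trivial)
      (Submodule.smul_mem_smul h2 trivial)

/-- A sequence `g` is quasi-regular on `F`: a form in `g` of degree `n` lies in `(g) ^ (n + 1) F`
only if its coefficients lie in `(g) F`. -/
def IsQuasiRegularOn (g : ι → R) (F : Type*) [AddCommGroup F] [Module R F] : Prop :=
  ∀ (n : ℕ) (r : (ι → ℕ) → F), ∑ α ∈ Finset.piAntidiag Finset.univ n, (∏ i, g i ^ α i) • r α ∈
    Ideal.span (Set.range g) ^ (n + 1) • (⊤ : Submodule R F) →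
      ∀ α ∈ Finset.piAntidiag Finset.univ n, r α ∈ Ideal.span (Set.range g) • (⊤ : Submodule R F)

theorem isQuasiRegularOn_prod_of_division {g : ι → R} {D : ι → R →+ R}
    (hD : ∀ i h, D i (h * g i) = h) (hc : ∀ i l, l ≠ i → ∀ h, D i (h * g l) = D i h * g l) :
    IsQuasiRegularOn g (R × R) := by
  intro n r h α hα
  rw [mem_smul_top_prod] at h ⊢
  have hT : ∀ α ∈ Finset.piAntidiag (Finset.univ : Finset ι) n, ∑ i, α i = n :=
    fun α hα => (Finset.mem_piAntidiag.1 hα).1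
  constructor
  · refine quasiRegular_of_division hD hc n _ hT (fun α => (r α).1) ?_ α hα
    simpa [Prod.fst_sum, mul_comm] using h.1
  · refine quasiRegular_of_division hD hc n _ hT (fun α => (r α).2) ?_ α hα
    simpa [Prod.snd_sum, mul_comm] using h.2

variable {F : Type*} [AddCommGroup F] [Module R F]

/-- An element of K ∩ 𝔞^(n+1)F is by induction a form of degree n in g with coefficients in K.
Quasi-regularity puts these coefficients in 𝔞F, hence in K ∩ 𝔞F ⊆ 𝔞K. -/
theorem inf_pow_smul_top_le {g : ι → R} (hg : IsQuasiRegularOn g F) (K : Submodule R F)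
    (hK : K ⊓ Ideal.span (Set.range g) • ⊤ ≤ Ideal.span (Set.range g) • K) (n : ℕ) :
    K ⊓ Ideal.span (Set.range g) ^ n • ⊤ ≤ Ideal.span (Set.range g) ^ n • K := by
  induction n with
  | zero => simp
  | succ n ih =>
    rintro z ⟨hzK, hz⟩
    have h1 : z ∈ Ideal.span (Set.range g) ^ n • (⊤ : Submodule R F) :=
      Submodule.smul_mono_left (Ideal.pow_le_pow_right n.le_succ) hz
    obtain ⟨c, hc, hzc⟩ := exists_eq_sum_of_mem_pow_smul g n K (ih ⟨hzK, h1⟩)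
    have h2 := hg n c (by rw [← hzc]; exact hz)
    rw [hzc, pow_succ, mul_smul]
    refine Submodule.sum_mem _ fun α hα => Submodule.smul_mem_smul ?_ (hK ⟨hc α, h2 α hα⟩)
    have := prod_pow_mem_span_range_pow g α
    rwa [(Finset.mem_piAntidiag.1 hα).1] at this

/-- The 𝔞-adic associated graded module of F/K is F/(K + 𝔞F) with polynomial variables for the g_i.
Hence vectors l_b independent modulo K + 𝔞F give products g^α l_b, |α| < n, independent modulo K +
𝔞^n F. This is the lower bound of the dimension count. -/
theorem eq_zero_of_sum_mem_sup_pow_smul {k ι' : Type*} [Field k] [Algebra k R] [Module k F]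
    [IsScalarTower k R F] [Fintype ι'] {g : ι → R} (hg : IsQuasiRegularOn g F)
    (K : Submodule R F)
    (hK : K ⊓ Ideal.span (Set.range g) • ⊤ ≤ Ideal.span (Set.range g) • K) (l : ι' → F)
    (hl : ∀ c : ι' → k, ∑ b, c b • l b ∈ K ⊔ Ideal.span (Set.range g) • ⊤ → c = 0)
    (n : ℕ) (c : (ι → ℕ) → ι' → k)
    (h : ∑ s ∈ Finset.range n, ∑ α ∈ Finset.piAntidiag Finset.univ s,
      (∏ i, g i ^ α i) • ∑ b, c α b • l b ∈ K ⊔ Ideal.span (Set.range g) ^ n • ⊤)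
    (s : ℕ) (hs : s < n) : ∀ α ∈ Finset.piAntidiag Finset.univ s, c α = 0 := by
  set a := Ideal.span (Set.range g) with ha
  induction s using Nat.strong_induction_on with
  | _ s ih =>
    have hmem : ∀ (t : ℕ) (α : ι → ℕ), α ∈ Finset.piAntidiag Finset.univ t → ∀ x : F,
        (∏ i, g i ^ α i) • x ∈ a ^ t • (⊤ : Submodule R F) := by
      intro t α hα x
      refine Submodule.smul_mem_smul ?_ trivial
      have := prod_pow_mem_span_range_pow g α
      rwa [(Finset.mem_piAntidiag.1 hα).1] at this
    set z : ℕ → F := fun t => ∑ α ∈ Finset.piAntidiag Finset.univ t,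
      (∏ i, g i ^ α i) • ∑ b, c α b • l b with hz
    -- The layers of degree below s vanish by induction, and those above lie in 𝔞^(s+1)F.
    have hz1 : z s ∈ K ⊔ a ^ (s + 1) • (⊤ : Submodule R F) := by
      have h1 : ∑ t ∈ Finset.range n, z t ∈ K ⊔ a ^ (s + 1) • (⊤ : Submodule R F) :=
        (sup_le_sup le_rfl (Submodule.smul_mono_left (Ideal.pow_le_pow_right hs)) :
          K ⊔ a ^ n • (⊤ : Submodule R F) ≤ K ⊔ a ^ (s + 1) • ⊤) h
      rw [← Finset.add_sum_erase _ _ (Finset.mem_range.2 hs)] at h1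
      refine (Submodule.add_mem_iff_left _ (Submodule.sum_mem _ fun t ht => ?_)).1 h1
      obtain ⟨hts, htn⟩ := Finset.mem_erase.1 ht
      rcases lt_or_gt_of_ne hts with hlt | hgt
      · have : z t = 0 := by
          refine Finset.sum_eq_zero fun α hα => ?_
          rw [ih t hlt (hlt.trans hs) α hα]
          simp
        rw [this]
        exact Submodule.zero_mem _
      · refine Submodule.mem_sup_right (Submodule.smul_mono_left
          (Ideal.pow_le_pow_right (m := s + 1) hgt) (Submodule.sum_mem _ fun α hα => ?_))
        exact hmem t α hα _
    obtain ⟨x, hx, w, hw, hxw⟩ := Submodule.mem_sup.1 hz1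
    have hx2 : x ∈ a ^ s • (⊤ : Submodule R F) := by
      have hzs : z s ∈ a ^ s • (⊤ : Submodule R F) :=
        Submodule.sum_mem _ fun α hα => hmem s α hα _
      have hw' : w ∈ a ^ s • (⊤ : Submodule R F) :=
        Submodule.smul_mono_left (Ideal.pow_le_pow_right s.le_succ) hw
      rw [← hxw] at hzs
      exact (Submodule.add_mem_iff_left _ hw').1 hzs
    obtain ⟨e, he, hxe⟩ := exists_eq_sum_of_mem_pow_smul g s K
      (inf_pow_smul_top_le hg K hK s ⟨hx, hx2⟩)
    -- Rewriting the K-part x as a form of degree s with coefficients in K turns the relation into a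
    -- single form lying in 𝔞^(s+1)F, to which quasi-regularity applies.
    have h3 := hg s (fun α => ∑ b, c α b • l b - e α) (by
      simp only [smul_sub, Finset.sum_sub_distrib]
      rw [← hxe]
      change z s - x ∈ _
      rw [← hxw, add_sub_cancel_left]
      exact hw)
    intro α hα
    refine hl (c α) ?_
    rw [← sub_add_cancel (∑ b, c α b • l b) (e α), add_comm]
    exact Submodule.add_mem_sup (he α) (h3 α hα)

end QuasiRegular

/-! ### Powers of the maximal ideal and dimensions of quotients of power series rings -/

section PowerSeries

open IsLocalRing

variable {σ : Type*} {k : Type u} [Field k]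

theorem mem_maximalIdeal_iff_constantCoeff (p : MvPowerSeries σ k) :
    p ∈ maximalIdeal (MvPowerSeries σ k) ↔ MvPowerSeries.constantCoeff p = 0 := by
  rw [mem_maximalIdeal, mem_nonunits_iff, MvPowerSeries.isUnit_iff_constantCoeff,
    isUnit_iff_ne_zero, not_not]

theorem X_mem_maximalIdeal (v : σ) :
    (MvPowerSeries.X v : MvPowerSeries σ k) ∈ maximalIdeal (MvPowerSeries σ k) := by
  rw [mem_maximalIdeal_iff_constantCoeff, MvPowerSeries.constantCoeff_X]

theorem monomial_mem_maximalIdeal_pow (e : σ →₀ ℕ) (c : k) :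
    MvPowerSeries.monomial e c ∈ maximalIdeal (MvPowerSeries σ k) ^ e.degree := by
  classical
  induction e using Finsupp.induction generalizing c with
  | zero => simp
  | single_add v n f hv hn ih =>
    have h : MvPowerSeries.monomial (Finsupp.single v n + f) c =
        MvPowerSeries.X v ^ n * MvPowerSeries.monomial f c := by
      rw [MvPowerSeries.X_pow_eq, MvPowerSeries.monomial_mul_monomial, one_mul]
    rw [h, map_add, pow_add, Finsupp.degree_single]
    exact Ideal.mul_mem_mul (Ideal.pow_mem_pow (X_mem_maximalIdeal v) n) (ih c)

theorem coeff_eq_zero_of_mem_maximalIdeal_pow {s : ℕ} {p : MvPowerSeries σ k}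
    (hp : p ∈ maximalIdeal (MvPowerSeries σ k) ^ s) {e : σ →₀ ℕ} (he : e.degree < s) :
    MvPowerSeries.coeff e p = 0 := by
  have hle : (s : ℕ∞) ≤ p.order := by
    clear he
    induction s generalizing p with
    | zero => simp
    | succ s ih =>
      rw [pow_succ] at hp
      refine Submodule.mul_induction_on hp (fun x hx y hy => ?_) (fun x y hx hy => ?_)
      · rw [mem_maximalIdeal_iff_constantCoeff,
          ← MvPowerSeries.one_le_order_iff_constCoeff_eq_zero] at hy
        push_cast
        exact (add_le_add (ih hx) hy).trans MvPowerSeries.le_order_mul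
      · exact (le_min hx hy).trans MvPowerSeries.min_order_le_add
  exact MvPowerSeries.coeff_of_lt_order (lt_of_lt_of_le (by exact_mod_cast he) hle)

theorem mem_span_monomial_degree [Finite σ] {s : ℕ} {p : MvPowerSeries σ k}
    (hp : ∀ e : σ →₀ ℕ, e.degree < s → MvPowerSeries.coeff e p = 0) :
    p ∈ Ideal.span (Set.range fun e : {e : σ →₀ ℕ // e.degree = s} =>
      MvPowerSeries.monomial e.1 (1 : k)) := by
  have : Finite {e : σ →₀ ℕ // e.degree = s} :=
    (Finsupp.finite_of_degree_eq (σ := σ) s).to_subtype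
  have : Fintype {e : σ →₀ ℕ // e.degree = s} := Fintype.ofFinite _
  refine mem_span_monomial (fun e : {e : σ →₀ ℕ // e.degree = s} => e.1) p fun m hm => ?_
  have hs : s ≤ m.degree := by
    by_contra hlt
    exact hm (hp m (not_le.1 hlt))
  obtain ⟨e, he, hes⟩ := Finsupp.exists_le_degree_eq m s hs
  exact ⟨⟨e, hes⟩, he⟩

theorem maximalIdeal_pow_eq_span [Finite σ] (s : ℕ) :
    maximalIdeal (MvPowerSeries σ k) ^ s =
      Ideal.span (Set.range fun e : {e : σ →₀ ℕ // e.degree = s} =>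
        MvPowerSeries.monomial e.1 (1 : k)) := by
  refine le_antisymm (fun p hp => mem_span_monomial_degree fun e he =>
    coeff_eq_zero_of_mem_maximalIdeal_pow hp he) ?_
  rw [Ideal.span_le]
  rintro _ ⟨e, rfl⟩
  have := monomial_mem_maximalIdeal_pow e.1 (1 : k)
  rwa [e.2] at this

theorem maximalIdeal_eq_span_X [Finite σ] :
    maximalIdeal (MvPowerSeries σ k) = Ideal.span (Set.range MvPowerSeries.X) := by
  refine le_antisymm ?_ ?_
  · rw [← pow_one (maximalIdeal _), maximalIdeal_pow_eq_span, Ideal.span_le]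
    rintro _ ⟨⟨e, he⟩, rfl⟩
    obtain ⟨v, hv⟩ : ∃ v, e v ≠ 0 := by
      by_contra! h0
      rw [show e = 0 from Finsupp.ext h0] at he
      simp at he
    have hle : Finsupp.single v 1 ≤ e := Finsupp.single_le_iff.2 (Nat.one_le_iff_ne_zero.2 hv)
    obtain ⟨f, rfl⟩ := exists_add_of_le hle
    have h : MvPowerSeries.monomial (Finsupp.single v 1 + f) (1 : k) =
        MvPowerSeries.X v * MvPowerSeries.monomial f 1 := by
      rw [MvPowerSeries.X_def, MvPowerSeries.monomial_mul_monomial, one_mul]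
    change MvPowerSeries.monomial (Finsupp.single v 1 + f) (1 : k) ∈ _
    rw [h]
    exact Ideal.mul_mem_right _ _ (Ideal.subset_span ⟨v, rfl⟩)
  · rw [Ideal.span_le]
    rintro _ ⟨v, rfl⟩
    exact X_mem_maximalIdeal v

theorem finite_quotient_of_coeff (I : Ideal (MvPowerSeries σ k)) (T : Finset (σ →₀ ℕ))
    (h : ∀ p : MvPowerSeries σ k, (∀ m ∈ T, MvPowerSeries.coeff m p = 0) → p ∈ I) :
    Module.Finite k (MvPowerSeries σ k ⧸ I) ∧
      Module.finrank k (MvPowerSeries σ k ⧸ I) ≤ T.card := by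
  let f : MvPowerSeries σ k →ₗ[k] (T → k) := LinearMap.pi fun m => MvPowerSeries.coeff m.1
  let g : MvPowerSeries σ k →ₗ[k] (MvPowerSeries σ k ⧸ I) := (Ideal.Quotient.mkₐ k I).toLinearMap
  have hg : Function.Surjective g := Ideal.Quotient.mk_surjective
  have hfg : LinearMap.ker f ≤ LinearMap.ker g := by
    intro p hp
    have : p ∈ I := h p fun m hm => congrFun (LinearMap.mem_ker.1 hp) ⟨m, hm⟩
    exact Ideal.Quotient.eq_zero_iff_mem.2 this
  let q : LinearMap.range f →ₗ[k] (MvPowerSeries σ k ⧸ I) :=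
    (LinearMap.ker f).liftQ g hfg ∘ₗ f.quotKerEquivRange.symm.toLinearMap
  have hq : Function.Surjective q := by
    intro y
    obtain ⟨x, rfl⟩ := hg y
    exact ⟨f.quotKerEquivRange (Submodule.Quotient.mk x), by simp [q]⟩
  refine ⟨Module.Finite.of_surjective q hq, ?_⟩
  calc Module.finrank k (MvPowerSeries σ k ⧸ I) ≤ Module.finrank k (LinearMap.range f) :=
        LinearMap.finrank_le_finrank_of_surjective hq
    _ ≤ Module.finrank k (T → k) := Submodule.finrank_le _
    _ = T.card := by simp

theorem card_le_finrank_quotient (I : Ideal (MvPowerSeries σ k))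
    [Module.Finite k (MvPowerSeries σ k ⧸ I)] (T : Finset (σ →₀ ℕ))
    (h : ∀ p ∈ I, ∀ m ∈ T, MvPowerSeries.coeff m p = 0) :
    T.card ≤ Module.finrank k (MvPowerSeries σ k ⧸ I) := by
  let f : MvPowerSeries σ k →ₗ[k] (T → k) := LinearMap.pi fun m => MvPowerSeries.coeff m.1
  let q : (MvPowerSeries σ k ⧸ I) →ₗ[k] (T → k) :=
    (I.restrictScalars k).liftQ f (fun p hp => by
      rw [LinearMap.mem_ker]
      funext m
      exact h p hp m.1 m.2) ∘ₗ (Submodule.Quotient.restrictScalarsEquiv k I).symm.toLinearMap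
  have hq : Function.Surjective q := by
    classical
    intro y
    let p : MvPowerSeries σ k := fun m => if hm : m ∈ T then y ⟨m, hm⟩ else 0
    refine ⟨Ideal.Quotient.mk I p, ?_⟩
    funext m
    change MvPowerSeries.coeff m.1 p = y m
    change p m.1 = y m
    simp [p]
  calc T.card = Module.finrank k (T → k) := by simp
    _ ≤ _ := LinearMap.finrank_le_finrank_of_surjective hq

end PowerSeries

/-! ### Length equals dimension over the residue field -/

section Length

open IsLocalRing

/-- A simple quotient is killed by the maximal ideal, so it is at most a line over k because k maps
onto the residue field. The k-structure is quantified after the colon so that the induction can be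
applied to submodules with their restricted structure. -/
theorem length_le_length_of_residue {k R M : Type*} [Field k] [CommRing R] [IsLocalRing R]
    [Algebra k R] (hk : ∀ r : R, ∃ c : k, r - algebraMap k R c ∈ maximalIdeal R)
    [AddCommGroup M] [Module R M] (hM : IsFiniteLength R M) :
    ∀ (_ : Module k M) (_ : IsScalarTower k R M), Module.length k M ≤ Module.length R M := by
  induction hM with
  | of_subsingleton => intro _ _; simp
  | @of_simple_quotient M _ _ N hN _ ih =>
    intro _ _
    have h1 : Module.length k (M ⧸ N) ≤ 1 := by
      have := IsSimpleModule.nontrivial R (M ⧸ N)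
      obtain ⟨x, hx⟩ := exists_ne (0 : M ⧸ N)
      have hm : ∀ r ∈ maximalIdeal R, r • x = 0 := by
        intro r hr
        by_contra hne
        have htop := (IsSimpleModule.toSpanSingleton_surjective R hne)
        obtain ⟨s, hs⟩ := htop x
        rw [LinearMap.toSpanSingleton_apply, smul_smul] at hs
        have hu : IsUnit (1 - s * r) := by
          refine (IsLocalRing.isUnit_or_isUnit_one_sub_self (s * r)).resolve_left fun hu => ?_
          exact (mem_nonunits_iff.1 ((mem_maximalIdeal _).1
            (Ideal.mul_mem_left _ s hr))) hu
        have h0 : (1 - s * r) • x = 0 := by rw [sub_smul, one_smul, hs, sub_self]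
        exact hx (hu.smul_eq_zero.1 h0)
      have hsurj : Function.Surjective (LinearMap.toSpanSingleton k (M ⧸ N) x) := by
        intro y
        obtain ⟨r, rfl⟩ := IsSimpleModule.toSpanSingleton_surjective R hx y
        obtain ⟨c, hc⟩ := hk r
        refine ⟨c, ?_⟩
        have := hm _ hc
        rw [sub_smul, sub_eq_zero, algebraMap_smul] at this
        simp [this]
      calc Module.length k (M ⧸ N) ≤ Module.length k k := Module.length_le_of_surjective _ hsurj
        _ = 1 := by rw [Module.length_eq_finrank]; simp
    rw [Module.length_eq_add_of_exact (N.restrictScalars k).subtype (N.restrictScalars k).mkQ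
        (Submodule.injective_subtype _) (Submodule.mkQ_surjective _)
        (LinearMap.exact_subtype_mkQ _),
      Module.length_eq_add_of_exact N.subtype N.mkQ (Submodule.injective_subtype _)
        (Submodule.mkQ_surjective _) (LinearMap.exact_subtype_mkQ _)]
    refine add_le_add (ih (Submodule.module' N) ⟨fun a b c => Subtype.ext (smul_assoc a b c.1)⟩) ?_
    rw [(Submodule.Quotient.restrictScalarsEquiv k N).length_eq,
      Module.length_eq_one (R := R) (M := M ⧸ N)]
    exact h1

theorem length_eq_finrank_of_residue {k R M : Type*} [Field k] [CommRing R] [IsLocalRing R]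
    [Algebra k R] (hk : ∀ r : R, ∃ c : k, r - algebraMap k R c ∈ maximalIdeal R)
    [AddCommGroup M] [Module R M] [Module k M] [IsScalarTower k R M] [Module.Finite k M] :
    IsFiniteLength R M ∧ Module.length R M = Module.finrank k M := by
  have : IsFiniteLength R M := isFiniteLength_iff_isNoetherian_isArtinian.2
    ⟨isNoetherian_of_tower k inferInstance, isArtinian_of_tower k inferInstance⟩
  refine ⟨this, ?_⟩
  rw [← Module.length_eq_finrank]
  refine le_antisymm ?_ (length_le_length_of_residue hk this _ inferInstance)
  have h := Submodule.length_le_length_restrictScalars k (⊤ : Submodule R M)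
  rwa [Submodule.restrictScalars_top, Module.length_top, Module.length_top] at h

theorem sub_constantCoeff_mem {σ k : Type*} [Field k] (p : MvPowerSeries σ k) :
    ∃ c : k, p - algebraMap k (MvPowerSeries σ k) c ∈ maximalIdeal (MvPowerSeries σ k) := by
  refine ⟨MvPowerSeries.constantCoeff p, ?_⟩
  rw [mem_maximalIdeal_iff_constantCoeff, map_sub, MvPowerSeries.algebraMap_apply]
  simp

end Length

/-! ### Regularity of g on R, and of powers of the x_i and of the y_i on S -/

section RegularSequences

open RingTheory.Sequence

theorem ofList_take_ofFn {R : Type*} [CommRing R] {n : ℕ} (r : Fin n → R) (i : Fin n) :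
    Ideal.ofList ((List.ofFn r).take i) = Ideal.span (r '' {j | j < i}) := by
  rw [Ideal.ofList]
  congr 1
  ext x
  simp only [Set.mem_ofPred_eq, List.mem_take_iff_getElem, List.getElem_ofFn, List.length_ofFn,
    Set.mem_image]
  constructor
  · rintro ⟨j, hj, rfl⟩
    exact ⟨⟨j, by omega⟩, by rw [Fin.lt_def]; simp only; omega, rfl⟩
  · rintro ⟨j, hj, rfl⟩
    exact ⟨j, lt_min hj j.2, rfl⟩

theorem isWeaklyRegular_ofFn {R N : Type*} [CommRing R] [AddCommGroup N] [Module R N] {n : ℕ}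
    (r : Fin n → R) (h : ∀ (i : Fin n) (x : N),
      r i • x ∈ Ideal.span (r '' {j | j < i}) • (⊤ : Submodule R N) →
        x ∈ Ideal.span (r '' {j | j < i}) • (⊤ : Submodule R N)) :
    IsWeaklyRegular N (List.ofFn r) := by
  constructor
  intro i hi
  rw [List.length_ofFn] at hi
  rw [List.getElem_ofFn, ofList_take_ofFn r ⟨i, hi⟩, isSMulRegular_iff_right_eq_zero_of_smul]
  intro y hy
  obtain ⟨x, rfl⟩ := Submodule.Quotient.mk_surjective _ y
  rw [← Submodule.Quotient.mk_smul, Submodule.Quotient.mk_eq_zero] at hy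
  rw [Submodule.Quotient.mk_eq_zero]
  exact h ⟨i, hi⟩ x hy

theorem ofList_ofFn {R : Type*} [CommRing R] {n : ℕ} (r : Fin n → R) :
    Ideal.ofList (List.ofFn r) = Ideal.span (Set.range r) := by
  rw [Ideal.ofList]
  congr 1
  ext x
  simp [List.mem_ofFn]

theorem mk_mem_smul_top {R : Type*} [CommRing R] (a I : Ideal R) (p : R) :
    (Ideal.Quotient.mk a p) ∈ I • (⊤ : Submodule R (R ⧸ a)) ↔ p ∈ I ⊔ a := by
  have h : I • (⊤ : Submodule R (R ⧸ a)) = Submodule.map (Submodule.mkQ a) I := by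
    have : (⊤ : Submodule R (R ⧸ a)) = Submodule.map (Submodule.mkQ a) ⊤ := by
      rw [Submodule.map_top, Submodule.range_mkQ]
    rw [this, ← Submodule.map_smul'', smul_eq_mul, Ideal.mul_top]
  rw [h]
  have := Submodule.comap_map_mkQ a I
  rw [sup_comm, ← this]
  rfl

variable {σ : Type*} {k : Type u} [Field k] {d : ℕ}

/-- The series `X (v i) ^ d + X (w i) ^ d`. -/
def powSum (k : Type u) [Field k] (v w : Fin d → σ) (i : Fin d) : MvPowerSeries σ k :=
  MvPowerSeries.X (v i) ^ d + MvPowerSeries.X (w i) ^ d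

section

variable {v w : Fin d → σ} (hv : Function.Injective v) (hvw : ∀ i j, v i ≠ w j)

include hvw in
theorem divOp_mul_powSum_self (i : Fin d) (h : MvPowerSeries σ k) :
    divOp (v i) (w i) d (h * powSum k v w i) = h :=
  divOp_mul_add (hvw i i) i.pos h

include hv hvw in
theorem divOp_mul_powSum (i l : Fin d) (hl : l ≠ i) (h : MvPowerSeries σ k) :
    divOp (v i) (w i) d (h * powSum k v w l) = divOp (v i) (w i) d h * powSum k v w l := by
  rw [powSum, mul_add, map_add, divOp_mul_X_pow (hvw i i) i.pos (hv.ne hl),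
    divOp_mul_X_pow (hvw i i) i.pos (hvw i l).symm, mul_add]

include hv hvw in
-- Division by g_i preserves the ideal of the earlier g_j and sends g_i x back to x.
theorem isWeaklyRegular_powSum :
    IsWeaklyRegular (MvPowerSeries σ k) (List.ofFn (powSum k v w)) := by
  refine isWeaklyRegular_ofFn _ fun i x hx => ?_
  rw [smul_eq_mul, smul_eq_mul, Ideal.mul_top] at *
  have h1 : ∀ y ∈ Ideal.span (powSum k v w '' {j | j < i}),
      divOp (v i) (w i) d y ∈ Ideal.span (powSum k v w '' {j | j < i}) := by
    intro y hy
    -- The division operator is only additive, so the multiplier c is carried through the induction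
    -- in place of linearity.
    refine Submodule.span_induction (p := fun y _ => ∀ c, divOp (v i) (w i) d (c * y) ∈
      Ideal.span (powSum k v w '' {j | j < i})) ?_ ?_ ?_ ?_ hy 1 |> fun h => by simpa using h
    · rintro _ ⟨j, hj, rfl⟩ c
      rw [divOp_mul_powSum hv hvw i j (ne_of_lt hj)]
      exact Ideal.mul_mem_left _ _ (Ideal.subset_span ⟨j, hj, rfl⟩)
    · intro c; simp
    · intro y z _ _ hy hz c
      rw [mul_add, map_add]
      exact Ideal.add_mem _ (hy c) (hz c)
    · intro r y _ hy c
      rw [smul_eq_mul, ← mul_assoc]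
      exact hy _
  have h2 := h1 _ hx
  rwa [mul_comm, divOp_mul_powSum_self hvw] at h2

include hv hvw in
-- N takes the remainder of successive divisions by the g_l with l in s. For s everything it picks a
-- representative modulo (g) that depends only on the class and commutes with multiplication by
-- powers of the X (w l), so questions about these variables on R/(g) move to the power series ring.
theorem exists_normalForm (s : Finset (Fin d)) :
    ∃ N : MvPowerSeries σ k →+ MvPowerSeries σ k,
      (∀ h, N h - h ∈ Ideal.span (Set.range (powSum k v w))) ∧
      (∀ l e h, N (h * MvPowerSeries.X (w l) ^ e) = N h * MvPowerSeries.X (w l) ^ e) ∧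
      (∀ l ∈ s, ∀ h, N (h * powSum k v w l) = 0) ∧
      ∀ l ∉ s, ∀ h, N (h * powSum k v w l) = N h * powSum k v w l := by
  classical
  induction s using Finset.induction_on with
  | empty => exact ⟨AddMonoidHom.id _, by simp, by simp, by simp, by simp⟩
  | insert a s ha ih =>
    obtain ⟨N, h1, h2, h3, h4⟩ := ih
    refine ⟨N - (AddMonoidHom.mulRight (powSum k v w a)).comp ((divOp (v a) (w a) d).comp N),
      ?_, ?_, ?_, ?_⟩
    · intro h
      have : (N - (AddMonoidHom.mulRight (powSum k v w a)).comp ((divOp (v a) (w a) d).comp N)) h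
          - h = (N h - h) - divOp (v a) (w a) d (N h) * powSum k v w a := by
        simp; ring
      rw [this]
      exact Ideal.sub_mem _ (h1 h) (Ideal.mul_mem_left _ _ (Ideal.subset_span ⟨a, rfl⟩))
    · intro l e h
      simp only [AddMonoidHom.sub_apply, AddMonoidHom.comp_apply, AddMonoidHom.coe_mulRight, h2]
      rw [divOp_mul_X_pow (hvw a a) a.pos (hvw a l).symm]
      ring
    · intro l hl h
      simp only [AddMonoidHom.sub_apply, AddMonoidHom.comp_apply, AddMonoidHom.coe_mulRight]
      by_cases hla : l = a
      · subst hla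
        rw [h4 l ha, divOp_mul_powSum_self hvw, sub_self]
      · rw [h3 l (Finset.mem_of_mem_insert_of_ne hl hla)]
        simp
    · intro l hl h
      simp only [AddMonoidHom.sub_apply, AddMonoidHom.comp_apply, AddMonoidHom.coe_mulRight]
      rw [Finset.mem_insert, not_or] at hl
      rw [h4 l hl.2, divOp_mul_powSum hv hvw a l hl.1]
      ring

include hv hvw in
-- The normal form kills (g), so the relation becomes one between monomial powers in the power
-- series ring, where `shiftOp` cancels X (w i)^e. The result returns to p because p and its normal
-- form agree modulo (g).
theorem mem_of_X_pow_mul_mem (hw : Function.Injective w) (e : ℕ) (i : Fin d)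
    (p : MvPowerSeries σ k)
    (hp : MvPowerSeries.X (w i) ^ e * p ∈
      Ideal.span ((fun j => (MvPowerSeries.X (w j) : MvPowerSeries σ k) ^ e) '' {j | j < i}) ⊔
        Ideal.span (Set.range (powSum k v w))) :
    p ∈ Ideal.span ((fun j => (MvPowerSeries.X (w j) : MvPowerSeries σ k) ^ e) '' {j | j < i}) ⊔
        Ideal.span (Set.range (powSum k v w)) := by
  obtain ⟨N, h1, h2, h3, -⟩ := exists_normalForm (k := k) hv hvw Finset.univ
  set I := Ideal.span ((fun j => (MvPowerSeries.X (w j) : MvPowerSeries σ k) ^ e) '' {j | j < i})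
    with hI
  obtain ⟨x, hx, y, hy, hxy⟩ := Submodule.mem_sup.1 hp
  have hNy : N y = 0 := by
    rw [Ideal.mem_span_range_iff_exists_fun] at hy
    obtain ⟨c, rfl⟩ := hy
    rw [map_sum]
    exact Finset.sum_eq_zero fun l _ => h3 l (Finset.mem_univ l) _
  have hstab : ∀ T : MvPowerSeries σ k →+ MvPowerSeries σ k, (∀ l, l < i → ∀ h,
      T (h * MvPowerSeries.X (w l) ^ e) = T h * MvPowerSeries.X (w l) ^ e) →
      ∀ z ∈ I, T z ∈ I := by
    intro T hT z hz
    refine Submodule.span_induction (p := fun z _ => ∀ c, T (c * z) ∈ I) ?_ ?_ ?_ ?_ hz 1 |>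
      fun h => by simpa using h
    · rintro _ ⟨j, hj, rfl⟩ c
      simp only
      rw [hT j hj]
      exact Ideal.mul_mem_left _ _ (Ideal.subset_span ⟨j, hj, rfl⟩)
    · intro c; simp
    · intro y z _ _ hy hz c
      rw [mul_add, map_add]
      exact Ideal.add_mem _ (hy c) (hz c)
    · intro r y _ hy c
      rw [smul_eq_mul, ← mul_assoc]
      exact hy _
  have h5 : N p * MvPowerSeries.X (w i) ^ e ∈ I := by
    rw [← h2, mul_comm, ← hxy, map_add, hNy, add_zero]
    exact hstab N (fun l _ h => h2 l e h) x hx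
  have h6 := hstab (shiftOp (w i) e)
    (fun l hl h => shiftOp_mul_X_pow (hw.ne (ne_of_lt hl)) e e h) _ h5
  rw [shiftOp_mul_self] at h6
  have : p = N p - (N p - p) := by ring
  rw [this]
  exact Ideal.sub_mem _ (Ideal.mem_sup_left h6) (Ideal.mem_sup_right (h1 p))

include hv hvw in
theorem isWeaklyRegular_X_pow (hw : Function.Injective w) (e : ℕ) :
    IsWeaklyRegular (MvPowerSeries σ k ⧸ Ideal.span (Set.range (powSum k v w)))
      (List.ofFn fun i => (MvPowerSeries.X (w i) : MvPowerSeries σ k) ^ e) := by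
  refine isWeaklyRegular_ofFn _ fun i x hx => ?_
  obtain ⟨p, rfl⟩ := Ideal.Quotient.mk_surjective x
  rw [mk_mem_smul_top]
  refine mem_of_X_pow_mul_mem hv hvw hw e i p ?_
  rw [← mk_mem_smul_top]
  exact hx

end

variable (k d)

/-- Exchanging the two summands lets division eliminate y_i in place of x_i; this is what makes
powers of the x_i accessible on S by the same argument. -/
theorem polyG_eq' : polyG k d = powSum k Sum.inr Sum.inl := funext fun _ => add_comm _ _

theorem idealA_eq : idealA k d = Ideal.span (Set.range (powSum k (d := d) Sum.inr Sum.inl)) := by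
  rw [idealA, polyG_eq']

theorem isWeaklyRegular_polyG : IsWeaklyRegular (ringR k d) (List.ofFn (polyG k d)) :=
  isWeaklyRegular_powSum Sum.inl_injective fun _ _ => Sum.inl_ne_inr

theorem isWeaklyRegular_varX_pow (e : ℕ) :
    IsWeaklyRegular (ringS k d) (List.ofFn fun i => varX k d i ^ e) := by
  unfold ringS
  rw [idealA_eq]
  exact isWeaklyRegular_X_pow Sum.inr_injective (fun _ _ => Sum.inr_ne_inl) Sum.inl_injective e

theorem isWeaklyRegular_varY_pow (e : ℕ) :
    IsWeaklyRegular (ringS k d) (List.ofFn fun i => varY k d i ^ e) :=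
  isWeaklyRegular_X_pow Sum.inl_injective (fun _ _ => Sum.inl_ne_inr) Sum.inr_injective e

theorem isQuasiRegularOn_polyG : IsQuasiRegularOn (polyG k d) (ringR k d × ringR k d) :=
  isQuasiRegularOn_prod_of_division (D := fun i => divOp (Sum.inl i) (Sum.inr i) d)
    (divOp_mul_powSum_self fun _ _ => Sum.inl_ne_inr)
    (divOp_mul_powSum Sum.inl_injective fun _ _ => Sum.inl_ne_inr)

theorem polyG_mem_maximalIdeal_pow (i : Fin d) :
    polyG k d i ∈ IsLocalRing.maximalIdeal (ringR k d) ^ d :=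
  Ideal.add_mem _ (Ideal.pow_mem_pow (X_mem_maximalIdeal _) d)
    (Ideal.pow_mem_pow (X_mem_maximalIdeal _) d)

theorem idealA_le_maximalIdeal_pow :
    idealA k d ≤ IsLocalRing.maximalIdeal (ringR k d) ^ d := by
  rw [idealA, Ideal.span_le]
  rintro _ ⟨i, rfl⟩
  exact polyG_mem_maximalIdeal_pow k d i

theorem idealA_le_maximalIdeal : idealA k d ≤ IsLocalRing.maximalIdeal (ringR k d) := by
  rw [idealA, Ideal.span_le]
  rintro _ ⟨i, rfl⟩
  exact Ideal.pow_le_self i.pos.ne' (polyG_mem_maximalIdeal_pow k d i)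

instance : Nontrivial (ringS k d) := Ideal.Quotient.nontrivial_iff.2 fun h =>
  (IsLocalRing.maximalIdeal.isMaximal (ringR k d)).ne_top
    (top_le_iff.1 (h ▸ idealA_le_maximalIdeal k d))

instance : IsLocalRing (ringS k d) := IsLocalRing.of_surjective' (toS k d)
  Ideal.Quotient.mk_surjective

theorem isRegular_polyG : IsRegular (ringR k d) (List.ofFn (polyG k d)) := by
  refine ⟨isWeaklyRegular_polyG k d, ?_⟩
  rw [ofList_ofFn, smul_eq_mul, Ideal.mul_top]
  intro h
  exact (IsLocalRing.maximalIdeal.isMaximal (ringR k d)).ne_top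
    (top_le_iff.1 (h.symm ▸ idealA_le_maximalIdeal k d : (⊤ : Ideal (ringR k d)) ≤ _))

end RegularSequences

/-! ### Krull dimensions of R and S -/

section Dimension

open RingTheory.Sequence

theorem supportDim_eq_zero_of_isFiniteLength {R N : Type*} [CommRing R] [IsLocalRing R]
    [AddCommGroup N] [Module R N] [Nontrivial N] (h : IsFiniteLength R N) :
    Module.supportDim R N = 0 := by
  obtain ⟨_, _⟩ := isFiniteLength_iff_isNoetherian_isArtinian.1 h
  set m := IsLocalRing.maximalIdeal R with hm
  obtain ⟨n, hn⟩ := IsArtinian.monotone_stabilizes (R := R) (M := N)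
    ⟨fun n => OrderDual.toDual (m ^ n • (⊤ : Submodule R N)), fun a b hab =>
      Submodule.smul_mono_left (Ideal.pow_le_pow_right hab)⟩
  have h1 : m ^ n • (⊤ : Submodule R N) = m • (m ^ n • (⊤ : Submodule R N)) := by
    rw [← mul_smul, ← pow_succ']
    exact hn (n + 1) n.le_succ
  have h2 : m ^ n • (⊤ : Submodule R N) = ⊥ :=
    Submodule.eq_bot_of_le_smul_of_le_jacobson_bot m _ (IsNoetherian.noetherian _) h1.le
      (IsLocalRing.maximalIdeal_le_jacobson _)
  have h3 : m ^ n ≤ Module.annihilator R N := by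
    rw [← Submodule.annihilator_top, Submodule.le_annihilator_iff]
    exact h2
  have hsub : Subsingleton (Module.support R N) := by
    have key : ∀ p ∈ Module.support R N, p.asIdeal = m := by
      intro p hp
      rw [Module.mem_support_iff_of_finite] at hp
      exact ((IsLocalRing.maximalIdeal.isMaximal R).eq_of_le p.2.ne_top
        (p.2.le_of_pow_le (h3.trans hp))).symm
    exact ⟨fun p q => Subtype.ext (PrimeSpectrum.ext ((key p p.2).trans (key q q.2).symm))⟩
  have hne : Nonempty (Module.support R N) := (Module.nonempty_support_of_nontrivial).to_subtype
  exact le_antisymm Order.krullDim_nonpos_of_subsingleton Order.krullDim_nonneg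

theorem supportDim_le_supportDim_quotient_add_length {R : Type*} [CommRing R] [IsLocalRing R]
    [IsNoetherianRing R] (rs : List R) (hrs : ∀ r ∈ rs, r ∈ IsLocalRing.maximalIdeal R)
    (N : Type*) [AddCommGroup N] [Module R N] [Module.Finite R N] :
    Module.supportDim R N ≤
      Module.supportDim R (N ⧸ (Ideal.ofList rs • ⊤ : Submodule R N)) + rs.length := by
  induction rs generalizing N with
  | nil =>
    rw [Ideal.ofList_nil, Submodule.bot_smul]
    simpa using (Module.supportDim_eq_of_equiv (Submodule.quotEquivOfEqBot ⊥ rfl).symm).le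
  | cons x rs ih =>
    rw [Module.supportDim_eq_of_equiv
      (Submodule.quotOfListConsSMulTopEquivQuotSMulTopInner N x rs)]
    refine (Module.supportDim_le_supportDim_quotSMulTop_succ
      (hrs x List.mem_cons_self)).trans ?_
    have h := ih (fun r hr => hrs r (List.mem_cons_of_mem _ hr)) (QuotSMulTop x N)
    rw [List.length_cons, Nat.cast_add, Nat.cast_one, ← add_assoc]
    gcongr

theorem mem_of_coeff_eq_zero {σ : Type*} [Finite σ] {k : Type u} [Field k]
    (I : Ideal (MvPowerSeries σ k)) (T : Finset (σ →₀ ℕ))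
    {ι : Type*} [Fintype ι] (e : ι → σ →₀ ℕ) (he : ∀ i, MvPowerSeries.monomial (e i) 1 ∈ I)
    (hT : ∀ m, (∀ i, ¬ e i ≤ m) → m ∈ T)
    (p : MvPowerSeries σ k) (hp : ∀ m ∈ T, MvPowerSeries.coeff m p = 0) : p ∈ I := by
  have h := mem_span_monomial e p fun m hm => by
    by_contra! hc
    exact hm (hp m (hT m hc))
  refine (Ideal.span_le.2 ?_) h
  rintro _ ⟨i, rfl⟩
  exact he i

/-- The set of exponents that are bounded by `b` componentwise. -/
def boxExp {σ : Type*} [Fintype σ] [DecidableEq σ] (b : σ → ℕ) : Finset (σ →₀ ℕ) :=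
  (Fintype.piFinset fun v => Finset.range (b v)).map Finsupp.equivFunOnFinite.symm.toEmbedding

theorem mem_boxExp {σ : Type*} [Fintype σ] [DecidableEq σ] (b : σ → ℕ) (m : σ →₀ ℕ) :
    m ∈ boxExp b ↔ ∀ v, m v < b v := by
  rw [boxExp, Finset.mem_map_equiv]
  simp

theorem card_boxExp {σ : Type*} [Fintype σ] [DecidableEq σ] (b : σ → ℕ) :
    (boxExp b).card = ∏ v, b v := by
  simp [boxExp]

theorem finite_quotient_of_X_pow_mem {σ : Type*} [Finite σ] {k : Type u} [Field k]
    (I : Ideal (MvPowerSeries σ k)) (n : ℕ) (h : ∀ v, MvPowerSeries.X v ^ n ∈ I) :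
    Module.Finite k (MvPowerSeries σ k ⧸ I) := by
  classical
  have := Fintype.ofFinite σ
  refine (finite_quotient_of_coeff I (boxExp fun _ => n) fun p hp => ?_).1
  refine mem_of_coeff_eq_zero I (boxExp fun _ => n) (fun v => Finsupp.single v n) (fun v => ?_)
    (fun m hm => ?_) p hp
  · rw [← MvPowerSeries.X_pow_eq]
    exact h v
  · rw [mem_boxExp]
    intro v
    have := hm v
    rwa [Finsupp.single_le_iff, not_le] at this

theorem finite_quotient_prod_of_X_pow_mem {σ : Type*} [Finite σ] {k : Type u} [Field k]
    (N : Submodule (MvPowerSeries σ k) (MvPowerSeries σ k × MvPowerSeries σ k)) (n : ℕ)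
    (h : ∀ v z, (MvPowerSeries.X v : MvPowerSeries σ k) ^ n • z ∈ N) :
    Module.Finite k ((MvPowerSeries σ k × MvPowerSeries σ k) ⧸ N) := by
  set I : Ideal (MvPowerSeries σ k) := Ideal.span (Set.range fun v => MvPowerSeries.X v ^ n)
  have hfin : Module.Finite k (MvPowerSeries σ k ⧸ I) :=
    finite_quotient_of_X_pow_mem I n fun v => Ideal.subset_span ⟨v, rfl⟩
  have hI : ∀ r ∈ I, ∀ z, r • z ∈ N := by
    intro r hr z
    induction hr using Submodule.span_induction with
    | mem x hx =>
      obtain ⟨v, rfl⟩ := hx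
      exact h v z
    | zero => simp
    | add x y _ _ hx hy => rw [add_smul]; exact N.add_mem hx hy
    | smul a x _ hx => rw [smul_assoc]; exact N.smul_mem _ hx
  let f (z : MvPowerSeries σ k × MvPowerSeries σ k) : (MvPowerSeries σ k ⧸ I) →ₗ[MvPowerSeries σ k]
      ((MvPowerSeries σ k × MvPowerSeries σ k) ⧸ N) :=
    Submodule.liftQ I (LinearMap.toSpanSingleton _ _ (Submodule.Quotient.mk z)) fun r hr => by
      rw [LinearMap.mem_ker, LinearMap.toSpanSingleton_apply, ← Submodule.Quotient.mk_smul,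
        Submodule.Quotient.mk_eq_zero]
      exact hI r hr z
  refine Module.Finite.of_surjective
    (((f (1, 0)).coprod (f (0, 1))).restrictScalars k) fun y => ?_
  obtain ⟨⟨p, q⟩, rfl⟩ := Submodule.Quotient.mk_surjective _ y
  refine ⟨(Submodule.Quotient.mk p, Submodule.Quotient.mk q), ?_⟩
  change p • Submodule.Quotient.mk (p := N) (1, 0) + q • Submodule.Quotient.mk (p := N) (0, 1) = _
  rw [← Submodule.Quotient.mk_smul, ← Submodule.Quotient.mk_smul, ← Submodule.Quotient.mk_add]
  simp

variable (k : Type u) [Field k] (d : ℕ)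

theorem varX_pow_add_varY_pow_mem (i : Fin d) : varX k d i ^ d + varY k d i ^ d ∈ idealA k d :=
  Ideal.subset_span ⟨i, rfl⟩

theorem finite_quotient_varX :
    Module.Finite k (ringR k d ⧸ (Ideal.span (Set.range (varX k d)) ⊔ idealA k d)) := by
  refine finite_quotient_of_X_pow_mem _ d fun v => ?_
  have hx : ∀ i : Fin d, varX k d i ^ d ∈ Ideal.span (Set.range (varX k d)) ⊔ idealA k d :=
    fun i => Ideal.mem_sup_left (Ideal.pow_mem_of_mem _ (Ideal.subset_span (Set.mem_range_self i)) d i.pos)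
  rcases v with i | i
  · exact hx i
  · have h1 : varY k d i ^ d = (varX k d i ^ d + varY k d i ^ d) - varX k d i ^ d := by ring
    change varY k d i ^ d ∈ _
    rw [h1]
    exact Ideal.sub_mem _ (Ideal.mem_sup_right (varX_pow_add_varY_pow_mem k d i)) (hx i)

theorem varX_mem_maximalIdeal (i : Fin d) : varX k d i ∈ IsLocalRing.maximalIdeal (ringR k d) :=
  X_mem_maximalIdeal _

theorem varY_mem_maximalIdeal (i : Fin d) : varY k d i ∈ IsLocalRing.maximalIdeal (ringR k d) :=
  X_mem_maximalIdeal _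

theorem smul_top_ne_top_of_le_maximalIdeal {I : Ideal (ringR k d)}
    (hI : I ≤ IsLocalRing.maximalIdeal (ringR k d)) :
    I • (⊤ : Submodule (ringR k d) (ringS k d)) ≠ ⊤ := by
  intro h
  have h1 : Ideal.Quotient.mk (idealA k d) 1 ∈ I • (⊤ : Submodule (ringR k d) (ringS k d)) :=
    by rw [h]; trivial
  rw [mk_mem_smul_top] at h1
  exact (IsLocalRing.maximalIdeal.isMaximal (ringR k d)).ne_top
    ((Ideal.eq_top_iff_one _).2 (sup_le hI (idealA_le_maximalIdeal k d) h1))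

/-- The x_i form an S-regular sequence of length d, and S/(x) has finite length since y_i^d = -x_i^d
in S. -/
theorem ringKrullDim_ringS : ringKrullDim (ringS k d) = d := by
  have hle : Ideal.span (Set.range (varX k d)) ≤ IsLocalRing.maximalIdeal (ringR k d) := by
    rw [Ideal.span_le]
    rintro _ ⟨i, rfl⟩
    exact varX_mem_maximalIdeal k d i
  have hlist : Ideal.ofList (List.ofFn fun i => varX k d i ^ 1) =
      Ideal.span (Set.range (varX k d)) := by
    rw [ofList_ofFn]
    simp
  have hreg : IsRegular (ringS k d) (List.ofFn fun i => varX k d i ^ 1) := by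
    refine ⟨isWeaklyRegular_varX_pow k d 1, ?_⟩
    rw [hlist]
    exact (smul_top_ne_top_of_le_maximalIdeal k d hle).symm
  have h := Module.supportDim_add_length_eq_supportDim_of_isRegular _ hreg
  rw [hlist, List.length_ofFn, Module.supportDim_quotient_eq_ringKrullDim] at h
  rw [← h]
  have hnt : Nontrivial (ringS k d ⧸
      (Ideal.span (Set.range (varX k d)) • ⊤ : Submodule (ringR k d) (ringS k d))) :=
    Submodule.Quotient.nontrivial_iff.2 (smul_top_ne_top_of_le_maximalIdeal k d hle)
  have hfin := finite_quotient_varX k d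
  let f : (ringR k d ⧸ (Ideal.span (Set.range (varX k d)) ⊔ idealA k d)) →ₗ[ringR k d]
      (ringS k d ⧸ (Ideal.span (Set.range (varX k d)) • ⊤ :
        Submodule (ringR k d) (ringS k d))) :=
    Submodule.liftQ _ (Submodule.mkQ _ ∘ₗ (Submodule.mkQ (idealA k d))) fun r hr => by
      rw [LinearMap.mem_ker, LinearMap.comp_apply, Submodule.mkQ_apply, Submodule.mkQ_apply,
        Submodule.Quotient.mk_eq_zero]
      exact (mk_mem_smul_top _ _ _).2 hr
  have hf : Function.Surjective f := by
    intro y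
    obtain ⟨x, rfl⟩ := Submodule.Quotient.mk_surjective _ y
    obtain ⟨r, rfl⟩ := Ideal.Quotient.mk_surjective x
    exact ⟨Submodule.Quotient.mk r, rfl⟩
  have : Module.Finite k (ringS k d ⧸ (Ideal.span (Set.range (varX k d)) • ⊤ :
        Submodule (ringR k d) (ringS k d))) :=
    Module.Finite.of_surjective (f.restrictScalars k) hf
  rw [supportDim_eq_zero_of_isFiniteLength
    (length_eq_finrank_of_residue (k := k) sub_constantCoeff_mem).1, zero_add]

/-- Deduced from dim S: passing to the quotient by the regular sequence g lowers the dimension by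
exactly d. -/
theorem ringKrullDim_ringR : ringKrullDim (ringR k d) = d + d := by
  have h := ringKrullDim_add_length_eq_ringKrullDim_of_isRegular _ (isRegular_polyG k d)
  rw [List.length_ofFn, ofList_ofFn] at h
  rw [← h, ← ringKrullDim_ringS k d]
  rfl

end Dimension

/-! ### Presentation of M over R, finite length, projective dimension -/

section Presentation

theorem isFiniteLength_of_finite (k : Type*) {A N : Type*} [Field k] [CommRing A] [Algebra k A]
    [AddCommGroup N] [Module A N] [Module k N] [IsScalarTower k A N] [Module.Finite k N] :
    IsFiniteLength A N :=
  isFiniteLength_iff_isNoetherian_isArtinian.2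
    ⟨isNoetherian_of_tower k inferInstance, isArtinian_of_tower k inferInstance⟩

/-- A pushout of an injection is an injection with the same cokernel: 0 → C → pushout → A/I → 0 is
exact, and the bounds for the outer terms pass to the middle. -/
theorem hasProjectiveDimensionLE_pushout {A C : Type u} [CommRing A] [AddCommGroup C] [Module A C]
    (I : Ideal A) (η : I →ₗ[A] C) (n : ℕ)
    (hX : HasProjectiveDimensionLE (ModuleCat.of A (A ⧸ I)) n)
    (hY : HasProjectiveDimensionLE (ModuleCat.of A C) n) :
    HasProjectiveDimensionLE (ModuleCat.of A (PushoutModule (Submodule.subtype I) η)) n := by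
  let f : C →ₗ[A] PushoutModule (Submodule.subtype I) η :=
    Submodule.mkQ _ ∘ₗ LinearMap.inr A A C
  let g : PushoutModule (Submodule.subtype I) η →ₗ[A] (A ⧸ I) :=
    Submodule.liftQ _ (I.mkQ ∘ₗ LinearMap.fst A A C) (by
      rintro _ ⟨t, rfl⟩
      exact (Submodule.Quotient.mk_eq_zero _).2 t.2)
  have hfg : g ∘ₗ f = 0 := by
    refine LinearMap.ext fun c => ?_
    exact map_zero I.mkQ
  have hinj : Function.Injective f := by
    rw [injective_iff_map_eq_zero]
    intro y hy
    obtain ⟨t, ht⟩ := (Submodule.Quotient.mk_eq_zero _).1 hy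
    have h1 : t = 0 := Subtype.ext (congrArg Prod.fst ht)
    have h2 : -η t = y := congrArg Prod.snd ht
    rw [← h2, h1, map_zero, neg_zero]
  have hsurj : Function.Surjective g := by
    intro y
    obtain ⟨x, rfl⟩ := Submodule.Quotient.mk_surjective _ y
    exact ⟨Submodule.Quotient.mk (x, 0), rfl⟩
  have hexact : Function.Exact f g := by
    intro y
    constructor
    · intro hy
      obtain ⟨⟨x, z⟩, rfl⟩ := Submodule.Quotient.mk_surjective _ y
      have hx : x ∈ I := (Submodule.Quotient.mk_eq_zero _).1 hy
      refine ⟨z + η ⟨x, hx⟩, ?_⟩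
      refine (Submodule.Quotient.eq _).2 ⟨-⟨x, hx⟩, ?_⟩
      refine Prod.ext ?_ ?_
      · simp
      · simp
    · rintro ⟨z, rfl⟩
      exact LinearMap.congr_fun hfg z
  have hS := ModuleCat.shortComplex_shortExact
    (ShortComplex.mk (ModuleCat.ofHom f) (ModuleCat.ofHom g)
      (by rw [← ModuleCat.ofHom_comp, hfg]; rfl)) hexact hinj hsurj
  exact hS.hasProjectiveDimensionLT_X₂ (n + 1) hY hX

variable (k : Type u) [Field k] (d : ℕ)

/-- The relation `(x_i ^ (d-1), f_i)`. -/
def relX (i : Fin d) : ringR k d × ringR k d := (varX k d i ^ (d - 1), monF k d i)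

/-- The relation `(0, y_i ^ (d-1))`. -/
def relY (i : Fin d) : ringR k d × ringR k d := (0, varY k d i ^ (d - 1))

/-- The submodule of `R ^ 2` generated by the relations `(x_i ^ (d-1), f_i)` and
`(0, y_i ^ (d-1))`. -/
def relModule : Submodule (ringR k d) (ringR k d × ringR k d) :=
  Submodule.span (ringR k d) (Set.range (Sum.elim (relX k d) (relY k d)))

variable {k d}

theorem relX_mem (i : Fin d) : relX k d i ∈ relModule k d := Submodule.subset_span ⟨Sum.inl i, rfl⟩

theorem relY_mem (i : Fin d) : relY k d i ∈ relModule k d := Submodule.subset_span ⟨Sum.inr i, rfl⟩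

theorem mem_relModule_iff (z : ringR k d × ringR k d) : z ∈ relModule k d ↔
    ∃ s t : Fin d → ringR k d, z.1 = ∑ i, s i * varX k d i ^ (d - 1) ∧
      z.2 = ∑ i, s i * monF k d i + ∑ i, t i * varY k d i ^ (d - 1) := by
  rw [relModule, Submodule.mem_span_range_iff_exists_fun]
  constructor
  · rintro ⟨c, rfl⟩
    refine ⟨fun i => c (Sum.inl i), fun i => c (Sum.inr i), ?_, ?_⟩ <;>
      simp [Fintype.sum_sum_type, Prod.fst_sum, Prod.snd_sum, relX, relY]
  · rintro ⟨s, t, h1, h2⟩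
    refine ⟨Sum.elim s t, Prod.ext ?_ ?_⟩
    · simp [Fintype.sum_sum_type, Prod.fst_sum, relX, relY, h1]
    · simp [Fintype.sum_sum_type, Prod.snd_sum, relX, relY, h2]

variable (k d)

/-- The presentation `R ^ 2 → M` of `M` over `R`. -/
def toM : ringR k d × ringR k d →ₗ[ringR k d] moduleM k d :=
  (Submodule.mkQ (LinearMap.range ((Submodule.subtype (idealX k d)).prod
    (-eta k d)))).restrictScalars (ringR k d) ∘ₗ
      ((Algebra.linearMap (ringR k d) (ringS k d)).prodMap
        ((idealY k d).mkQ.restrictScalars (ringR k d) ∘ₗ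
          Algebra.linearMap (ringR k d) (ringS k d)))

theorem toM_apply (p q : ringR k d) : toM k d (p, q) =
    Submodule.Quotient.mk (toS k d p, Ideal.Quotient.mk (idealY k d) (toS k d q)) := rfl

theorem toM_surjective : Function.Surjective (toM k d) := by
  intro y
  obtain ⟨⟨s, t⟩, rfl⟩ := Submodule.Quotient.mk_surjective _ y
  obtain ⟨p, rfl⟩ := Ideal.Quotient.mk_surjective s
  obtain ⟨t, rfl⟩ := Ideal.Quotient.mk_surjective t
  obtain ⟨q, rfl⟩ := Ideal.Quotient.mk_surjective t
  exact ⟨(p, q), rfl⟩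

variable {k d} in
theorem eta_sum (s : Fin d → ringS k d)
    (h : ∑ i, s i * toS k d (varX k d i ^ (d - 1)) ∈ idealX k d) :
    eta k d ⟨∑ i, s i * toS k d (varX k d i ^ (d - 1)), h⟩ =
      -Ideal.Quotient.mk (idealY k d) (∑ i, s i * toS k d (monF k d i)) := by
  have h1 : (⟨∑ i, s i * toS k d (varX k d i ^ (d - 1)), h⟩ : idealX k d) =
      ∑ i, s i • (⟨toS k d (varX k d i ^ (d - 1)), Ideal.subset_span ⟨i, rfl⟩⟩ : idealX k d) := by
    apply Subtype.ext
    simp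
  rw [h1, map_sum, map_sum, ← Finset.sum_neg_distrib]
  refine Finset.sum_congr rfl fun i _ => ?_
  rw [map_smul, eta_apply, smul_neg, map_mul]
  rfl

theorem toS_eq_zero_iff (p : ringR k d) : toS k d p = 0 ↔ p ∈ idealA k d :=
  Ideal.Quotient.eq_zero_iff_mem

theorem toS_mem_idealY_iff (q : ringR k d) : toS k d q ∈ idealY k d ↔
    ∃ t : Fin d → ringR k d, q - ∑ i, t i * varY k d i ^ (d - 1) ∈ idealA k d := by
  rw [idealY, Ideal.mem_span_range_iff_exists_fun]
  constructor
  · rintro ⟨c, hc⟩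
    choose t ht using fun i => Ideal.Quotient.mk_surjective (c i)
    refine ⟨t, ?_⟩
    rw [← toS_eq_zero_iff, map_sub, ← hc, map_sum]
    simp [toS, ht]
  · rintro ⟨t, ht⟩
    refine ⟨fun i => toS k d (t i), ?_⟩
    rw [← toS_eq_zero_iff, map_sub, sub_eq_zero] at ht
    rw [ht, map_sum]
    simp

/-- The pushout relation (t, -η t) at t = x_i^(d-1) is (x_i^(d-1), f_i): the sign in η cancels the
sign of the pushout. -/
theorem ker_toM : LinearMap.ker (toM k d) =
    relModule k d ⊔ idealA k d • (⊤ : Submodule (ringR k d) (ringR k d × ringR k d)) := by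
  apply le_antisymm
  · rintro ⟨p, q⟩ hpq
    rw [LinearMap.mem_ker, toM_apply, Submodule.Quotient.mk_eq_zero] at hpq
    obtain ⟨⟨u, hu⟩, h⟩ := hpq
    have h1 : u = toS k d p := congrArg Prod.fst h
    have h2 : -eta k d ⟨u, hu⟩ = Ideal.Quotient.mk (idealY k d) (toS k d q) :=
      congrArg Prod.snd h
    have hu' := hu
    rw [idealX, Ideal.mem_span_range_iff_exists_fun] at hu'
    obtain ⟨c, rfl⟩ := hu'
    rw [eta_sum, neg_neg] at h2
    choose s hs using fun i => Ideal.Quotient.mk_surjective (c i)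
    obtain rfl : (fun i => toS k d (s i)) = c := funext hs
    simp only [← map_mul, ← map_sum] at h1 h2
    have h3 : p - ∑ i, s i * varX k d i ^ (d - 1) ∈ idealA k d := by
      rw [← toS_eq_zero_iff, map_sub, h1, sub_self]
    have h4 : toS k d (q - ∑ i, s i * monF k d i) ∈ idealY k d := by
      rw [← Ideal.Quotient.eq_zero_iff_mem, map_sub, map_sub, h2, sub_self]
    rw [toS_mem_idealY_iff] at h4
    obtain ⟨t, ht⟩ := h4
    refine Submodule.mem_sup.2 ⟨(∑ i, s i * varX k d i ^ (d - 1),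
      ∑ i, s i * monF k d i + ∑ i, t i * varY k d i ^ (d - 1)),
      (mem_relModule_iff _).2 ⟨s, t, rfl, rfl⟩,
      (p - ∑ i, s i * varX k d i ^ (d - 1),
        q - ∑ i, s i * monF k d i - ∑ i, t i * varY k d i ^ (d - 1)),
      (mem_smul_top_prod _ _).2 ⟨h3, ht⟩, ?_⟩
    ext1 <;> simp
  · refine sup_le ?_ ?_
    · rw [relModule, Submodule.span_le]
      rintro _ ⟨i | i, rfl⟩
      · rw [SetLike.mem_coe, LinearMap.mem_ker]
        change toM k d (_, _) = 0
        rw [toM_apply, Submodule.Quotient.mk_eq_zero]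
        refine ⟨⟨toS k d (varX k d i ^ (d - 1)), Ideal.subset_span ⟨i, rfl⟩⟩, Prod.ext rfl ?_⟩
        change -eta k d _ = _
        rw [eta_apply, neg_neg]
      · rw [SetLike.mem_coe, LinearMap.mem_ker]
        change toM k d (_, _) = 0
        have h : Ideal.Quotient.mk (idealY k d) (toS k d (varY k d i ^ (d - 1))) = 0 :=
          Ideal.Quotient.eq_zero_iff_mem.2 (Ideal.subset_span ⟨i, rfl⟩)
        rw [toM_apply, map_zero, h]
        rfl
    · rintro ⟨p, q⟩ hpq
      rw [mem_smul_top_prod] at hpq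
      rw [LinearMap.mem_ker, toM_apply, (toS_eq_zero_iff k d p).2 hpq.1,
        (toS_eq_zero_iff k d q).2 hpq.2, map_zero]
      rfl

/-- The identification of `M` with the quotient of `R ^ 2` by its relations. -/
def quotEquivM : ((ringR k d × ringR k d) ⧸
    (relModule k d ⊔ idealA k d • (⊤ : Submodule (ringR k d) (ringR k d × ringR k d))))
      ≃ₗ[ringR k d] moduleM k d :=
  (Submodule.quotEquivOfEq _ _ (ker_toM k d).symm).trans
    ((toM k d).quotKerEquivOfSurjective (toM_surjective k d))

/-- The ideal `(x_i ^ (d-1) y_j ^ (d-1)) + 𝔞 ^ n`. -/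
def idealB (n : ℕ) : Ideal (ringR k d) :=
  Ideal.span (Set.range fun p : Fin d × Fin d =>
    varX k d p.1 ^ (d - 1) * varY k d p.2 ^ (d - 1)) ⊔ idealA k d ^ n

variable {k d}

theorem mul_mem_idealB (i j : Fin d) (n : ℕ) :
    varX k d i ^ (d - 1) * varY k d j ^ (d - 1) ∈ idealB k d n :=
  Ideal.mem_sup_left (Ideal.subset_span ⟨(i, j), rfl⟩)

theorem mul_pow_mem_idealB (i : Fin d) (n : ℕ) : varX k d i ^ d * varY k d i ^ d ∈ idealB k d n := by
  have h1 : ∀ x : ringR k d, x ^ d = x * x ^ (d - 1) := fun x => by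
    rw [← pow_succ', Nat.sub_add_cancel i.pos]
  rw [h1, h1, mul_mul_mul_comm]
  exact Ideal.mul_mem_left _ _ (mul_mem_idealB i i n)

/-- Modulo ab one has a(a + b)^n = a^(n+1). -/
theorem pow_mul_succ_mem {A : Type*} [CommRing A] (I : Ideal A) (a b : A) (n : ℕ)
    (h1 : a * b ∈ I) (h2 : (a + b) ^ n ∈ I) : a ^ (n + 1) ∈ I := by
  have h3 : (a + b) - a ∣ (a + b) ^ n - a ^ n := sub_dvd_pow_sub_pow _ _ n
  rw [add_sub_cancel_left] at h3
  obtain ⟨c, hc⟩ := h3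
  have h4 : a ^ (n + 1) = a * (a + b) ^ n - c * (a * b) := by
    have : a ^ n = (a + b) ^ n - b * c := by rw [← hc]; ring
    rw [pow_succ, this]
    ring
  rw [h4]
  exact Ideal.sub_mem _ (Ideal.mul_mem_left _ _ h2) (Ideal.mul_mem_left _ _ h1)

/-- Take a and b to be x_i^d and y_i^d in the preceding observation: their product is in the ideal,
and their sum g_i has its n-th power there. -/
theorem X_pow_mem_idealB (v : Fin d ⊕ Fin d) (n : ℕ) :
    (MvPowerSeries.X v : ringR k d) ^ (d * (n + 1)) ∈ idealB k d n := by
  rw [pow_mul]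
  have hg : ∀ i, (varX k d i ^ d + varY k d i ^ d) ^ n ∈ idealB k d n := fun i =>
    Ideal.mem_sup_right (Ideal.pow_mem_pow (varX_pow_add_varY_pow_mem k d i) n)
  rcases v with i | i
  · exact pow_mul_succ_mem _ _ _ n (mul_pow_mem_idealB i n) (hg i)
  · refine pow_mul_succ_mem _ _ (varX k d i ^ d) n ?_ ?_
    · rw [mul_comm]
      exact mul_pow_mem_idealB i n
    · rw [add_comm]
      exact hg i

/-- The multiplier is the determinant of the relations (x_i^(d-1), f_i) and (0, y_j^(d-1)), so it
kills R²/N; the coefficients are those of Cramer's rule. -/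
theorem mul_pow_smul_mem_relModule (i j : Fin d) (z : ringR k d × ringR k d) :
    (varX k d i ^ (d - 1) * varY k d j ^ (d - 1)) • z ∈ relModule k d := by
  rw [mem_relModule_iff]
  classical
  refine ⟨Pi.single i (varY k d j ^ (d - 1) * z.1),
    Pi.single j (varX k d i ^ (d - 1) * z.2 - monF k d i * z.1), ?_, ?_⟩
  · simp [Pi.single_apply, ite_mul]
    ring
  · simp [Pi.single_apply, ite_mul]
    ring

theorem idealB_smul_mem {n : ℕ} {r : ringR k d} (hr : r ∈ idealB k d n)
    (z : ringR k d × ringR k d) :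
    r • z ∈ relModule k d ⊔
      idealA k d ^ n • (⊤ : Submodule (ringR k d) (ringR k d × ringR k d)) := by
  obtain ⟨a, ha, b, hb, rfl⟩ := Submodule.mem_sup.1 hr
  rw [add_smul]
  refine Submodule.add_mem_sup ?_ (Submodule.smul_mem_smul hb trivial)
  clear hr
  induction ha using Submodule.span_induction with
  | mem x hx =>
    obtain ⟨⟨i, j⟩, rfl⟩ := hx
    exact mul_pow_smul_mem_relModule i j z
  | zero => simp
  | add x y _ _ hx hy => rw [add_smul]; exact Submodule.add_mem _ hx hy
  | smul a x _ hx => rw [smul_assoc]; exact Submodule.smul_mem _ _ hx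

instance finite_quotient_relModule (n : ℕ) : Module.Finite k ((ringR k d × ringR k d) ⧸
    (relModule k d ⊔ idealA k d ^ n • (⊤ : Submodule (ringR k d) (ringR k d × ringR k d)))) :=
  finite_quotient_prod_of_X_pow_mem _ (d * (n + 1)) fun v z =>
    idealB_smul_mem (X_pow_mem_idealB v n) z

variable (k d)

instance finite_moduleM : Module.Finite k (moduleM k d) := by
  have h : Function.Surjective ((toM k d).restrictScalars k) := toM_surjective k d
  have h1 := finite_quotient_relModule (k := k) (d := d) 1
  rw [pow_one] at h1
  exact Module.Finite.of_surjective ((quotEquivM k d).toLinearMap.restrictScalars k)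
    (quotEquivM k d).surjective

theorem isFiniteLength_moduleM : IsFiniteLength (ringS k d) (moduleM k d) :=
  isFiniteLength_of_finite k

theorem isFiniteLength_moduleM_ringR : IsFiniteLength (ringR k d) (moduleM k d) :=
  isFiniteLength_of_finite k

theorem hasProjectiveDimensionLE_quotient (r : Fin d → ringR k d)
    (hr : ∀ i, r i ∈ IsLocalRing.maximalIdeal (ringR k d))
    (hreg : RingTheory.Sequence.IsWeaklyRegular (ringS k d) (List.ofFn r)) :
    HasProjectiveDimensionLE (ModuleCat.of (ringS k d)
      (ringS k d ⧸ Ideal.span (Set.range fun i => toS k d (r i)))) d := by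
  have hmap : (List.ofFn r).map (algebraMap (ringR k d) (ringS k d)) =
      List.ofFn fun i => toS k d (r i) := by
    rw [List.map_ofFn]
    rfl
  have hreg' : RingTheory.Sequence.IsWeaklyRegular (ringS k d)
      (List.ofFn fun i => toS k d (r i)) := by
    rw [← hmap, RingTheory.Sequence.isWeaklyRegular_map_algebraMap_iff]
    exact hreg
  have hmem : ∀ s ∈ List.ofFn fun i => toS k d (r i),
      s ∈ IsLocalRing.maximalIdeal (ringS k d) := by
    intro s hs
    obtain ⟨i, rfl⟩ := List.mem_ofFn.1 hs
    have : IsLocalHom (toS k d) := IsLocalHom.of_surjective _ Ideal.Quotient.mk_surjective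
    have h := ((IsLocalRing.local_hom_TFAE (toS k d)).out 0 3 rfl rfl).1 this
    exact h (hr i)
  have : Nontrivial (ModuleCat.of (ringS k d) (ringS k d)) :=
    inferInstanceAs (Nontrivial (ringS k d))
  have h := ModuleCat.projectiveDimension_quotient_eq_add_length_of_isWeaklyRegular
    (ModuleCat.of (ringS k d) (ringS k d)) (List.ofFn fun i => toS k d (r i)) hreg' hmem
  have hproj : Projective (ModuleCat.of (ringS k d) (ringS k d)) :=
    (IsProjective.iff_projective (ringS k d)).1 inferInstance
  rw [ModuleCat.projectiveDimension_eq_zero_of_projective (ModuleCat.of (ringS k d) (ringS k d)), zero_add, List.length_ofFn] at h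
  have hle := (projectiveDimension_le_iff _ d).1 h.le
  have heq : Ideal.ofList (List.ofFn fun i => toS k d (r i)) • (⊤ : Submodule (ringS k d) (ringS k d))
      = Ideal.span (Set.range fun i => toS k d (r i)) := by
    rw [ofList_ofFn]
    exact Ideal.mul_top _
  exact @hasProjectiveDimensionLT_of_iso _ _ _ _ _
    (Submodule.quotEquivOfEq _ _ heq).toModuleIso (d + 1) hle

theorem hasProjectiveDimensionLE_moduleM (hd : 2 ≤ d) :
    HasProjectiveDimensionLE (ModuleCat.of (ringS k d) (moduleM k d)) d := by
  have hX := hasProjectiveDimensionLE_quotient k d (fun i => varX k d i ^ (d - 1))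
    (fun i => Ideal.pow_mem_of_mem _ (varX_mem_maximalIdeal k d i) _ (by omega))
    (isWeaklyRegular_varX_pow k d (d - 1))
  have hY := hasProjectiveDimensionLE_quotient k d (fun i => varY k d i ^ (d - 1))
    (fun i => Ideal.pow_mem_of_mem _ (varY_mem_maximalIdeal k d i) _ (by omega))
    (isWeaklyRegular_varY_pow k d (d - 1))
  exact hasProjectiveDimensionLE_pushout (idealX k d) (eta k d) d hX hY

end Presentation

/-! ### The standard lifting system and the growth of its Fitting ideals -/

section LiftingSystems

theorem map_mkQ_smul_top {R F : Type*} [CommRing R] [AddCommGroup F] [Module R F]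
    (A : Submodule R F) (I : Ideal R) :
    (I • ⊤ : Submodule R (F ⧸ A)) = Submodule.map A.mkQ (I • ⊤) := by
  rw [Submodule.map_smul'', Submodule.map_top, Submodule.range_mkQ]

/-- `(F / A) / I (F / A) ≃ F / (A + I F)`. -/
def quotSMulTopEquiv {R F : Type*} [CommRing R] [AddCommGroup F] [Module R F]
    (A : Submodule R F) (I : Ideal R) :
    ((F ⧸ A) ⧸ (I • ⊤ : Submodule R (F ⧸ A))) ≃ₗ[R] F ⧸ (A ⊔ I • ⊤) :=
  (Submodule.quotEquivOfEq _ _ (map_mkQ_smul_top A I)).trans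
    (Submodule.quotientQuotientEquivQuotientSup A (I • ⊤))

variable (k : Type u) [Field k] (d : ℕ)

/-- The submodule `relModule + 𝔞 ^ n R ^ 2` of `R ^ 2`. -/
def relModulePow (n : ℕ) : Submodule (ringR k d) (ringR k d × ringR k d) :=
  relModule k d ⊔ idealA k d ^ n • (⊤ : Submodule (ringR k d) (ringR k d × ringR k d))

theorem relModulePow_succ_sup (n : ℕ) :
    relModulePow k d (n + 1) ⊔ idealA k d ^ n •
      (⊤ : Submodule (ringR k d) (ringR k d × ringR k d)) = relModulePow k d n := by
  have h : idealA k d ^ (n + 1) ≤ idealA k d ^ n := Ideal.pow_le_pow_right n.le_succ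
  have h1 : idealA k d ^ (n + 1) • (⊤ : Submodule (ringR k d) (ringR k d × ringR k d)) ≤
      idealA k d ^ n • ⊤ := Submodule.smul_mono_left h
  rw [relModulePow, relModulePow, sup_assoc, sup_eq_right.2 h1]

/-- The lifting system of `M` formed by the modules `L / 𝔞 ^ n L`, where `L` is the `R`-module with
the same generators and relations as `M`. -/
def standardSystem : LiftingSystem (idealA k d) (moduleM k d) where
  obj n := ModuleCat.of _ ((ringR k d × ringR k d) ⧸ relModulePow k d n)
  finite_length n := by
    have := finite_quotient_relModule (k := k) (d := d) n
    exact isFiniteLength_of_finite k (A := ringR k d)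
      (N := (ringR k d × ringR k d) ⧸ (relModule k d ⊔ idealA k d ^ n • ⊤))
  le_annihilator n := by
    intro r hr
    rw [Module.mem_annihilator]
    intro y
    obtain ⟨z, rfl⟩ := Submodule.Quotient.mk_surjective _ y
    rw [← Submodule.Quotient.mk_smul, Submodule.Quotient.mk_eq_zero]
    exact Submodule.mem_sup_right (Submodule.smul_mem_smul hr trivial)
  iso n := (quotSMulTopEquiv _ _).trans
    (Submodule.quotEquivOfEq _ _ (relModulePow_succ_sup k d n))
  base := (Submodule.quotEquivOfEq _ _ (by rw [relModulePow, pow_one])).trans (quotEquivM k d)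

theorem det_mem_fittingIdealZero {R : Type u} [CommRing R] (N : Submodule R (R × R))
    {z w : R × R} (hz : z ∈ N) (hw : w ∈ N) :
    z.1 * w.2 - z.2 * w.1 ∈ fittingIdealZero R ((R × R) ⧸ N) := by
  have hN : ∀ y ∈ N, y.1 • (Submodule.Quotient.mk (1, 0) : (R × R) ⧸ N) +
      y.2 • Submodule.Quotient.mk (0, 1) = 0 := by
    intro y hy
    rw [← Submodule.Quotient.mk_smul, ← Submodule.Quotient.mk_smul, ← Submodule.Quotient.mk_add,
      Submodule.Quotient.mk_eq_zero]
    simpa using hy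
  refine Ideal.subset_span ⟨2, ![Submodule.Quotient.mk (1, 0), Submodule.Quotient.mk (0, 1)],
    !![z.1, z.2; w.1, w.2], ?_, ?_, ?_⟩
  · rw [eq_top_iff]
    rintro y -
    obtain ⟨⟨p, q⟩, rfl⟩ := Submodule.Quotient.mk_surjective _ y
    have : (Submodule.Quotient.mk (p, q) : (R × R) ⧸ N) =
        p • Submodule.Quotient.mk (1, 0) + q • Submodule.Quotient.mk (0, 1) := by
      rw [← Submodule.Quotient.mk_smul, ← Submodule.Quotient.mk_smul, ← Submodule.Quotient.mk_add]
      simp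
    rw [this]
    exact Submodule.add_mem _ (Submodule.smul_mem _ _ (Submodule.subset_span ⟨0, rfl⟩))
      (Submodule.smul_mem _ _ (Submodule.subset_span ⟨1, rfl⟩))
  · intro i
    fin_cases i
    · simpa using hN z hz
    · simpa using hN w hw
  · rw [Matrix.det_fin_two_of]

theorem smul_eq_zero_of_mem_fittingIdealZero {R N : Type u} [CommRing R] [AddCommGroup N]
    [Module R N] {r : R} (hr : r ∈ fittingIdealZero R N) (x : N) : r • x = 0 := by
  suffices h : fittingIdealZero R N ≤ Module.annihilator R N from Module.mem_annihilator.1 (h hr) x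
  rw [fittingIdealZero, Ideal.span_le]
  rintro _ ⟨m, v, A, hv, hA, rfl⟩
  rw [SetLike.mem_coe, Module.mem_annihilator]
  have hj : ∀ j, A.det • v j = 0 := by
    intro j
    have h1 : ∑ l, (A.adjugate * A) j l • v l = 0 := by
      simp only [Matrix.mul_apply, Finset.sum_smul, mul_smul]
      rw [Finset.sum_comm]
      refine Finset.sum_eq_zero fun i _ => ?_
      rw [← Finset.smul_sum, hA, smul_zero]
    rw [Matrix.adjugate_mul] at h1
    simpa [Matrix.smul_apply, Matrix.one_apply, ite_smul] using h1
  intro x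
  have hx : x ∈ Submodule.span R (Set.range v) := hv ▸ trivial
  induction hx using Submodule.span_induction with
  | mem x hx => obtain ⟨j, rfl⟩ := hx; exact hj j
  | zero => exact smul_zero _
  | add x y _ _ hx hy => rw [smul_add, hx, hy, add_zero]
  | smul c x _ hx => rw [smul_comm, hx, smul_zero]

/-- All generators come from 2 × 2 minors. Two relations of N give x_i^(d-1) y_j^(d-1). For h in
𝔞^n, a relation of N and a multiple of a basis vector by h give x_i^(d-1) h and h y_i^(d-1), and h
g_i is a combination of these. -/
theorem idealB_le_fittingIdealZero (n : ℕ) : idealB k d (n + 1) ≤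
    fittingIdealZero (ringR k d) ((ringR k d × ringR k d) ⧸ relModulePow k d n) := by
  have hX : ∀ i, relX k d i ∈ relModulePow k d n := fun i => Submodule.mem_sup_left (relX_mem i)
  have hY : ∀ i, relY k d i ∈ relModulePow k d n := fun i => Submodule.mem_sup_left (relY_mem i)
  refine sup_le ?_ ?_
  · rw [Ideal.span_le]
    rintro _ ⟨⟨i, j⟩, rfl⟩
    simpa [relX, relY] using det_mem_fittingIdealZero _ (hX i) (hY j)
  · rw [pow_succ, Ideal.mul_le]
    intro h hh r hr
    have hh1 : ∀ z, h • z ∈ relModulePow k d n := fun z =>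
      Submodule.mem_sup_right (Submodule.smul_mem_smul hh trivial)
    refine (Ideal.span_le.2 ?_ : idealA k d ≤ Submodule.comap (LinearMap.mulLeft _ h)
      (fittingIdealZero (ringR k d) ((ringR k d × ringR k d) ⧸ relModulePow k d n))) hr
    rintro _ ⟨i, rfl⟩
    change h * (varX k d i ^ d + varY k d i ^ d) ∈
      fittingIdealZero (ringR k d) ((ringR k d × ringR k d) ⧸ relModulePow k d n)
    have h1 := det_mem_fittingIdealZero _ (hX i) (hh1 (0, 1))
    have h2 := det_mem_fittingIdealZero _ (hh1 (1, 0)) (hY i)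
    simp only [relX, relY, Prod.smul_mk, smul_eq_mul, mul_one, mul_zero, sub_zero] at h1 h2
    have hpow : ∀ x : ringR k d, x ^ d = x * x ^ (d - 1) := fun x => by
      rw [← pow_succ', Nat.sub_add_cancel i.pos]
    have h3 : h * (varX k d i ^ d + varY k d i ^ d) =
        varX k d i * (varX k d i ^ (d - 1) * h) + varY k d i * (h * varY k d i ^ (d - 1)) := by
      rw [hpow, hpow]; ring
    rw [h3]
    have h2' : h * varY k d i ^ (d - 1) ∈
        fittingIdealZero (ringR k d) ((ringR k d × ringR k d) ⧸ relModulePow k d n) := by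
      simpa using h2
    exact Ideal.add_mem _ (Ideal.mul_mem_left _ _ h1) (Ideal.mul_mem_left _ _ h2')

/-- A monomial divisible by no x_i^(d-1) y_j^(d-1) has all x-exponents below d or all y-exponents
below d. With the general bound d(n+1) this leaves two boxes in which only d exponents grow, hence
order n^d rather than n^(2d). -/
theorem finite_quotient_idealB_le (I : Ideal (ringR k d)) (n : ℕ) (hI : idealB k d n ≤ I) :
    Module.Finite k (ringR k d ⧸ I) ∧
      Module.finrank k (ringR k d ⧸ I) ≤ 2 * (d ^ d * (d * (n + 1)) ^ d) := by
  classical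
  set T : Finset ((Fin d ⊕ Fin d) →₀ ℕ) :=
    boxExp (Sum.elim (fun _ => d) fun _ => d * (n + 1)) ∪
      boxExp (Sum.elim (fun _ => d * (n + 1)) fun _ => d) with hT
  have hcard : T.card ≤ 2 * (d ^ d * (d * (n + 1)) ^ d) := by
    refine (Finset.card_union_le _ _).trans ?_
    rw [card_boxExp, card_boxExp]
    simp only [Fintype.prod_sum_type, Sum.elim_inl, Sum.elim_inr, Finset.prod_const,
      Finset.card_univ, Fintype.card_fin]
    rw [two_mul]
    exact add_le_add le_rfl (mul_comm _ _).le
  have h := finite_quotient_of_coeff I T fun p hp => ?_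
  · exact ⟨h.1, h.2.trans hcard⟩
  refine mem_of_coeff_eq_zero I T
    (Sum.elim (fun p : Fin d × Fin d => Finsupp.single (Sum.inl p.1) (d - 1) +
      Finsupp.single (Sum.inr p.2) (d - 1)) fun v => Finsupp.single v (d * (n + 1)))
    (fun i => hI ?_) (fun m hm => ?_) p hp
  · rcases i with ⟨i, j⟩ | v
    · have h1 := mul_mem_idealB (k := k) i j n
      rwa [varX, varY, MvPowerSeries.X_pow_eq, MvPowerSeries.X_pow_eq,
        MvPowerSeries.monomial_mul_monomial, one_mul] at h1
    · have h1 := X_pow_mem_idealB (k := k) v n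
      rwa [MvPowerSeries.X_pow_eq] at h1
  · have h1 : ∀ v, m v < d * (n + 1) := fun v => by
      have := hm (Sum.inr v)
      rwa [Sum.elim_inr, Finsupp.single_le_iff, not_le] at this
    rw [hT, Finset.mem_union, mem_boxExp, mem_boxExp]
    by_cases hx : ∀ i, m (Sum.inl i) < d
    · left
      rintro (i | i)
      · exact hx i
      · exact h1 _
    · right
      push Not at hx
      obtain ⟨i, hi⟩ := hx
      rintro (j | j)
      · exact h1 _
      · by_contra hj
        refine hm (Sum.inl (i, j)) fun v => ?_
        simp only [Sum.elim_inl, Sum.elim_inr, not_lt] at hj ⊢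
        rcases v with v | v
        · by_cases hv : i = v
          · subst hv; simp; omega
          · simp [hv]
        · by_cases hv : j = v
          · subst hv; simp; omega
          · simp [hv]

theorem fst_mem_of_mem_relModulePow {n : ℕ} {z : ringR k d × ringR k d}
    (hz : z ∈ relModulePow k d n) :
    z.1 ∈ Ideal.span (Set.range fun i => varX k d i ^ (d - 1)) ⊔ idealA k d ^ n := by
  obtain ⟨x, hx, y, hy, rfl⟩ := Submodule.mem_sup.1 hz
  obtain ⟨s, t, h1, -⟩ := (mem_relModule_iff x).1 hx
  rw [mem_smul_top_prod] at hy
  refine Submodule.add_mem_sup ?_ hy.1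
  rw [h1]
  exact Ideal.sum_mem _ fun i _ => Ideal.mul_mem_left _ _ (Ideal.subset_span ⟨i, rfl⟩)

theorem idealA_pow_le_maximalIdeal_pow (n : ℕ) :
    idealA k d ^ n ≤ IsLocalRing.maximalIdeal (ringR k d) ^ (d * n) := by
  rw [pow_mul]
  exact Ideal.pow_right_mono (idealA_le_maximalIdeal_pow k d) n

/-- The Fitting ideal kills the class of (1, 0), so it lies in (x_i^(d-1)) + 𝔞^n ⊆ (x_i^(d-1)) +
𝔪^(dn). The n^d monomials in y alone with exponents below n have degree below dn and do not occur in
its elements. -/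
theorem pow_le_finrank_quotient_fittingIdealZero (hd : 2 ≤ d) (n : ℕ)
    [Module.Finite k (ringR k d ⧸ fittingIdealZero (ringR k d)
      ((ringR k d × ringR k d) ⧸ relModulePow k d n))] :
    n ^ d ≤ Module.finrank k (ringR k d ⧸ fittingIdealZero (ringR k d)
      ((ringR k d × ringR k d) ⧸ relModulePow k d n)) := by
  classical
  have h := card_le_finrank_quotient (fittingIdealZero (ringR k d)
      ((ringR k d × ringR k d) ⧸ relModulePow k d n))
    (boxExp (Sum.elim (fun _ : Fin d => 1) fun _ : Fin d => n)) fun p hp m hm => ?_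
  · simpa [card_boxExp, Fintype.prod_sum_type] using h
  rw [mem_boxExp] at hm
  have hx : ∀ i, m (Sum.inl i) = 0 := fun i => Nat.lt_one_iff.1 (hm (Sum.inl i))
  have hy : ∀ i, m (Sum.inr i) < n := fun i => hm (Sum.inr i)
  have h0 := smul_eq_zero_of_mem_fittingIdealZero hp (Submodule.Quotient.mk (1, 0))
  rw [← Submodule.Quotient.mk_smul, Submodule.Quotient.mk_eq_zero] at h0
  have h1 := fst_mem_of_mem_relModulePow k d h0
  simp only [Prod.smul_fst, smul_eq_mul, mul_one] at h1
  obtain ⟨a, ha, b, hb, rfl⟩ := Submodule.mem_sup.1 h1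
  rw [map_add]
  have hdeg : m.degree < d * n := by
    rw [Finsupp.degree_eq_sum, Fintype.sum_sum_type, Finset.sum_eq_zero fun i _ => hx i, zero_add]
    have : (Finset.univ : Finset (Fin d)).Nonempty := ⟨⟨0, by omega⟩, Finset.mem_univ _⟩
    calc ∑ i, m (Sum.inr i) < ∑ _i : Fin d, n :=
          Finset.sum_lt_sum_of_nonempty this fun i _ => hy i
      _ = d * n := by simp
  rw [coeff_eq_zero_of_mem_maximalIdeal_pow (idealA_pow_le_maximalIdeal_pow k d n hb) hdeg,
    add_zero]
  rw [Ideal.mem_span_range_iff_exists_fun] at ha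
  obtain ⟨c, rfl⟩ := ha
  rw [map_sum]
  refine Finset.sum_eq_zero fun i _ => ?_
  rw [coeff_mul_x_pow, hx, if_neg (by omega)]

theorem growsLikePow_standardSystem (hd : 2 ≤ d) :
    GrowsLikePow (fun n => Module.length (ringR k d)
      (ringR k d ⧸ fittingIdealZero (ringR k d) ((standardSystem k d).obj n))) d := by
  have hdpos : (0 : ℝ) < 2 * (d ^ d * d ^ d) := by positivity
  refine ⟨Polynomial.X ^ d,
    -- The shift by 2 comes from `idealB` being used with n + 1, whose exponent bound is d(n+2).
    Polynomial.C (2 * (d ^ d * d ^ d) : ℝ) * (Polynomial.X + Polynomial.C 2) ^ d, by simp, by simp,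
    ?_, ?_, Filter.Eventually.of_forall fun n => ?_⟩
  · rw [Polynomial.natDegree_C_mul hdpos.ne', Polynomial.natDegree_pow,
      Polynomial.natDegree_X_add_C, mul_one]
  · rw [Polynomial.leadingCoeff_mul, Polynomial.leadingCoeff_C, Polynomial.leadingCoeff_pow,
      Polynomial.leadingCoeff_X_add_C, one_pow, mul_one]
    exact hdpos
  · obtain ⟨hfin, hle⟩ := finite_quotient_idealB_le k d _ (n + 1)
      (idealB_le_fittingIdealZero k d n)
    have hge := pow_le_finrank_quotient_fittingIdealZero k d hd n
    have hlen := (length_eq_finrank_of_residue (k := k) (R := ringR k d) (M := ringR k d ⧸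
      fittingIdealZero (ringR k d) ((ringR k d × ringR k d) ⧸ relModulePow k d n))
      sub_constantCoeff_mem).2
    refine ⟨_, hlen, ?_, ?_⟩
    · rw [Polynomial.eval_pow, Polynomial.eval_X]
      exact_mod_cast hge
    · refine (Nat.cast_le.2 hle).trans (le_of_eq ?_)
      simp only [Polynomial.eval_mul, Polynomial.eval_C, Polynomial.eval_pow, Polynomial.eval_add,
        Polynomial.eval_X]
      push_cast
      rw [mul_pow]
      ring

end LiftingSystems

/-! ### Naive lifts and their dimension -/

section NaiveLifts

theorem isNaiveLift_iff {R : Type u} [CommRing R] (a : Ideal R) (M : Type u) [AddCommGroup M]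
    [Module R M] [Module (R ⧸ a) M] [IsScalarTower R (R ⧸ a) M] (L : ModuleCat.{u} R) :
    IsNaiveLift a M L ↔
      Module.Finite R L ∧ Nonempty ((L ⧸ (a • ⊤ : Submodule R L)) ≃ₗ[R] M) := by
  refine and_congr_right fun _ => ⟨fun ⟨e⟩ => ⟨?_⟩, fun ⟨e⟩ => ⟨?_⟩⟩
  · exact (TensorProduct.quotTensorEquivQuotSMul L a).symm.trans (e.restrictScalars R)
  · exact LinearEquiv.extendScalarsOfSurjective (S := R ⧸ a) Ideal.Quotient.mk_surjective
      ((TensorProduct.quotTensorEquivQuotSMul L a).trans e)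

variable (k : Type u) [Field k] (d : ℕ)

/-- The `R`-module with the same generators and relations as `M`. -/
def standardLift : ModuleCat.{u} (ringR k d) :=
  ModuleCat.of _ ((ringR k d × ringR k d) ⧸ relModule k d)

theorem isNaiveLift_standardLift :
    IsNaiveLift (idealA k d) (moduleM k d) (standardLift k d) := by
  rw [isNaiveLift_iff]
  refine ⟨inferInstanceAs (Module.Finite (ringR k d)
    ((ringR k d × ringR k d) ⧸ relModule k d)), ⟨?_⟩⟩
  exact (quotSMulTopEquiv (relModule k d) (idealA k d)).trans (quotEquivM k d)

variable {k d} in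
theorem nontrivial_moduleM (hd : 2 ≤ d) : Nontrivial (moduleM k d) := by
  refine ⟨toM k d (1, 0), 0, fun h => ?_⟩
  rw [← LinearMap.mem_ker, ker_toM, ← pow_one (idealA k d)] at h
  have h1 := fst_mem_of_mem_relModulePow k d h
  rw [pow_one] at h1
  refine (IsLocalRing.maximalIdeal.isMaximal (ringR k d)).ne_top ((Ideal.eq_top_iff_one _).2 ?_)
  refine (sup_le ?_ (idealA_le_maximalIdeal k d)) h1
  rw [Ideal.span_le]
  rintro _ ⟨i, rfl⟩
  exact Ideal.pow_mem_of_mem _ (varX_mem_maximalIdeal k d i) _ (by omega)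

variable {k d} in
-- Cutting L down to M, of dimension 0, takes d elements of the maximal ideal, each lowering the
-- dimension by at most one.
theorem supportDim_le_of_isNaiveLift (hd : 2 ≤ d) {L : ModuleCat.{u} (ringR k d)}
    (hL : IsNaiveLift (idealA k d) (moduleM k d) L) : Module.supportDim (ringR k d) L ≤ d := by
  rw [isNaiveLift_iff] at hL
  obtain ⟨_, ⟨e⟩⟩ := hL
  have h := supportDim_le_supportDim_quotient_add_length (List.ofFn (polyG k d))
    (fun r hr => by
      obtain ⟨i, rfl⟩ := List.mem_ofFn.1 hr
      exact idealA_le_maximalIdeal k d (Ideal.subset_span ⟨i, rfl⟩)) L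
  rw [ofList_ofFn, List.length_ofFn] at h
  have := nontrivial_moduleM (k := k) hd
  have h2 := supportDim_eq_zero_of_isFiniteLength (isFiniteLength_moduleM_ringR k d)
  change _ ≤ Module.supportDim (ringR k d) (L ⧸ (idealA k d • ⊤ : Submodule (ringR k d) L)) + d at h
  rwa [Module.supportDim_eq_of_equiv e, h2, zero_add] at h

/-- Projection to the first coordinate maps F/N onto R/(x_1^(d-1), …, x_d^(d-1)), whose dimension is
at least 2d - d. -/
theorem le_supportDim_standardLift (hd : 2 ≤ d) :
    (d : WithBot ℕ∞) ≤ Module.supportDim (ringR k d) (standardLift k d) := by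
  set I : Ideal (ringR k d) := Ideal.span (Set.range fun i => varX k d i ^ (d - 1)) with hI
  let f : (ringR k d × ringR k d) ⧸ relModule k d →ₗ[ringR k d] (ringR k d ⧸ I) :=
    Submodule.liftQ _ (I.mkQ ∘ₗ LinearMap.fst _ _ _) (by
      intro z hz
      obtain ⟨s, t, h1, -⟩ := (mem_relModule_iff z).1 hz
      refine (Submodule.Quotient.mk_eq_zero _).2 ?_
      change z.1 ∈ I
      rw [h1]
      exact Ideal.sum_mem _ fun i _ => Ideal.mul_mem_left _ _ (Ideal.subset_span ⟨i, rfl⟩))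
  have hf : Function.Surjective f := by
    intro y
    obtain ⟨x, rfl⟩ := Submodule.Quotient.mk_surjective _ y
    exact ⟨Submodule.Quotient.mk (x, 0), rfl⟩
  refine le_trans ?_ (Module.supportDim_le_of_surjective f hf)
  have h := supportDim_le_supportDim_quotient_add_length (List.ofFn fun i => varX k d i ^ (d - 1))
    (fun r hr => by
      obtain ⟨i, rfl⟩ := List.mem_ofFn.1 hr
      exact Ideal.pow_mem_of_mem _ (varX_mem_maximalIdeal k d i) _ (by omega)) (ringR k d)
  rw [ofList_ofFn, List.length_ofFn, smul_eq_mul, Ideal.mul_top,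
    Module.supportDim_self_eq_ringKrullDim, ringKrullDim_ringR] at h
  exact ENat.WithBot.add_le_add_natCast_right_iff.1 h

theorem isSerreLiftable_moduleM (hd : 2 ≤ d) : IsSerreLiftable (idealA k d) (moduleM k d) := by
  refine ⟨d, ⟨⟨standardLift k d, isNaiveLift_standardLift k d, ?_⟩, ?_⟩, ?_⟩
  · exact le_antisymm (supportDim_le_of_isNaiveLift hd (isNaiveLift_standardLift k d))
      (le_supportDim_standardLift k d hd)
  · rintro r ⟨L, hL, rfl⟩
    exact supportDim_le_of_isNaiveLift hd hL
  · rw [ringKrullDim_ringR]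
    exact congrArg _ (ringKrullDim_ringS k d)

end NaiveLifts

/-! ### Elements of K ∩ IF as classes in Tor_1(F/K, R/I) -/

section Tor

open TensorProduct MonoidalCategory

/-- A map ψ on chains that vanishes on boundaries detects homology: it factors through the opcycles,
so a cycle with zero homology class has zero image under it. -/
theorem comp_eq_zero_of_homologyMap {C : Type*} [Category* C] [Abelian C]
    {K K' : ChainComplex C ℕ} (F : K ⟶ K') {A Q : C} (w : A ⟶ K.X 1) (hw : w ≫ K.d 1 0 = 0)
    (ψ : K'.X 1 ⟶ Q) (hψ : K'.d 2 1 ≫ ψ = 0)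
    (h : (K.liftCycles w 0 (by simp) hw ≫ K.homologyπ 1) ≫ HomologicalComplex.homologyMap F 1 = 0) :
    w ≫ F.f 1 ≫ ψ = 0 := by
  have h1 := congrArg (· ≫ K'.homologyι 1 ≫ K'.descOpcycles ψ 2 (by simp) hψ) h
  simpa using h1

theorem comp_eq_zero_of_conj {C : Type*} [Category* C] [HasZeroMorphisms C] {A X Y Z W : C}
    (e : X ≅ Y) (e' : W ≅ Z) {a : A ⟶ Y} {m : Y ⟶ Z} (h : (a ≫ e.inv) ≫ e.hom ≫ m ≫ e'.inv = 0) :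
    a ≫ m = 0 := by
  rw [Category.assoc, Iso.inv_hom_id_assoc, ← Category.assoc] at h
  exact zero_of_comp_mono _ h

theorem exists_eq_sum_smul_of_mem_span_smul_top {R F ι : Type*} [CommRing R] [AddCommGroup F]
    [Module R F] [Fintype ι] (g : ι → R) {x : F}
    (hx : x ∈ Ideal.span (Set.range g) • (⊤ : Submodule R F)) : ∃ z : ι → F, x = ∑ i, g i • z i := by
  have h : Ideal.span (Set.range g) • (⊤ : Submodule R F) ≤
      LinearMap.range (∑ i, g i • LinearMap.proj (R := R) (φ := fun _ => F) i) := by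
    rw [Submodule.smul_le]
    intro r hr y _
    obtain ⟨c, rfl⟩ := (Ideal.mem_span_range_iff_exists_fun).1 hr
    exact ⟨fun i => c i • y, by
      simp only [LinearMap.sum_apply, LinearMap.smul_apply, LinearMap.proj_apply, Finset.sum_smul]
      exact Finset.sum_congr rfl fun i _ => by rw [smul_smul, mul_comm]⟩
  obtain ⟨z, rfl⟩ := h hx
  exact ⟨z, by simp⟩

/-- Apply the well-defined map (F/K) ⊗ I → F/IK, x ⊗ r ↦ r x. -/
theorem sum_smul_mem_smul_of_sum_tmul_eq_zero {R F ι : Type*} [CommRing R] [AddCommGroup F]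
    [Module R F] [Fintype ι] (I : Ideal R) (K : Submodule R F) (g : ι → I) (z : ι → F)
    (h : ∑ i, K.mkQ (z i) ⊗ₜ[R] g i = 0) : ∑ i, (g i : R) • z i ∈ I • K := by
  let B : F ⧸ K →ₗ[R] I →ₗ[R] F ⧸ (I • K) :=
    K.liftQ (LinearMap.mk₂ R (fun x r => (I • K).mkQ ((r : R) • x))
      (fun x y r => by rw [smul_add, map_add]) (fun c x r => by rw [smul_comm, map_smul])
      (fun x r s => by rw [Submodule.coe_add, add_smul, map_add])
      (fun c x r => by rw [Submodule.coe_smul, smul_assoc, map_smul])) (by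
        intro x hx
        ext r
        exact (Submodule.Quotient.mk_eq_zero _).2 (Submodule.smul_mem_smul r.2 hx))
  have h1 := congrArg (TensorProduct.lift B) h
  rw [map_sum, map_zero] at h1
  rw [← Submodule.Quotient.mk_eq_zero, ← Submodule.mkQ_apply, map_sum]
  exact h1

variable {R : Type u} [CommRing R]

/-- The class is the one that the connecting map Tor_1(L, R/I) → L ⊗ I sends to ∑ z_i ⊗ g_i, made
explicit on a projective resolution P of R/I. With p ∈ P_0 over 1 and y_i ∈ P_1 bounding g_i p, it
is represented by the cycle ∑ z_i ⊗ y_i. One τ serves all N by naturality. -/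
theorem exists_hom_tor_one {ι : Type*} [Fintype ι] (I : Ideal R) (g : ι → I) (L : ModuleCat.{u} R)
    (z : ι → L) (hz : ∑ i, (g i : R) • z i = 0) :
    ∃ τ : ModuleCat.of R R ⟶ ((Tor (ModuleCat.{u} R) 1).obj L).obj (ModuleCat.of R (R ⧸ I)),
      ∀ (N : ModuleCat.{u} R) (f : L ⟶ N),
        τ ≫ ((Tor (ModuleCat.{u} R) 1).map f).app (ModuleCat.of R (R ⧸ I)) = 0 →
          ∑ i, f.hom (z i) ⊗ₜ[R] g i = 0 := by
  let S := ModuleCat.of R (R ⧸ I)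
  let P : ProjectiveResolution S := projectiveResolution S
  let π : P.complex.X 0 ⟶ S := P.π.f 0
  let q : ModuleCat.of R R ⟶ S := ModuleCat.ofHom I.mkQ
  have hq : Epi q := (ModuleCat.epi_iff_surjective _).2 I.mkQ_surjective
  have hπ : Function.Surjective π.hom :=
    (ModuleCat.epi_iff_surjective _).1 (inferInstanceAs (Epi (P.π.f 0)))
  obtain ⟨p, hp⟩ := hπ (Submodule.Quotient.mk 1)
  have hdπ : P.complex.d 1 0 ≫ π = 0 := P.complex_d_comp_π_f_zero
  have hex : ∀ x : P.complex.X 0, π.hom x = 0 → ∃ y, (P.complex.d 1 0).hom y = x := by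
    have := (ShortComplex.moduleCat_exact_iff _).1 P.exact₀
    exact this
  have hgp : ∀ i, ∃ y, (P.complex.d 1 0).hom y = (g i : R) • p := fun i => hex _ (by
    rw [map_smul, hp, ← Submodule.Quotient.mk_smul, Submodule.Quotient.mk_eq_zero]
    simp)
  choose y hy using hgp
  let φ : P.complex.X 0 ⟶ ModuleCat.of R R := Projective.factorThru π q
  have hφ : φ ≫ q = π := Projective.factorThru_comp _ _
  have hφmem : ∀ x, π.hom x = 0 → φ.hom x ∈ I := by
    intro x hx
    rw [← hφ] at hx
    exact (Submodule.Quotient.mk_eq_zero _).1 hx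
  -- ρ : P_1 → I represents the connecting map; it is the differential followed by a lift φ : P_0 →
  -- R of the augmentation.
  let ρ : P.complex.X 1 ⟶ ModuleCat.of R I := ModuleCat.ofHom
    (LinearMap.codRestrict I (φ.hom ∘ₗ (P.complex.d 1 0).hom) fun x => hφmem _ (by
      exact congrArg (fun t => t.hom x) hdπ))
  have hρ : P.complex.d 2 1 ≫ ρ = 0 := by
    refine ModuleCat.hom_ext (LinearMap.ext fun x => Subtype.ext ?_)
    exact (congrArg (fun t => φ.hom (t.hom x)) (P.complex.d_comp_d 2 1 0)).trans (map_zero _)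
  have hφp : φ.hom p - 1 ∈ I := by
    rw [← Submodule.Quotient.mk_eq_zero, Submodule.Quotient.mk_sub, sub_eq_zero, ← hp, ← hφ]
    rfl
  -- φ p equals 1 only modulo I; the resulting error is (∑ g_i f(z_i)) ⊗ (φ p - 1), which vanishes
  -- by `hz`.
  have key : ∀ (N : ModuleCat.{u} R) (f : L ⟶ N),
      ∑ i, f.hom (z i) ⊗ₜ[R] ρ.hom (y i) = ∑ i, f.hom (z i) ⊗ₜ[R] g i := by
    intro N f
    have h1 : ∀ i, ρ.hom (y i) = g i + (g i : R) • (⟨_, hφp⟩ : I) := by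
      intro i
      apply Subtype.ext
      change φ.hom ((P.complex.d 1 0).hom (y i)) = _
      rw [hy, map_smul]
      simp [mul_sub]
    simp only [h1, tmul_add, Finset.sum_add_distrib, ← smul_tmul]
    rw [← sum_tmul]
    simp only [← map_smul, ← map_sum, hz, map_zero, zero_tmul, add_zero]
  let T : ModuleCat.{u} R → ModuleCat.{u} R ⥤ ModuleCat.{u} R :=
    fun N => (tensoringLeft (ModuleCat.{u} R)).obj N
  let K : ModuleCat.{u} R → ChainComplex (ModuleCat.{u} R) ℕ :=
    fun N => ((T N).mapHomologicalComplex _).obj P.complex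
  let w : ModuleCat.of R R ⟶ (K L).X 1 :=
    ModuleCat.ofHom (LinearMap.toSpanSingleton R (TensorProduct R L (P.complex.X 1))
      (∑ i, z i ⊗ₜ y i))
  have hw : w ≫ (K L).d 1 0 = 0 := by
    ext
    change (LinearMap.lTensor L (P.complex.d 1 0).hom) ((1 : R) • ∑ i, z i ⊗ₜ y i) = 0
    rw [one_smul, map_sum]
    simp only [LinearMap.lTensor_tmul, hy, ← smul_tmul]
    rw [← sum_tmul, hz, zero_tmul]
  refine ⟨((K L).liftCycles w 0 (by simp) hw ≫ (K L).homologyπ 1) ≫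
    (P.isoLeftDerivedObj (T L) 1).inv, fun N f hf => ?_⟩
  let F : K L ⟶ K N := (NatTrans.mapHomologicalComplex
    ((tensoringLeft (ModuleCat.{u} R)).map f) _).app P.complex
  have hF : ((K L).liftCycles w 0 (by simp) hw ≫ (K L).homologyπ 1) ≫
      HomologicalComplex.homologyMap F 1 = 0 := by
    change _ ≫ (NatTrans.leftDerived ((tensoringLeft (ModuleCat.{u} R)).map f) 1).app S = 0 at hf
    rw [ProjectiveResolution.leftDerived_app_eq _ P] at hf
    exact comp_eq_zero_of_conj (P.isoLeftDerivedObj (T L) 1) (P.isoLeftDerivedObj (T N) 1) hf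
  have h2 := comp_eq_zero_of_homologyMap F w hw (N ◁ ρ)
    (by
      change N ◁ P.complex.d 2 1 ≫ N ◁ ρ = 0
      rw [← whiskerLeft_comp, hρ, MonoidalPreadditive.whiskerLeft_zero]) hF
  have h3 : (LinearMap.lTensor N ρ.hom) ((LinearMap.rTensor (P.complex.X 1) f.hom)
      ((1 : R) • ∑ i, z i ⊗ₜ y i)) = 0 := congrArg (fun t => t.hom 1) h2
  rw [one_smul, map_sum, map_sum] at h3
  simpa [key] using h3

/-- If `x ∈ K ∩ I F`, then `x` defines an element of `Tor_1(F / K, R / I)`, whose image in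
`Tor_1(F / N, R / I)` is nonzero as long as `K ≤ N` and `x ∉ I N`. -/
theorem exists_hom_tor_one_quotient {F : Type u} {ι : Type*} [AddCommGroup F] [Module R F]
    [Fintype ι] (g : ι → R) (K : Submodule R F) {x : F} (hxK : x ∈ K)
    (hx : x ∈ Ideal.span (Set.range g) • (⊤ : Submodule R F)) :
    ∃ τ : ModuleCat.of R R ⟶ ((Tor (ModuleCat.{u} R) 1).obj (ModuleCat.of R (F ⧸ K))).obj
        (ModuleCat.of R (R ⧸ Ideal.span (Set.range g))),
      ∀ (N : ModuleCat.{u} R) (f : ModuleCat.of R (F ⧸ K) ⟶ N) (φ : F →ₗ[R] N),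
        Function.Surjective φ → f.hom ∘ₗ K.mkQ = φ →
        τ ≫ ((Tor (ModuleCat.{u} R) 1).map f).app
          (ModuleCat.of R (R ⧸ Ideal.span (Set.range g))) = 0 →
          x ∈ Ideal.span (Set.range g) • LinearMap.ker φ := by
  obtain ⟨z, rfl⟩ := exists_eq_sum_smul_of_mem_span_smul_top g hx
  let g' : ι → Ideal.span (Set.range g) := fun i => ⟨g i, Ideal.subset_span ⟨i, rfl⟩⟩
  obtain ⟨τ, hτ⟩ := exists_hom_tor_one (Ideal.span (Set.range g)) g' (ModuleCat.of R (F ⧸ K))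
    (fun i => K.mkQ (z i)) (by
      simp only [← map_smul, ← map_sum]
      exact (Submodule.Quotient.mk_eq_zero _).2 hxK)
  refine ⟨τ, fun N f φ hφ hf h => ?_⟩
  have h1 := hτ N f h
  refine sum_smul_mem_smul_of_sum_tmul_eq_zero _ (LinearMap.ker φ) g' z ?_
  have h2 := congrArg (LinearMap.rTensor _ (φ.quotKerEquivOfSurjective hφ).symm.toLinearMap) h1
  rw [map_sum, map_zero] at h2
  rw [← h2]
  refine Finset.sum_congr rfl fun i _ => ?_
  have h3 : f.hom (K.mkQ (z i)) = φ (z i) := LinearMap.congr_fun hf (z i)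
  rw [LinearMap.rTensor_tmul, h3]
  congr 1
  exact ((φ.quotKerEquivOfSurjective hφ).symm_apply_eq.2 rfl).symm

theorem inf_smul_top_le_of_isZero_tor {F : Type u} {ι : Type*} [AddCommGroup F] [Module R F]
    [Fintype ι] (g : ι → R) (K : Submodule R F)
    (h : IsZero (((Tor (ModuleCat.{u} R) 1).obj (ModuleCat.of R (F ⧸ K))).obj
      (ModuleCat.of R (R ⧸ Ideal.span (Set.range g))))) :
    K ⊓ Ideal.span (Set.range g) • (⊤ : Submodule R F) ≤ Ideal.span (Set.range g) • K := by
  rintro x ⟨hxK, hx⟩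
  obtain ⟨τ, hτ⟩ := exists_hom_tor_one_quotient g K hxK hx
  have h1 := hτ _ (𝟙 _) K.mkQ K.mkQ_surjective rfl (by rw [h.eq_of_tgt τ 0, zero_comp])
  rwa [Submodule.ker_mkQ] at h1

end Tor

/-! ### Counting lattice points in a simplex -/

section Counting

/-- The tuples `α` of natural numbers with `∑ α < n`. -/
def simplexExp (d n : ℕ) : Finset (Fin d → ℕ) :=
  (Finset.range n).biUnion fun s => Finset.piAntidiag Finset.univ s

variable {d : ℕ}

theorem mem_simplexExp {n : ℕ} {α : Fin d → ℕ} : α ∈ simplexExp d n ↔ ∑ i, α i < n := by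
  simp [simplexExp, Finset.mem_piAntidiag]

theorem sum_simplexExp {M : Type*} [AddCommMonoid M] (n : ℕ) (f : (Fin d → ℕ) → M) :
    ∑ α ∈ simplexExp d n, f α =
      ∑ s ∈ Finset.range n, ∑ α ∈ Finset.piAntidiag Finset.univ s, f α :=
  Finset.sum_biUnion fun _ _ _ _ hst => Finset.disjoint_left.2 fun _ hα hα' =>
    hst ((Finset.mem_piAntidiag.1 hα).1.symm.trans (Finset.mem_piAntidiag.1 hα').1)

theorem apply_lt_of_mem_simplexExp {n : ℕ} {α : Fin d → ℕ} (h : α ∈ simplexExp d n) (i : Fin d) :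
    α i < n :=
  (Finset.single_le_sum (fun _ _ => Nat.zero_le _) (Finset.mem_univ i)).trans_lt (mem_simplexExp.1 h)

theorem card_filter_simplexExp_le (l : Fin d) (c n : ℕ) :
    ((simplexExp d n).filter fun α => α l < c).card ≤ c * n ^ (d - 1) := by
  have h : ((simplexExp d n).filter fun α => α l < c) ⊆
      Fintype.piFinset (Function.update (fun _ => Finset.range n) l (Finset.range c)) := by
    intro α hα
    rw [Finset.mem_filter] at hα
    rw [Fintype.mem_piFinset]
    intro i
    by_cases hi : i = l
    · subst hi; simpa using hα.2
    · simpa [hi] using apply_lt_of_mem_simplexExp hα.1 i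
  refine (Finset.card_le_card h).trans (le_of_eq ?_)
  rw [Fintype.card_piFinset, ← Finset.mul_prod_erase _ _ (Finset.mem_univ l)]
  rw [Function.update_self, Finset.card_range,
    Finset.prod_congr rfl (g := fun _ => n) fun i hi => by
      rw [Function.update_of_ne (Finset.ne_of_mem_erase hi), Finset.card_range]]
  simp [Finset.card_erase_of_mem]

/-- Subtracting c from the l-th entry embeds the points with that entry at least c into the smaller
simplex; the others lie in a slab. -/
theorem card_simplexExp_add_le (l : Fin d) (n c : ℕ) :
    (simplexExp d (n + c)).card ≤ (simplexExp d n).card + c * (n + c) ^ (d - 1) := by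
  classical
  rw [← Finset.card_filter_add_card_filter_not (fun α : Fin d → ℕ => α l < c), add_comm]
  refine add_le_add ?_ (card_filter_simplexExp_le l c (n + c))
  refine Finset.card_le_card_of_injOn (fun α => α - Pi.single l c) ?_ ?_
  · intro α hα
    simp only [Finset.coe_filter, not_lt, Set.mem_ofPred_eq, mem_simplexExp] at hα
    rw [Finset.mem_coe, mem_simplexExp]
    change ∑ i, (α - Pi.single l c : Fin d → ℕ) i < n
    have hle : Pi.single l c ≤ α := by
      intro i
      by_cases hi : i = l
      · subst hi; simpa using hα.2
      · simp [hi]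
    have h1 : ∑ i, (α - Pi.single l c : Fin d → ℕ) i + ∑ i, (Pi.single l c : Fin d → ℕ) i = ∑ i, α i := by
      rw [← Finset.sum_add_distrib]
      exact Finset.sum_congr rfl fun i _ => Nat.sub_add_cancel (hle i)
    rw [Finset.sum_pi_single', if_pos (Finset.mem_univ _)] at h1
    omega
  · intro α hα β hβ h
    simp only [Finset.coe_filter, not_lt, Set.mem_ofPred_eq] at hα hβ
    funext i
    have h1 := congrFun h i
    by_cases hi : i = l
    · subst hi
      simp only [Pi.sub_apply, Pi.single_eq_same] at h1
      omega
    · simpa [hi] using h1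

/-- Division with remainder by d in every entry: the remainders lie in a box of size d^d and the
quotients in the smaller simplex. -/
theorem card_simplexExp_mul_le (m : ℕ) :
    (simplexExp d (d * m)).card ≤ d ^ d * (simplexExp d m).card := by
  have h : d ^ d * (simplexExp d m).card =
      ((Fintype.piFinset fun _ : Fin d => Finset.range d) ×ˢ simplexExp d m).card := by
    simp [Finset.card_product]
  rw [h]
  refine Finset.card_le_card_of_injOn (fun α => (fun i => α i % d, fun i => α i / d)) ?_ ?_
  · intro α hα
    rw [Finset.mem_coe, mem_simplexExp] at hα
    simp only [Finset.coe_product, Set.mem_prod, Finset.mem_coe, Fintype.mem_piFinset,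
      Finset.mem_range, mem_simplexExp]
    refine ⟨fun i => Nat.mod_lt _ i.pos, ?_⟩
    refine lt_of_mul_lt_mul_left (lt_of_le_of_lt ?_ hα) (Nat.zero_le d)
    rw [Finset.mul_sum]
    exact Finset.sum_le_sum fun i _ => Nat.mul_div_le _ _
  · intro α _ β _ h
    simp only [Prod.mk.injEq] at h
    funext i
    rw [← Nat.mod_add_div (α i) d, ← Nat.mod_add_div (β i) d, congrFun h.1 i, congrFun h.2 i]

theorem pow_le_card_simplexExp (hd : 0 < d) (m : ℕ) : m ^ d ≤ (simplexExp d (d * m)).card := by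
  have h : (Fintype.piFinset fun _ : Fin d => Finset.range m) ⊆ simplexExp d (d * m) := by
    intro α hα
    simp only [Fintype.mem_piFinset, Finset.mem_range] at hα
    rw [mem_simplexExp]
    calc ∑ i, α i < ∑ _i : Fin d, m :=
          Finset.sum_lt_sum_of_nonempty ⟨⟨0, hd⟩, Finset.mem_univ _⟩ fun i _ => hα i
      _ = d * m := by simp
  simpa using Finset.card_le_card h

/-- With n^d/d! points to leading order, the left side grows like (d-1)^d d^d n^d/d! and the right
side like twice that. This is the numerical contradiction sought; the degree 2d² and the slab term
affect only lower order. -/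
theorem exists_lt_mul_card_simplexExp (hd : 2 ≤ d) : ∃ n : ℕ,
    (d - 1) ^ d * ((simplexExp d (d * n + 2 * d ^ 2)).card +
      d * (d * (d * n + 2 * d ^ 2) ^ (d - 1))) <
        2 * ((d - 1) ^ d * d ^ d) * (simplexExp d n).card := by
  have hd0 : 0 < d := by omega
  by_contra! h
  -- If the inequality failed at n = dm, the point count would be at most 3d(n+2d)^(d-1), and m^d
  -- points would force m ≤ 3 d^d 2^(d-1), half of the chosen m.
  set m := 3 * d ^ d * 2 ^ d with hm
  have hm2 : 2 ≤ m := by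
    have h1 : 1 ≤ d ^ d := Nat.one_le_pow _ _ hd0
    have h2 : 1 ≤ 2 ^ d := Nat.one_le_two_pow
    nlinarith
  have h1 := h (d * m)
  set n := d * m with hn
  have ht : d * n + 2 * d ^ 2 = d * (n + 2 * d) := by ring
  rw [ht] at h1
  have h2 := card_simplexExp_mul_le (d := d) (n + 2 * d)
  have h3 := card_simplexExp_add_le (⟨0, hd0⟩ : Fin d) n (2 * d)
  have h4 := pow_le_card_simplexExp hd0 m
  rw [← hn] at h4
  have h5 : 2 * d ^ d * (simplexExp d n).card ≤
      (simplexExp d (d * (n + 2 * d))).card + d * (d * (d * (n + 2 * d)) ^ (d - 1)) := by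
    refine le_of_mul_le_mul_left ?_ (show 0 < (d - 1) ^ d from pow_pos (by omega) d)
    calc _ = _ := by ring
      _ ≤ _ := h1
  have h6 : d * (d * (d * (n + 2 * d)) ^ (d - 1)) = d ^ d * (d * (n + 2 * d) ^ (d - 1)) := by
    have : d ^ d = d * d ^ (d - 1) := by rw [← pow_succ', Nat.sub_add_cancel hd0]
    rw [mul_pow, this]
    ring
  have h7 : (simplexExp d n).card ≤ 3 * d * (n + 2 * d) ^ (d - 1) := by
    refine le_of_mul_le_mul_left ?_ (show 0 < d ^ d from pow_pos hd0 d)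
    have h8 := Nat.mul_le_mul_left (d ^ d) h3
    rw [h6] at h5
    nlinarith
  have h8 : (n + 2 * d) ^ (d - 1) ≤ d ^ (d - 1) * (2 ^ (d - 1) * m ^ (d - 1)) := by
    rw [← mul_pow, ← mul_pow]
    refine Nat.pow_le_pow_left ?_ _
    rw [hn]
    nlinarith
  have h9 : m ^ d ≤ 3 * d ^ d * 2 ^ (d - 1) * m ^ (d - 1) := by
    refine (h4.trans h7).trans ((Nat.mul_le_mul_left _ h8).trans (le_of_eq ?_))
    have : d ^ d = d * d ^ (d - 1) := by rw [← pow_succ', Nat.sub_add_cancel hd0]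
    rw [this]
    ring
  have h10 : m ^ d = m * m ^ (d - 1) := by rw [← pow_succ', Nat.sub_add_cancel hd0]
  rw [h10] at h9
  have h11 := le_of_mul_le_mul_right h9 (pow_pos (by omega) _)
  rw [hm] at h11
  have h12 := le_of_mul_le_mul_left h11 (by positivity)
  have h13 : 2 ^ (d - 1) < 2 ^ d := Nat.pow_lt_pow_right (by norm_num) (by omega)
  omega

/-- The exponents whose `x`-part lies in `A` and whose `y`-part lies in `B`. -/
def sumExp (A B : Finset (Fin d → ℕ)) : Finset ((Fin d ⊕ Fin d) →₀ ℕ) :=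
  (A ×ˢ B).map ((Equiv.sumArrowEquivProdArrow (Fin d) (Fin d) ℕ).symm.trans
    Finsupp.equivFunOnFinite.symm).toEmbedding

theorem mem_sumExp {A B : Finset (Fin d → ℕ)} {e : (Fin d ⊕ Fin d) →₀ ℕ} :
    e ∈ sumExp A B ↔ (fun i => e (Sum.inl i)) ∈ A ∧ (fun i => e (Sum.inr i)) ∈ B := by
  rw [sumExp, Finset.mem_map_equiv, Finset.mem_product]
  rfl

theorem card_sumExp (A B : Finset (Fin d → ℕ)) : (sumExp A B).card = A.card * B.card := by
  rw [sumExp, Finset.card_map, Finset.card_product]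

/-- The tuples `α` with `∑ α < n` that have an entry less than `c`. -/
def lowExp (d c n : ℕ) : Finset (Fin d → ℕ) :=
  (simplexExp d n).filter fun α => ∃ l, α l < c

theorem card_lowExp_le (c n : ℕ) : (lowExp d c n).card ≤ d * (c * n ^ (d - 1)) := by
  have h : lowExp d c n ⊆
      Finset.univ.biUnion fun l => (simplexExp d n).filter fun α => α l < c := by
    intro α hα
    rw [lowExp, Finset.mem_filter] at hα
    obtain ⟨hα, l, hl⟩ := hα
    simp only [Finset.mem_biUnion, Finset.mem_univ, true_and, Finset.mem_filter]
    exact ⟨l, hα, hl⟩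
  refine (Finset.card_le_card h).trans (Finset.card_biUnion_le.trans ?_)
  refine (Finset.sum_le_sum fun l _ => card_filter_simplexExp_le l c n).trans (le_of_eq ?_)
  simp

end Counting

/-! ### Monomials and the filtration of R² by powers of 𝔪 -/

section Monomials

variable {σ k : Type*} [Field k]

theorem monomial_eq_mul_X_pow {e : σ →₀ ℕ} {v : σ} {n : ℕ} (h : n ≤ e v) :
    MvPowerSeries.monomial e (1 : k) =
      MvPowerSeries.monomial (e - Finsupp.single v n) 1 * MvPowerSeries.X v ^ n := by
  rw [MvPowerSeries.X_pow_eq, MvPowerSeries.monomial_mul_monomial, one_mul,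
    tsub_add_cancel_of_le (Finsupp.single_le_iff.2 h)]

theorem degree_sub_single {e : σ →₀ ℕ} {v : σ} {n : ℕ} (h : n ≤ e v) :
    (e - Finsupp.single v n).degree + n = e.degree := by
  conv_rhs => rw [← tsub_add_cancel_of_le (Finsupp.single_le_iff.2 h), map_add,
    Finsupp.degree_single]

theorem monomial_mem_maximalIdeal_pow_of_le {e : σ →₀ ℕ} {s : ℕ} (h : s ≤ e.degree) :
    MvPowerSeries.monomial e (1 : k) ∈ IsLocalRing.maximalIdeal (MvPowerSeries σ k) ^ s :=
  Ideal.pow_le_pow_right h (monomial_mem_maximalIdeal_pow e 1)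

/-- The residue field is k, so 𝔪^sF/𝔪^(s+1)F is spanned over k by monomials. This lets a mere
k-subspace U be tested one degree at a time. -/
theorem smul_top_le_of_monomial [Finite σ]
    (U : Submodule k (MvPowerSeries σ k × MvPowerSeries σ k)) (s : ℕ)
    (hU : ∀ z, z ∈ IsLocalRing.maximalIdeal (MvPowerSeries σ k) ^ (s + 1) •
      (⊤ : Submodule (MvPowerSeries σ k) (MvPowerSeries σ k × MvPowerSeries σ k)) → z ∈ U)
    (h1 : ∀ e : σ →₀ ℕ, e.degree = s → (MvPowerSeries.monomial e 1, 0) ∈ U)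
    (h2 : ∀ e : σ →₀ ℕ, e.degree = s → (0, MvPowerSeries.monomial e 1) ∈ U) :
    ∀ z, z ∈ IsLocalRing.maximalIdeal (MvPowerSeries σ k) ^ s •
      (⊤ : Submodule (MvPowerSeries σ k) (MvPowerSeries σ k × MvPowerSeries σ k)) → z ∈ U := by
  have hp : ∀ f : MvPowerSeries σ k →ₗ[MvPowerSeries σ k] MvPowerSeries σ k × MvPowerSeries σ k,
      (∀ e : σ →₀ ℕ, e.degree = s → f (MvPowerSeries.monomial e 1) ∈ U) →
      ∀ p ∈ IsLocalRing.maximalIdeal (MvPowerSeries σ k) ^ s, f p ∈ U := by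
    intro f hf p hp
    rw [maximalIdeal_pow_eq_span, Finsupp.mem_ideal_span_range_iff_exists_finsupp] at hp
    obtain ⟨c, rfl⟩ := hp
    rw [Finsupp.sum, map_sum]
    refine U.sum_mem fun e _ => ?_
    obtain ⟨b, hb⟩ := sub_constantCoeff_mem (c e)
    have h : c e * MvPowerSeries.monomial e.1 1 =
        b • MvPowerSeries.monomial e.1 (1 : k) +
          (c e - algebraMap k _ b) * MvPowerSeries.monomial e.1 1 := by
      rw [Algebra.smul_def]; ring
    rw [h, map_add, LinearMap.map_smul_of_tower]
    refine U.add_mem (U.smul_mem _ (hf _ e.2)) (hU _ ?_)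
    rw [← mul_one (_ * _), ← smul_eq_mul, map_smul]
    refine Submodule.smul_mem_smul ?_ trivial
    rw [pow_succ']
    exact Ideal.mul_mem_mul hb (monomial_mem_maximalIdeal_pow_of_le e.2.ge)
  intro z hz
  rw [mem_smul_top_prod] at hz
  have hz' : z = LinearMap.inl (MvPowerSeries σ k) _ _ z.1 +
      LinearMap.inr (MvPowerSeries σ k) _ _ z.2 := by simp
  rw [hz']
  exact U.add_mem (hp _ h1 _ hz.1) (hp _ h2 _ hz.2)

end Monomials

/-! ### 𝔪^(dn+2d²)R² lies in K + 𝔞^n R² -/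

section UpperBound

variable {k : Type u} [Field k] {d : ℕ}

/-- Modulo `X_{u i} ^ d + X_{v i} ^ d`, every monomial is up to sign a monomial whose exponents at
all `v i` are less than `d`. -/
theorem monomial_smul_mem_of_lt {σ F : Type*} [AddCommGroup F] [Module (MvPowerSeries σ k) F]
    [Finite σ] {u v : Fin d → σ} (huv : ∀ i j, u i ≠ v j)
    (Q : Submodule (MvPowerSeries σ k) F) (z : F) (s : ℕ)
    (hQ : ∀ i, ∀ e : σ →₀ ℕ, e.degree + d = s → (MvPowerSeries.monomial e (1 : k) *
      (MvPowerSeries.X (u i) ^ d + MvPowerSeries.X (v i) ^ d)) • z ∈ Q)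
    (h : ∀ e : σ →₀ ℕ, e.degree = s → (∀ i, e (v i) < d) →
      MvPowerSeries.monomial e (1 : k) • z ∈ Q) (e : σ →₀ ℕ) (he : e.degree = s) :
    MvPowerSeries.monomial e (1 : k) • z ∈ Q := by
  -- Replacing X_(v i)^d by -X_(u i)^d keeps the degree and lowers the total exponent in the
  -- v-variables by d.
  induction hN : ∑ i, e (v i) using Nat.strong_induction_on generalizing e with
  | _ N ih =>
    by_cases hlt : ∀ i, e (v i) < d
    · exact h e he hlt
    push Not at hlt
    obtain ⟨i, hi⟩ := hlt
    set e' := e - Finsupp.single (v i) d with he'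
    have hdeg : e'.degree + d = s := (degree_sub_single hi).trans he
    have h1 : MvPowerSeries.monomial e (1 : k) = MvPowerSeries.monomial e' 1 *
        (MvPowerSeries.X (u i) ^ d + MvPowerSeries.X (v i) ^ d) -
          MvPowerSeries.monomial (e' + Finsupp.single (u i) d) 1 := by
      rw [monomial_eq_mul_X_pow hi, mul_add, MvPowerSeries.X_pow_eq (u i),
        MvPowerSeries.monomial_mul_monomial, one_mul, add_sub_cancel_left]
    rw [h1, sub_smul]
    refine Q.sub_mem (hQ i _ hdeg) (ih _ ?_ _ ?_ rfl)
    · rw [← hN]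
      refine Finset.sum_lt_sum (fun j _ => ?_) ⟨i, Finset.mem_univ i, ?_⟩
      · simp [he', Finsupp.single_eq_of_ne' (huv i j)]
      · have := i.pos
        simp only [he', Finsupp.add_apply, Finsupp.tsub_apply, Finsupp.single_eq_same,
          Finsupp.single_eq_of_ne' (huv i i)]
        omega
    · rw [map_add, Finsupp.degree_single, hdeg]

theorem degree_expF_add_one (i : Fin d) : (expF i).degree + 1 = d := by
  rw [Finsupp.degree_eq_sum, Fintype.sum_sum_type]
  simp only [expF_inl, expF_inr, Finset.sum_const_zero, add_zero]
  rw [Finset.sum_ite, Finset.sum_const_zero, zero_add, Finset.sum_const, smul_eq_mul, mul_one,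
    Finset.filter_not, Finset.filter_eq']
  have := i.pos
  simp only [Finset.mem_univ, if_true, ← Finset.compl_eq_univ_sdiff, Finset.card_compl,
    Finset.card_singleton, Fintype.card_fin]
  omega

variable (K : Submodule (ringR k d) (ringR k d × ringR k d))

local notation "𝔪" => IsLocalRing.maximalIdeal (ringR k d)
local notation "F2" => (⊤ : Submodule (ringR k d) (ringR k d × ringR k d))

/-- Relations known only modulo 𝔞F become relations modulo K with an error in I𝔞F after
multiplication by I; so K may replace N up to higher order. -/
theorem smul_mem_sup_of_mem {I J : Ideal (ringR k d)} (hIJ : I * idealA k d ≤ J) {r : ringR k d}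
    (hr : r ∈ I) {z : ringR k d × ringR k d} (hz : z ∈ K ⊔ idealA k d • F2) :
    r • z ∈ K ⊔ J • F2 := by
  obtain ⟨x, hx, y, hy, rfl⟩ := Submodule.mem_sup.1 hz
  rw [smul_add]
  refine Submodule.add_mem_sup (K.smul_mem _ hx) (Submodule.smul_mono_left hIJ ?_)
  rw [Submodule.mul_smul]
  exact Submodule.smul_mem_smul hr hy

theorem monomial_smul_relX (e : (Fin d ⊕ Fin d) →₀ ℕ) (i : Fin d) (h : d - 1 ≤ e (Sum.inl i)) :
    (MvPowerSeries.monomial e (1 : k), (0 : ringR k d)) =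
      MvPowerSeries.monomial (e - Finsupp.single (Sum.inl i) (d - 1)) (1 : k) • relX k d i -
        (0, MvPowerSeries.monomial (e - Finsupp.single (Sum.inl i) (d - 1) + expF i) 1) := by
  rw [monomial_eq_mul_X_pow h, relX, f_eq, Prod.smul_mk, smul_eq_mul, smul_eq_mul,
    MvPowerSeries.monomial_mul_monomial, one_mul, Prod.mk_sub_mk, sub_zero, sub_self]
  rfl

theorem monomial_smul_relY (e : (Fin d ⊕ Fin d) →₀ ℕ) (i : Fin d) (h : d - 1 ≤ e (Sum.inr i)) :
    ((0 : ringR k d), MvPowerSeries.monomial e (1 : k)) =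
      MvPowerSeries.monomial (e - Finsupp.single (Sum.inr i) (d - 1)) (1 : k) • relY k d i := by
  rw [monomial_eq_mul_X_pow h, relY, Prod.smul_mk, smul_zero]
  rfl

variable {K}

theorem relX_mem_sup (hK : K ⊔ idealA k d • F2 = relModule k d ⊔ idealA k d • F2)
    (i : Fin d) : relX k d i ∈ K ⊔ idealA k d • F2 :=
  hK ▸ Submodule.mem_sup_left (relX_mem i)

theorem relY_mem_sup (hK : K ⊔ idealA k d • F2 = relModule k d ⊔ idealA k d • F2)
    (i : Fin d) : relY k d i ∈ K ⊔ idealA k d • F2 :=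
  hK ▸ Submodule.mem_sup_left (relY_mem i)

/-- Modulo g, make the x-exponents (second coordinate) or the y-exponents (first coordinate) less
than d. In degree at least 2d² some exponent of the other kind is then at least d-1 and a relation
applies. In the first coordinate this leaves a second-coordinate monomial of the same degree,
treated before. -/
theorem maximalIdeal_pow_smul_top_le_sup
    (hK : K ⊔ idealA k d • F2 = relModule k d ⊔ idealA k d • F2)
    (hd0 : 0 < d) {s : ℕ} (hs : 2 * d ^ 2 ≤ s) :
    𝔪 ^ s • F2 ≤ K ⊔ (idealA k d * 𝔪 ^ (s - d)) • F2 := by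
  set Q := K ⊔ (idealA k d * 𝔪 ^ (s - d)) • F2 with hQ
  have hA : ∀ r ∈ 𝔪 ^ (s - d), ∀ z ∈ K ⊔ idealA k d • F2, r • z ∈ Q := fun r hr z hz =>
    smul_mem_sup_of_mem K (mul_comm _ _).le hr hz
  have hg : ∀ (i : Fin d) (z : ringR k d × ringR k d) (e : (Fin d ⊕ Fin d) →₀ ℕ),
      e.degree + d = s → (MvPowerSeries.monomial e (1 : k) * polyG k d i) • z ∈ Q := by
    intro i z e he
    refine Submodule.mem_sup_right (Submodule.smul_mem_smul ?_ trivial)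
    rw [mul_comm (MvPowerSeries.monomial e _)]
    exact Ideal.mul_mem_mul (Ideal.subset_span ⟨i, rfl⟩)
      (monomial_mem_maximalIdeal_pow_of_le (by omega))
  have hexists : ∀ (u v : Fin d → Fin d ⊕ Fin d) (e : (Fin d ⊕ Fin d) →₀ ℕ),
      e.degree = ∑ i, e (u i) + ∑ i, e (v i) → e.degree = s → (∀ i, e (v i) < d) →
      ∃ i, d - 1 ≤ e (u i) := by
    intro u v e h1 h2 h3
    by_contra! hc
    have h4 : ∑ i, e (u i) ≤ ∑ _i : Fin d, d := Finset.sum_le_sum fun i _ => by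
      have := hc i; omega
    have h5 : ∑ i, e (v i) < ∑ _i : Fin d, d :=
      Finset.sum_lt_sum_of_nonempty ⟨⟨0, hd0⟩, Finset.mem_univ _⟩ fun i _ => h3 i
    simp only [Finset.sum_const, Finset.card_univ, Fintype.card_fin, smul_eq_mul] at h4 h5
    rw [pow_two] at hs
    omega
  have hsum : ∀ e : (Fin d ⊕ Fin d) →₀ ℕ,
      e.degree = ∑ i, e (Sum.inl i) + ∑ i, e (Sum.inr i) := fun e => by
    rw [Finsupp.degree_eq_sum, Fintype.sum_sum_type]
  have h2 : ∀ e : (Fin d ⊕ Fin d) →₀ ℕ, e.degree = s →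
      ((0 : ringR k d), MvPowerSeries.monomial e (1 : k)) ∈ Q := by
    intro e he
    have h := monomial_smul_mem_of_lt (k := k) (u := Sum.inr) (v := Sum.inl)
      (fun _ _ => Sum.inr_ne_inl) Q ((0 : ringR k d), 1) s (fun i e he => by
        rw [add_comm (_ ^ d)]
        exact hg i _ e he) (fun e he hlt => ?_) e he
    · simpa using h
    obtain ⟨i, hi⟩ := hexists Sum.inr Sum.inl e ((hsum e).trans (add_comm _ _)) he hlt
    have h := monomial_smul_relY (k := k) e i hi
    simp only [Prod.smul_mk, smul_eq_mul, mul_one, mul_zero]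
    rw [h]
    refine hA _ (monomial_mem_maximalIdeal_pow_of_le ?_) _ (relY_mem_sup hK i)
    have := degree_sub_single hi
    omega
  have h1 : ∀ e : (Fin d ⊕ Fin d) →₀ ℕ, e.degree = s →
      (MvPowerSeries.monomial e (1 : k), (0 : ringR k d)) ∈ Q := by
    intro e he
    have h := monomial_smul_mem_of_lt (k := k) (u := Sum.inl) (v := Sum.inr)
      (fun _ _ => Sum.inl_ne_inr) Q ((1 : ringR k d), 0) s (fun i e he => hg i _ e he)
        (fun e he hlt => ?_) e he
    · simpa using h
    obtain ⟨i, hi⟩ := hexists Sum.inl Sum.inr e (hsum e) he hlt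
    have h := monomial_smul_relX (k := k) e i hi
    have hdeg := degree_sub_single hi
    have hF := degree_expF_add_one i
    simp only [Prod.smul_mk, smul_eq_mul, mul_one, mul_zero]
    rw [h]
    refine Q.sub_mem (hA _ (monomial_mem_maximalIdeal_pow_of_le (by omega)) _ (relX_mem_sup hK i))
      (h2 _ ?_)
    rw [map_add]
    omega
  rw [Submodule.smul_le]
  intro r hr z _
  rw [maximalIdeal_pow_eq_span] at hr
  induction hr using Submodule.span_induction with
  | mem x hx =>
    obtain ⟨⟨e, he⟩, rfl⟩ := hx
    have h : MvPowerSeries.monomial e (1 : k) • z =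
        z.1 • (MvPowerSeries.monomial e (1 : k), (0 : ringR k d)) +
          z.2 • ((0 : ringR k d), MvPowerSeries.monomial e (1 : k)) := by
      ext1 <;> simp [mul_comm]
    rw [h]
    exact Q.add_mem (Q.smul_mem _ (h1 e he)) (Q.smul_mem _ (h2 e he))
  | zero => simp
  | add x y _ _ hx hy => rw [add_smul]; exact Q.add_mem hx hy
  | smul a x _ hx => rw [smul_assoc]; exact Q.smul_mem _ hx

/-- Each further factor 𝔞 is bought with d degrees, since the previous step trades 𝔪^s for 𝔞𝔪^(s-d)
as long as s ≥ 2d². -/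
theorem maximalIdeal_pow_smul_top_le_sup_pow
    (hK : K ⊔ idealA k d • F2 = relModule k d ⊔ idealA k d • F2)
    (hd0 : 0 < d) (n : ℕ) :
    𝔪 ^ (d * n + 2 * d ^ 2) • F2 ≤ K ⊔ idealA k d ^ n • F2 := by
  induction n with
  | zero =>
    rw [pow_zero, Ideal.one_eq_top, Submodule.top_smul, sup_top_eq]
    exact le_top
  | succ n ih =>
    refine (maximalIdeal_pow_smul_top_le_sup hK hd0 (Nat.le_add_left _ _)).trans
      (sup_le le_sup_left ?_)
    have h : d * (n + 1) + 2 * d ^ 2 - d = d * n + 2 * d ^ 2 := by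
      rw [Nat.sub_eq_iff_eq_add (by nlinarith)]; ring
    rw [h, Submodule.mul_smul]
    refine (Submodule.smul_mono le_rfl ih).trans ?_
    rw [Submodule.smul_sup, ← Submodule.mul_smul, ← pow_succ']
    exact sup_le_sup_right Submodule.smul_le_right _

end UpperBound

/-! ### The two bounds for dim R²/(K + 𝔞^n R²) and their contradiction -/

section Comparison

variable {k : Type u} [Field k] {d : ℕ} {K : Submodule (ringR k d) (ringR k d × ringR k d)}

local notation "𝔪" => IsLocalRing.maximalIdeal (ringR k d)
local notation "F2" => (⊤ : Submodule (ringR k d) (ringR k d × ringR k d))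

open Classical in
/-- Monomials that generate `R ^ 2` as a vector space modulo `K + 𝔪 ^ t R ^ 2`. -/
def spanningSet (k : Type u) [Field k] (d t : ℕ) : Finset (ringR k d × ringR k d) :=
  (sumExp (Fintype.piFinset fun _ => Finset.range (d - 1)) (simplexExp d t)).image
      (fun e => (MvPowerSeries.monomial e 1, 0)) ∪
    (sumExp (lowExp d d t) (Fintype.piFinset fun _ => Finset.range (d - 1))).image
      fun e => (0, MvPowerSeries.monomial e 1)

theorem card_spanningSet_le (t : ℕ) : (spanningSet k d t).card ≤
    (d - 1) ^ d * ((simplexExp d t).card + d * (d * t ^ (d - 1))) := by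
  classical
  refine (Finset.card_union_le _ _).trans ?_
  rw [mul_add]
  refine add_le_add (Finset.card_image_le.trans ?_) (Finset.card_image_le.trans ?_)
  · rw [card_sumExp]; simp
  · rw [card_sumExp, mul_comm]
    refine Nat.mul_le_mul ?_ (card_lowExp_le d t)
    simp

theorem mem_spanningSet_inl {t : ℕ} {e : (Fin d ⊕ Fin d) →₀ ℕ} (he : e.degree < t)
    (h : ∀ i, e (Sum.inl i) < d - 1) :
    (MvPowerSeries.monomial e (1 : k), (0 : ringR k d)) ∈ spanningSet k d t := by
  classical
  refine Finset.mem_union_left _ (Finset.mem_image_of_mem _ (mem_sumExp.2 ⟨?_, ?_⟩))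
  · simpa using h
  · rw [mem_simplexExp]
    rw [Finsupp.degree_eq_sum, Fintype.sum_sum_type] at he
    omega

theorem mem_spanningSet_inr {t : ℕ} {e : (Fin d ⊕ Fin d) →₀ ℕ} (he : e.degree < t)
    (h : ∀ i, e (Sum.inr i) < d - 1) {l : Fin d} (hl : e (Sum.inl l) < d) :
    ((0 : ringR k d), MvPowerSeries.monomial e (1 : k)) ∈ spanningSet k d t := by
  classical
  refine Finset.mem_union_right _ (Finset.mem_image_of_mem _ (mem_sumExp.2 ⟨?_, ?_⟩))
  · rw [lowExp, Finset.mem_filter, mem_simplexExp]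
    rw [Finsupp.degree_eq_sum, Fintype.sum_sum_type] at he
    exact ⟨by omega, l, hl⟩
  · simpa using h

/-- Descending induction on the degree s. Every relation of degree d-1 holds in K up to 𝔞F ⊆ 𝔪^dF,
so reducing a monomial of degree s by it makes an error only in 𝔪^(s+1)F, covered by induction. -/
theorem mem_sup_span_spanningSet (hd : 2 ≤ d)
    (hK : K ⊔ idealA k d • F2 = relModule k d ⊔ idealA k d • F2) (t : ℕ)
    (z : ringR k d × ringR k d) :
    z ∈ K.restrictScalars k ⊔ Submodule.span k (spanningSet k d t : Set (ringR k d × ringR k d)) ⊔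
      (𝔪 ^ t • F2).restrictScalars k := by
  set U := K.restrictScalars k ⊔
    Submodule.span k (spanningSet k d t : Set (ringR k d × ringR k d)) ⊔
      (𝔪 ^ t • F2).restrictScalars k with hU
  have hKU : ∀ x ∈ K, x ∈ U := fun x hx => Submodule.mem_sup_left (Submodule.mem_sup_left hx)
  have hBU : ∀ x ∈ spanningSet k d t, x ∈ U := fun x hx =>
    Submodule.mem_sup_left (Submodule.mem_sup_right (Submodule.subset_span hx))
  suffices h : ∀ j s, s + j = t → ∀ z ∈ 𝔪 ^ s • F2, z ∈ U by
    refine h t 0 (zero_add t) z ?_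
    rw [pow_zero, Ideal.one_eq_top, Submodule.top_smul]
    trivial
  intro j
  induction j with
  | zero =>
    rintro s rfl z hz
    exact Submodule.mem_sup_right hz
  | succ j ih =>
    intro s hs
    have ih' := ih (s + 1) (by omega)
    have hst : s < t := by omega
    have hA : ∀ r ∈ 𝔪 ^ (s - (d - 1)), d - 1 ≤ s → ∀ z ∈ K ⊔ idealA k d • F2, r • z ∈ U := by
      intro r hr hds z hz
      have hle : 𝔪 ^ (s - (d - 1)) * idealA k d ≤ 𝔪 ^ (s + 1) := by
        refine (Ideal.mul_mono_right (idealA_le_maximalIdeal_pow k d)).trans ?_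
        rw [← pow_add]
        exact Ideal.pow_le_pow_right (by omega)
      obtain ⟨x, hx, y, hy, hxy⟩ := Submodule.mem_sup.1 (smul_mem_sup_of_mem K hle hr hz)
      rw [← hxy]
      exact U.add_mem (hKU x hx) (ih' y hy)
    let i₀ : Fin d := ⟨0, by omega⟩
    let i₁ : Fin d := ⟨1, by omega⟩
    have hi : i₀ ≠ i₁ := by simp [i₀, i₁]
    have h2 : ∀ e : (Fin d ⊕ Fin d) →₀ ℕ, e.degree = s →
        ((0 : ringR k d), MvPowerSeries.monomial e (1 : k)) ∈ U := by
      intro e he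
      induction hN : e (Sum.inl i₀) using Nat.strong_induction_on generalizing e with
      | _ N ihN =>
        by_cases hy : ∀ i, e (Sum.inr i) < d - 1
        swap
        · push Not at hy
          obtain ⟨i, hi⟩ := hy
          have hdeg := degree_sub_single hi
          rw [monomial_smul_relY e i hi]
          exact hA _ (monomial_mem_maximalIdeal_pow_of_le (by omega)) (by omega) _
            (relY_mem_sup hK i)
        by_cases hl : ∃ l, e (Sum.inl l) < d
        · obtain ⟨l, hl⟩ := hl
          exact hBU _ (mem_spanningSet_inr (by omega) hy hl)
        push Not at hl
        -- All x-exponents are now at least d, so x_(i₀)^(d-1) f_(i₁) divides the monomial. Since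
        -- f_(i₁) contains x_(i₀) and f_(i₀) does not, exchanging it for x_(i₁)^(d-1) f_(i₀) lowers
        -- the exponent of x_(i₀) by d.
        have hle : ∀ i j : Fin d, i ≠ j →
            Finsupp.single (Sum.inl i) (d - 1) + expF j ≤ e := by
          intro i j hij v
          rcases v with v | v
          · have := hl v
            rw [Finsupp.add_apply, expF_inl, Finsupp.single_apply]
            split_ifs <;> omega
          · rw [Finsupp.add_apply, expF_inr, Finsupp.single_eq_of_ne' Sum.inl_ne_inr]
            omega
        have hle' := hle i₀ i₁ hi
        set e' := e - (Finsupp.single (Sum.inl i₀) (d - 1) + expF i₁) with he'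
        set e'' := e' + (Finsupp.single (Sum.inl i₁) (d - 1) + expF i₀) with he''
        have hee : e = e' + (Finsupp.single (Sum.inl i₀) (d - 1) + expF i₁) :=
          (tsub_add_cancel_of_le hle').symm
        have hF0 := degree_expF_add_one i₀
        have hF1 := degree_expF_add_one i₁
        have hdeg : e.degree = e'.degree + ((d - 1) + (expF i₁).degree) := by
          conv_lhs => rw [hee, map_add, map_add, Finsupp.degree_single]
        have hdeg'' : e''.degree = e'.degree + ((d - 1) + (expF i₀).degree) := by
          rw [he'', map_add, map_add, Finsupp.degree_single]
        have key : ((0 : ringR k d), MvPowerSeries.monomial e (1 : k)) =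
            MvPowerSeries.monomial (e' + Finsupp.single (Sum.inl i₀) (d - 1)) (1 : k) •
                relX k d i₁ -
              MvPowerSeries.monomial (e' + Finsupp.single (Sum.inl i₁) (d - 1)) (1 : k) •
                relX k d i₀ + (0, MvPowerSeries.monomial e'' 1) := by
          have h1 : MvPowerSeries.monomial (e' + Finsupp.single (Sum.inl i₀) (d - 1)) (1 : k) *
              MvPowerSeries.monomial (expF i₁) 1 = MvPowerSeries.monomial e 1 := by
            rw [MvPowerSeries.monomial_mul_monomial, one_mul, add_assoc, ← hee]
          have h2 : MvPowerSeries.monomial (e' + Finsupp.single (Sum.inl i₁) (d - 1)) (1 : k) *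
              MvPowerSeries.monomial (expF i₀) 1 = MvPowerSeries.monomial e'' 1 := by
            rw [MvPowerSeries.monomial_mul_monomial, one_mul, add_assoc, ← he'']
          rw [relX, relX, f_eq, f_eq, Prod.smul_mk, Prod.smul_mk, smul_eq_mul, smul_eq_mul,
            smul_eq_mul, smul_eq_mul, h1, h2, varX, varX, MvPowerSeries.X_pow_eq,
            MvPowerSeries.X_pow_eq, MvPowerSeries.monomial_mul_monomial,
            MvPowerSeries.monomial_mul_monomial, add_right_comm]
          simp
        rw [key]
        refine U.add_mem (U.sub_mem
          (hA _ (monomial_mem_maximalIdeal_pow_of_le ?_) (by omega) _ (relX_mem_sup hK _))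
          (hA _ (monomial_mem_maximalIdeal_pow_of_le ?_) (by omega) _ (relX_mem_sup hK _)))
          (ihN _ ?_ e'' (by omega) rfl)
        · rw [map_add, Finsupp.degree_single]; omega
        · rw [map_add, Finsupp.degree_single]; omega
        · have h1 := hl i₀
          rw [← hN, he'', he', Finsupp.add_apply, Finsupp.tsub_apply, Finsupp.add_apply,
            Finsupp.add_apply, expF_inl, expF_inl, Finsupp.single_eq_same, if_neg hi, if_pos rfl,
            Finsupp.single_eq_of_ne' fun h => hi (Sum.inl_injective h).symm]
          omega
    refine smul_top_le_of_monomial U s ih' (fun e he => ?_) h2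
    by_cases hx : ∀ i, e (Sum.inl i) < d - 1
    · exact hBU _ (mem_spanningSet_inl (by omega) hx)
    push Not at hx
    obtain ⟨i, hi⟩ := hx
    have hdeg := degree_sub_single hi
    have hF := degree_expF_add_one i
    rw [monomial_smul_relX e i hi]
    refine U.sub_mem (hA _ (monomial_mem_maximalIdeal_pow_of_le (by omega)) (by omega) _
      (relX_mem_sup hK i)) (h2 _ ?_)
    rw [map_add]
    omega

/-- Monomials that are linearly independent modulo `relModule + 𝔞 R ^ 2`. -/
def independentFamily (k : Type u) [Field k] (d : ℕ) :
    (boxExp (Sum.elim (fun _ : Fin d => d - 1) fun _ : Fin d => d)) ⊕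
      (boxExp (Sum.elim (fun _ : Fin d => d) fun _ : Fin d => d - 1)) →
        ringR k d × ringR k d :=
  Sum.elim (fun e => (MvPowerSeries.monomial e.1 1, 0)) fun e => (0, MvPowerSeries.monomial e.1 1)

theorem exists_sum_of_mem_relModule_sup {z : ringR k d × ringR k d}
    (hz : z ∈ relModule k d ⊔ idealA k d • F2) : ∃ s t a b : Fin d → ringR k d,
      z.1 = ∑ i, s i * varX k d i ^ (d - 1) + ∑ i, a i * polyG k d i ∧
      z.2 = ∑ i, s i * monF k d i + ∑ i, t i * varY k d i ^ (d - 1) + ∑ i, b i * polyG k d i := by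
  obtain ⟨x, hx, y, hy, rfl⟩ := Submodule.mem_sup.1 hz
  obtain ⟨s, t, h1, h2⟩ := (mem_relModule_iff x).1 hx
  rw [mem_smul_top_prod] at hy
  obtain ⟨a, ha⟩ := Ideal.mem_span_range_iff_exists_fun.1 hy.1
  obtain ⟨b, hb⟩ := Ideal.mem_span_range_iff_exists_fun.1 hy.2
  exact ⟨s, t, a, b, by rw [ha, ← h1]; rfl, by rw [hb, ← h2]; rfl⟩

theorem coeff_sum_mul_polyG (a : Fin d → ringR k d) (m : (Fin d ⊕ Fin d) →₀ ℕ)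
    (hm : ∀ v, m v < d) : MvPowerSeries.coeff m (∑ i, a i * polyG k d i) = 0 := by
  rw [map_sum]
  refine Finset.sum_eq_zero fun i _ => ?_
  rw [polyG, mul_add, map_add, coeff_mul_x_pow, coeff_mul_y_pow, if_neg (hm _).not_ge,
    if_neg (hm _).not_ge, add_zero]

theorem coeff_sum_monomial {σ : Type*} (T : Finset (σ →₀ ℕ)) (c : T → k) (m : T) :
    MvPowerSeries.coeff m.1 (∑ e : T, c e • MvPowerSeries.monomial e.1 (1 : k)) = c m := by
  classical
  rw [map_sum, Finset.sum_eq_single m]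
  · simp
  · intro e _ he
    rw [map_smul, MvPowerSeries.coeff_monomial_ne fun h => he (Subtype.ext h.symm), smul_zero]
  · simp

/-- In the first coordinate no monomial of the box occurs in the ideal of the x_i^(d-1) and g_i, so
those coefficients vanish. Then the s_i form a relation among the x_i^(d-1) modulo 𝔞, and
`coeff_relation` shows that ∑ s_i f_i does not reach the box of the second coordinate either. -/
theorem eq_zero_of_sum_independentFamily_mem
    (c : (boxExp (Sum.elim (fun _ : Fin d => d - 1) fun _ : Fin d => d)) ⊕
      (boxExp (Sum.elim (fun _ : Fin d => d) fun _ : Fin d => d - 1)) → k)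
    (h : ∑ b, c b • independentFamily k d b ∈ relModule k d ⊔ idealA k d • F2) : c = 0 := by
  set p : ringR k d := ∑ e : boxExp (Sum.elim (fun _ : Fin d => d - 1) fun _ : Fin d => d),
    c (Sum.inl e) • MvPowerSeries.monomial e.1 (1 : k) with hp
  set q : ringR k d := ∑ e : boxExp (Sum.elim (fun _ : Fin d => d) fun _ : Fin d => d - 1),
    c (Sum.inr e) • MvPowerSeries.monomial e.1 (1 : k) with hq
  have hpq : ∑ b, c b • independentFamily k d b = (p, q) := by
    rw [Fintype.sum_sum_type]
    refine Prod.ext ?_ ?_ <;> simp [independentFamily, Prod.fst_sum, Prod.snd_sum, hp, hq]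
  rw [hpq] at h
  obtain ⟨s, t, a, b, h1, h2⟩ := exists_sum_of_mem_relModule_sup h
  have hc1 : ∀ e, c (Sum.inl e) = 0 := by
    intro e
    have he := (mem_boxExp _ _).1 e.2
    have hx : ∀ i, e.1 (Sum.inl i) < d - 1 := fun i => he (Sum.inl i)
    have hy : ∀ i, e.1 (Sum.inr i) < d := fun i => he (Sum.inr i)
    rw [← coeff_sum_monomial _ (fun e => c (Sum.inl e)) e, ← hp]
    change MvPowerSeries.coeff e.1 p = 0
    rw [show p = _ from h1, map_add, coeff_sum_mul_polyG _ _ (by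
      rintro (i | i)
      · have := hx i; omega
      · exact hy i), add_zero, map_sum]
    exact Finset.sum_eq_zero fun i _ => by rw [coeff_mul_x_pow, if_neg (hx i).not_ge]
  have hp0 : p = 0 := by
    rw [hp]
    exact Finset.sum_eq_zero fun e _ => by rw [hc1, zero_smul]
  have hs : ∑ i, s i * varX k d i ^ (d - 1) = ∑ i, (-a i) * polyG k d i := by
    have h3 : (0 : ringR k d) = _ := hp0.symm.trans h1
    simp only [neg_mul, Finset.sum_neg_distrib]
    exact eq_neg_of_add_eq_zero_left h3.symm
  funext e
  rcases e with e | e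
  · exact hc1 e
  have he := (mem_boxExp _ _).1 e.2
  have hx : ∀ i, e.1 (Sum.inl i) < d := fun i => he (Sum.inl i)
  have hy : ∀ i, e.1 (Sum.inr i) < d - 1 := fun i => he (Sum.inr i)
  rw [← coeff_sum_monomial _ (fun e => c (Sum.inr e)) e, ← hq]
  change MvPowerSeries.coeff e.1 q = 0
  rw [show q = _ from h2, map_add, map_add, coeff_sum_mul_polyG _ _ (by
    rintro (i | i)
    · exact hx i
    · have := hy i; omega), add_zero, coeff_relation s _ hs e.1 hx hy, zero_add, map_sum]
  exact Finset.sum_eq_zero fun i _ => by rw [coeff_mul_y_pow, if_neg (hy i).not_ge]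

/-- The products g^α times the independent monomials are independent in F/(K + 𝔞^n F), which the
reduced monomials of degree below dn+2d² span. -/
theorem mul_card_simplexExp_le (hd : 2 ≤ d)
    (hK : K ⊔ idealA k d • F2 = relModule k d ⊔ idealA k d • F2)
    (hK' : K ⊓ idealA k d • F2 ≤ idealA k d • K) (n : ℕ) :
    2 * ((d - 1) ^ d * d ^ d) * (simplexExp d n).card ≤
      (spanningSet k d (d * n + 2 * d ^ 2)).card := by
  classical
  set Q := K ⊔ idealA k d ^ n • F2 with hQ
  let v : (simplexExp d n) × ((boxExp (Sum.elim (fun _ : Fin d => d - 1) fun _ : Fin d => d)) ⊕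
      (boxExp (Sum.elim (fun _ : Fin d => d) fun _ : Fin d => d - 1))) →
        (ringR k d × ringR k d) ⧸ Q :=
    fun x => Q.mkQ ((∏ i, polyG k d i ^ x.1.1 i) • independentFamily k d x.2)
  have hv : LinearIndependent k v := by
    rw [Fintype.linearIndependent_iff]
    intro c hc
    let c' : (Fin d → ℕ) → _ → k := fun α b => if hα : α ∈ simplexExp d n then c (⟨α, hα⟩, b) else 0
    have h : ∑ s ∈ Finset.range n, ∑ α ∈ Finset.piAntidiag Finset.univ s,
        (∏ i, polyG k d i ^ α i) • ∑ b, c' α b • independentFamily k d b ∈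
          K ⊔ idealA k d ^ n • F2 := by
      rw [← sum_simplexExp, ← Submodule.Quotient.mk_eq_zero, ← hc, ← Finset.sum_coe_sort,
        Fintype.sum_prod_type, ← Submodule.mkQ_apply, map_sum]
      refine Finset.sum_congr rfl fun α _ => ?_
      rw [Finset.smul_sum, map_sum]
      refine Finset.sum_congr rfl fun b _ => ?_
      simp only [c', dif_pos α.2]
      rw [smul_comm, LinearMap.map_smul_of_tower]
    intro x
    have hx := eq_zero_of_sum_mem_sup_pow_smul (isQuasiRegularOn_polyG k d) K hK'
      (independentFamily k d) (fun c hc => eq_zero_of_sum_independentFamily_mem c (hK ▸ hc)) n c' h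
      _ (mem_simplexExp.1 x.1.2) x.1.1 (by simp [Finset.mem_piAntidiag])
    have h1 := congrFun hx x.2
    simpa only [c', dif_pos x.1.2, Pi.zero_apply] using h1
  have hspan : Submodule.span k (((spanningSet k d (d * n + 2 * d ^ 2)).image Q.mkQ :
      Finset ((ringR k d × ringR k d) ⧸ Q)) : Set ((ringR k d × ringR k d) ⧸ Q)) = ⊤ := by
    rw [eq_top_iff]
    rintro y -
    obtain ⟨z, rfl⟩ := Q.mkQ_surjective y
    obtain ⟨y, hy, w, hw, rfl⟩ :=
      Submodule.mem_sup.1 (mem_sup_span_spanningSet hd hK (d * n + 2 * d ^ 2) z)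
    obtain ⟨x, hx, b, hb, rfl⟩ := Submodule.mem_sup.1 hy
    have hw' : w ∈ Q := maximalIdeal_pow_smul_top_le_sup_pow hK (by omega) n hw
    have hx' : x ∈ Q := Submodule.mem_sup_left hx
    have h0 : ∀ x ∈ Q, Q.mkQ x = 0 := fun x hx => (Submodule.Quotient.mk_eq_zero _).2 hx
    rw [map_add, map_add, h0 _ hw', h0 _ hx', zero_add, add_zero, Finset.coe_image]
    have h1 := Submodule.mem_map_of_mem (f := Q.mkQ.restrictScalars k) hb
    rwa [Submodule.map_span] at h1
  have h := linearIndependent_le_span_finset v hv _ hspan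
  rw [Cardinal.mk_fintype, Nat.cast_le] at h
  refine le_trans (le_of_eq ?_) (h.trans Finset.card_image_le)
  simp only [Fintype.card_prod, Fintype.card_sum, Fintype.card_coe, card_boxExp,
    Fintype.prod_sum_type, Sum.elim_inl, Sum.elim_inr, Finset.prod_const, Finset.card_univ,
    Fintype.card_fin]
  ring

/-- If `R ^ 2 / K` is a lift of `M`, then `K ∩ 𝔞 R ^ 2` is not contained in `𝔞 K`; that is,
`Tor_1(R ^ 2 / K, S)` does not vanish. -/
theorem not_inf_smul_top_le (hd : 2 ≤ d)
    (hK : K ⊔ idealA k d • F2 = relModule k d ⊔ idealA k d • F2) :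
    ¬ K ⊓ idealA k d • F2 ≤ idealA k d • K := by
  intro hK'
  obtain ⟨n, hn⟩ := exists_lt_mul_card_simplexExp hd
  exact (((mul_card_simplexExp_le hd hK hK' n).trans (card_spanningSet_le _)).trans_lt hn).false

end Comparison

/-! ### Every lifting system comes from a single quotient of R² -/

section Reduction

theorem surjective_of_range_sup_smul_top {R F L : Type*} [CommRing R] [IsLocalRing R]
    [AddCommGroup F] [Module R F] [AddCommGroup L] [Module R L] [Module.Finite R L]
    {I : Ideal R} (hI : I ≤ IsLocalRing.maximalIdeal R) (φ : F →ₗ[R] L)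
    (h : LinearMap.range φ ⊔ I • ⊤ = ⊤) : Function.Surjective φ := by
  rw [← LinearMap.range_eq_top, eq_top_iff]
  exact Submodule.le_of_le_smul_of_le_jacobson_bot Module.Finite.fg_top
    (hI.trans (IsLocalRing.maximalIdeal_le_jacobson _)) h.ge

theorem ker_sup_smul_top {R F L M : Type*} [CommRing R] [AddCommGroup F] [Module R F]
    [AddCommGroup L] [Module R L] [AddCommGroup M] [Module R M] (I : Ideal R) (φ : F →ₗ[R] L)
    (hφ : Function.Surjective φ) (π : L →ₗ[R] M) (hπ : LinearMap.ker π = I • ⊤) :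
    LinearMap.ker φ ⊔ I • ⊤ = LinearMap.ker (π ∘ₗ φ) := by
  rw [LinearMap.ker_comp, hπ, ← LinearMap.range_eq_top.2 hφ, ← Submodule.map_top,
    ← Submodule.map_smul'', Submodule.comap_map_eq, sup_comm]

/-- Projectivity lifts p through π, and Nakayama makes the lift surjective because I lies in the
maximal ideal. -/
theorem exists_lift_of_ker_eq {R F L M : Type*} [CommRing R] [IsLocalRing R] [AddCommGroup F]
    [Module R F] [Module.Projective R F] [AddCommGroup L] [Module R L] [Module.Finite R L]
    [AddCommGroup M] [Module R M] {I : Ideal R} (hI : I ≤ IsLocalRing.maximalIdeal R)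
    (π : L →ₗ[R] M) (hπs : Function.Surjective π) (hπ : LinearMap.ker π = I • ⊤)
    (p : F →ₗ[R] M) (hp : Function.Surjective p) :
    ∃ φ : F →ₗ[R] L, Function.Surjective φ ∧ π ∘ₗ φ = p := by
  obtain ⟨φ, hφ⟩ := Module.projective_lifting_property π p hπs
  refine ⟨φ, surjective_of_range_sup_smul_top hI φ ?_, hφ⟩
  rw [← hπ, ← Submodule.comap_map_eq, ← LinearMap.range_comp, hφ, LinearMap.range_eq_top.2 hp,
    Submodule.comap_top]

/-- Lift the presentation of M step by step along the transition maps. The index is shifted because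
ψ 0 must land in M_1, the first term that carries information. -/
theorem LiftingSystem.exists_compatible {R : Type u} [CommRing R] [IsLocalRing R] {a : Ideal R}
    {M F : Type u} [AddCommGroup M] [Module R M] [AddCommGroup F] [Module R F]
    [Module.Projective R F] (ha : a ≤ IsLocalRing.maximalIdeal R) (E : LiftingSystem a M)
    (p : F →ₗ[R] M) (hp : Function.Surjective p) :
    ∃ ψ : ∀ n, F →ₗ[R] E.obj (n + 1), (∀ n, Function.Surjective (ψ n)) ∧
      E.base.toLinearMap ∘ₗ ψ 0 = p ∧
      (∀ n, (E.transition (n + 1)).hom ∘ₗ ψ (n + 1) = ψ n) ∧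
      ∀ n, LinearMap.ker (ψ (n + 1)) ⊔ a ^ (n + 1) • ⊤ = LinearMap.ker (ψ n) := by
  have hfin : ∀ n, Module.Finite R (E.obj n) := fun n => by
    have := (isFiniteLength_iff_isNoetherian_isArtinian.1 (E.finite_length n)).1
    infer_instance
  have hker : ∀ n, LinearMap.ker (E.transition n).hom = a ^ n • ⊤ := fun n => by
    change LinearMap.ker ((E.iso n).toLinearMap ∘ₗ Submodule.mkQ _) = _
    rw [LinearEquiv.ker_comp, Submodule.ker_mkQ]
  have hsurj : ∀ n, Function.Surjective (E.transition n).hom := fun n =>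
    (E.iso n).surjective.comp (Submodule.mkQ_surjective _)
  have hstep : ∀ (n : ℕ) (f : {f : F →ₗ[R] E.obj (n + 1) // Function.Surjective f}),
      ∃ g : {g : F →ₗ[R] E.obj (n + 2) // Function.Surjective g},
        (E.transition (n + 1)).hom ∘ₗ g.1 = f.1 := fun n f => by
    obtain ⟨g, hg, h⟩ := exists_lift_of_ker_eq ((Ideal.pow_le_self n.succ_ne_zero).trans ha)
      (E.transition (n + 1)).hom (hsurj _) (hker _) f.1 f.2
    exact ⟨⟨g, hg⟩, h⟩
  choose g hg using hstep
  let ψ : ∀ n, {f : F →ₗ[R] E.obj (n + 1) // Function.Surjective f} := fun n =>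
    Nat.rec ⟨E.base.symm.toLinearMap ∘ₗ p, E.base.symm.surjective.comp hp⟩ g n
  refine ⟨fun n => (ψ n).1, fun n => (ψ n).2, ?_, fun n => hg n (ψ n), fun n => ?_⟩
  · ext x
    exact E.base.apply_symm_apply (p x)
  · rw [ker_sup_smul_top _ _ (ψ (n + 1)).2 _ (hker (n + 1))]
    exact congrArg _ (hg n (ψ n))

theorem mem_of_forall_mem_sup_pow {R F : Type*} [CommRing R] [IsLocalRing R] [IsNoetherianRing R]
    [AddCommGroup F] [Module R F] [Module.Finite R F] (I : Ideal R) (hI : I ≠ ⊤)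
    (N : Submodule R F) {z : F} (h : ∀ᶠ t in Filter.atTop, z ∈ N ⊔ I ^ t • ⊤) : z ∈ N := by
  have h1 := Ideal.iInf_pow_smul_eq_bot_of_isLocalRing (M := F ⧸ N) I hI
  rw [← Submodule.Quotient.mk_eq_zero, ← Submodule.mem_bot R, ← h1, Submodule.mem_iInf]
  intro t
  obtain ⟨T, hT⟩ := Filter.eventually_atTop.1 h
  obtain ⟨x, hx, y, hy, rfl⟩ := Submodule.mem_sup.1 (hT _ (le_max_left T t))
  rw [Submodule.Quotient.mk_add, (Submodule.Quotient.mk_eq_zero N).2 hx, zero_add,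
    map_mkQ_smul_top]
  exact Submodule.mem_map_of_mem
    (Submodule.smul_mono_left (Ideal.pow_le_pow_right (le_max_right T t)) hy)

variable {k : Type u} [Field k]

theorem exists_limit {σ : Type*} [Finite σ] (z : ℕ → MvPowerSeries σ k × MvPowerSeries σ k)
    (hz : ∀ n, z n - z (n + 1) ∈ IsLocalRing.maximalIdeal (MvPowerSeries σ k) ^ n •
      (⊤ : Submodule (MvPowerSeries σ k) (MvPowerSeries σ k × MvPowerSeries σ k))) :
    ∃ w, ∀ n, z n - w ∈ IsLocalRing.maximalIdeal (MvPowerSeries σ k) ^ n •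
      (⊤ : Submodule (MvPowerSeries σ k) (MvPowerSeries σ k × MvPowerSeries σ k)) := by
  have key : ∀ f : ℕ → MvPowerSeries σ k,
      (∀ n, f n - f (n + 1) ∈ IsLocalRing.maximalIdeal (MvPowerSeries σ k) ^ n) →
      ∃ w, ∀ n, f n - w ∈ IsLocalRing.maximalIdeal (MvPowerSeries σ k) ^ n := by
    intro f hf
    have hc : IsAdicComplete (IsLocalRing.maximalIdeal (MvPowerSeries σ k)) (MvPowerSeries σ k) := by
      rw [maximalIdeal_eq_span_X]; infer_instance
    have hle : ∀ {m n : ℕ}, m ≤ n →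
        f m ≡ f n [SMOD (IsLocalRing.maximalIdeal (MvPowerSeries σ k) ^ m •
          ⊤ : Submodule (MvPowerSeries σ k) (MvPowerSeries σ k))] := by
      intro m n hmn
      induction n, hmn using Nat.le_induction with
      | base => rfl
      | succ n hmn ih =>
        refine ih.trans ?_
        rw [SModEq.sub_mem, smul_eq_mul, Ideal.mul_top]
        exact Ideal.pow_le_pow_right hmn (hf n)
    obtain ⟨w, hw⟩ := IsPrecomplete.prec hc.toIsPrecomplete hle
    refine ⟨w, fun n => ?_⟩
    have := hw n
    rwa [SModEq.sub_mem, smul_eq_mul, Ideal.mul_top] at this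
  simp only [mem_smul_top_prod] at hz ⊢
  obtain ⟨w₁, h₁⟩ := key (fun n => (z n).1) fun n => (hz n).1
  obtain ⟨w₂, h₂⟩ := key (fun n => (z n).2) fun n => (hz n).2
  exact ⟨(w₁, w₂), fun n => ⟨h₁ n, h₂ n⟩⟩

/-- An element of K n is corrected successively, by terms in growing powers of 𝔞, to lie in K (n +
1), K (n + 2), and so on; completeness supplies the limit, which lies in every K j. Thus the
intersection still surjects onto each stage. -/
theorem iInf_sup_pow_smul_top {σ : Type*} [Finite σ] {a : Ideal (MvPowerSeries σ k)}
    (ha : a ≤ IsLocalRing.maximalIdeal (MvPowerSeries σ k))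
    (K : ℕ → Submodule (MvPowerSeries σ k) (MvPowerSeries σ k × MvPowerSeries σ k))
    (hK : ∀ n, K (n + 1) ⊔ a ^ (n + 1) • ⊤ = K n) (n : ℕ) :
    (⨅ j, K j) ⊔ a ^ (n + 1) • ⊤ = K n := by
  refine le_antisymm (sup_le (iInf_le _ _) (le_sup_right.trans (hK n).le)) fun z hz => ?_
  have hstep : ∀ (j : ℕ) (x : K (n + j)), ∃ y : K (n + (j + 1)),
      (x : MvPowerSeries σ k × MvPowerSeries σ k) - y ∈ a ^ (n + j + 1) •
        (⊤ : Submodule (MvPowerSeries σ k) (MvPowerSeries σ k × MvPowerSeries σ k)) := by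
    rintro j ⟨x, hx⟩
    rw [← hK] at hx
    obtain ⟨y, hy, w, hw, rfl⟩ := Submodule.mem_sup.1 hx
    exact ⟨⟨y, hy⟩, by simpa using hw⟩
  choose y hy using hstep
  obtain ⟨Z, hZ0, hZ⟩ : ∃ Z : ∀ j, K (n + j), (Z 0).1 = z ∧ ∀ j, (Z j).1 - (Z (j + 1)).1 ∈
      a ^ (n + j + 1) • (⊤ : Submodule (MvPowerSeries σ k)
        (MvPowerSeries σ k × MvPowerSeries σ k)) :=
    ⟨fun j => Nat.rec ⟨z, hz⟩ y j, rfl, fun j => hy j _⟩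
  have hpow : ∀ i j : ℕ, i ≤ j → a ^ j • (⊤ : Submodule (MvPowerSeries σ k)
      (MvPowerSeries σ k × MvPowerSeries σ k)) ≤ a ^ i • ⊤ := fun i j hij =>
    Submodule.smul_mono_left (Ideal.pow_le_pow_right hij)
  obtain ⟨w, hw⟩ := exists_limit (fun j => (Z j).1) fun j =>
    Submodule.smul_mono_left (Ideal.pow_right_mono ha j) (hpow j _ (by omega) (hZ j))
  have hZw : ∀ j, (Z j).1 - w ∈
      a ^ (n + j + 1) • (⊤ : Submodule (MvPowerSeries σ k)
        (MvPowerSeries σ k × MvPowerSeries σ k)) := by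
    intro j
    have hsub : ∀ t, j ≤ t → (Z j).1 - (Z t).1 ∈
        a ^ (n + j + 1) • (⊤ : Submodule (MvPowerSeries σ k)
          (MvPowerSeries σ k × MvPowerSeries σ k)) := by
      intro t ht
      induction t, ht using Nat.le_induction with
      | base => simp
      | succ t ht ih =>
        rw [← sub_add_sub_cancel _ (Z t).1]
        exact Submodule.add_mem _ ih (hpow _ _ (by omega) (hZ t))
    -- The limit is only 𝔪-adic; membership in 𝔞^(n+j+1)F passes to it because submodules are
    -- 𝔪-adically closed.
    refine mem_of_forall_mem_sup_pow (IsLocalRing.maximalIdeal (MvPowerSeries σ k))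
      (IsLocalRing.maximalIdeal.isMaximal _).ne_top _ ?_
    filter_upwards [Filter.eventually_ge_atTop j] with t ht
    rw [← sub_add_sub_cancel _ (Z t).1]
    exact Submodule.add_mem_sup (hsub t ht) (hw t)
  have hanti : Antitone K := antitone_nat_of_succ_le fun j => le_sup_left.trans (hK j).le
  have hwK : w ∈ ⨅ j, K j := by
    rw [Submodule.mem_iInf]
    intro j
    refine hanti (Nat.le_add_left j n) ?_
    rw [← sub_sub_cancel (Z j).1 w]
    exact Submodule.sub_mem _ (Z j).2 ((hK (n + j)).le (Submodule.mem_sup_right (hZw j)))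
  have h0 : z = w + (z - w) := by abel
  rw [h0]
  exact Submodule.add_mem_sup hwK (hZ0 ▸ hZw 0)

end Reduction

/-! ### Non-liftability and the limit of Tor_1 -/

section Conclusion

variable (k : Type u) [Field k] (d : ℕ)

theorem not_isLiftable_moduleM (hd : 2 ≤ d) : ¬ IsLiftable (idealA k d) (moduleM k d) := by
  rintro ⟨L, hL, hTor⟩
  rw [isNaiveLift_iff] at hL
  obtain ⟨_, ⟨e⟩⟩ := hL
  obtain ⟨φ, hφ, hφp⟩ := exists_lift_of_ker_eq (idealA_le_maximalIdeal k d)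
    (e.toLinearMap ∘ₗ Submodule.mkQ _)
    (e.surjective.comp (Submodule.mkQ_surjective _))
    (by rw [LinearEquiv.ker_comp, Submodule.ker_mkQ]) (toM k d) (toM_surjective k d)
  have h1 := ker_sup_smul_top (idealA k d) φ hφ (e.toLinearMap ∘ₗ Submodule.mkQ _)
    (by rw [LinearEquiv.ker_comp, Submodule.ker_mkQ])
  rw [hφp, ker_toM] at h1
  refine not_inf_smul_top_le hd h1 (inf_smul_top_le_of_isZero_tor (polyG k d) _ ?_)
  let i : ModuleCat.of (ringR k d) ((ringR k d × ringR k d) ⧸ LinearMap.ker φ) ≅ L :=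
    (φ.quotKerEquivOfSurjective hφ).toModuleIso
  exact (hTor 1 one_pos).of_iso (((Tor (ModuleCat.{u} (ringR k d)) 1).mapIso i).app _)

/-- Write the system through one quotient L = F/K and choose x in K ∩ 𝔞F outside 𝔞K. Its class in
Tor_1(L, S) maps compatibly to all Tor_1(M_n, S); a zero limit would put x in 𝔞 ker ψ_n = 𝔞K +
𝔞^(n+2)F for every n, hence in 𝔞K. -/
theorem not_isZero_limTor (hd : 2 ≤ d) (E : LiftingSystem (idealA k d) (moduleM k d)) :
    ¬ IsZero (E.limTor 1) := by
  intro hzero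
  obtain ⟨ψ, hψ, hbase, htrans, hker⟩ :=
    E.exists_compatible (idealA_le_maximalIdeal k d) (toM k d) (toM_surjective k d)
  set K := ⨅ n, LinearMap.ker (ψ n) with hKdef
  have hK : ∀ n, K ⊔ idealA k d ^ (n + 1) • ⊤ = LinearMap.ker (ψ n) :=
    iInf_sup_pow_smul_top (idealA_le_maximalIdeal k d) _ hker
  have hK0 : K ⊔ idealA k d • (⊤ : Submodule (ringR k d) (ringR k d × ringR k d)) =
      relModule k d ⊔ idealA k d • ⊤ := by
    rw [← ker_toM, ← hbase, LinearEquiv.ker_comp, ← hK 0, zero_add, pow_one]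
  obtain ⟨x, ⟨hxK, hx⟩, hxaK⟩ := Set.not_subset.1 (not_inf_smul_top_le hd hK0)
  obtain ⟨τ, hτ⟩ := exists_hom_tor_one_quotient (polyG k d) K hxK hx
  let L : ModuleCat.{u} (ringR k d) := ModuleCat.of _ ((ringR k d × ringR k d) ⧸ K)
  let f' : ∀ n, L ⟶ E.obj (n + 1) := fun n =>
    ModuleCat.ofHom (K.liftQ (ψ n) (iInf_le _ n))
  have hf' : ∀ n, f' (n + 1) ≫ E.transition (n + 1) = f' n := fun n => by
    refine ModuleCat.hom_ext (Submodule.linearMap_qext _ ?_)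
    exact htrans n
  -- The inverse system also has a term of index 0, so the cone is extended there by composing with
  -- the last transition map.
  let f : ∀ n, L ⟶ E.obj n := fun n => Nat.casesOn n (f' 0 ≫ E.transition 0) f'
  have hf : ∀ n, f (n + 1) ≫ E.transition n = f n := fun n => by
    cases n with
    | zero => rfl
    | succ n => exact hf' n
  let c : Cone E.toFunctor :=
    { pt := L
      π := NatTrans.ofOpSequence f fun n => by
        simp only [Functor.const_obj_map, LiftingSystem.toFunctor]
        rw [Functor.ofOpSequence_map_homOfLE_succ]
        exact (hf n).symm }
  let T := (Tor (ModuleCat.{u} (ringR k d)) 1).flip.obj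
    (ModuleCat.of (ringR k d) (ringR k d ⧸ idealA k d))
  -- Precomposing with τ makes the Tor_1 class a cone with vertex R, that is, an element of the
  -- inverse limit.
  let c' : Cone (E.toFunctor ⋙ T) := (T.mapCone c).extend τ
  have h0 : ∀ n, τ ≫ T.map (f n) = 0 := by
    intro n
    have h1 : limit.lift _ c' = 0 := hzero.eq_of_tgt _ _
    have h2 := limit.lift_π c' (Opposite.op n)
    rw [h1, zero_comp] at h2
    exact h2.symm
  refine hxaK (mem_of_forall_mem_sup_pow (idealA k d)
    (fun h => (IsLocalRing.maximalIdeal.isMaximal (ringR k d)).ne_top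
      (top_le_iff.1 (h ▸ idealA_le_maximalIdeal k d))) _ (Filter.Eventually.of_forall fun n => ?_))
  have h1 := hτ (E.obj (n + 1)) (f (n + 1)) (ψ n) (hψ n) (Submodule.liftQ_mkQ _ _ _) (h0 (n + 1))
  change x ∈ idealA k d • _ at h1
  rw [← hK, Submodule.smul_sup, ← Submodule.mul_smul, ← pow_succ'] at h1
  have h2 : idealA k d ^ (n + 2) ≤ idealA k d ^ n := Ideal.pow_le_pow_right (by omega)
  have h3 : idealA k d ^ (n + 2) • (⊤ : Submodule (ringR k d) (ringR k d × ringR k d)) ≤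
      idealA k d ^ n • ⊤ := Submodule.smul_mono_left h2
  exact sup_le_sup_left h3 _ h1

end Conclusion

end

end SerreLifting

theorem mainTheorem4 (k : Type u) [Field k] (d : ℕ) (hd : 2 ≤ d) :
    -- `S` is a `d`-dimensional complete intersection: `g_1, …, g_d` is a regular sequence
    (RingTheory.Sequence.IsRegular (ringR k d) (List.ofFn (polyG k d)) ∧
      ringKrullDim (ringS k d) = d) ∧
    -- `M` has finite length and finite projective dimension over `S`
    (IsFiniteLength (ringS k d) (moduleM k d) ∧
      ∃ n : ℕ, HasProjectiveDimensionLE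
        (ModuleCat.of (ringS k d) (moduleM k d)) n) ∧
    -- there is a lifting system whose Fitting ideals have colength growing like `n ^ d`,
    -- and `M` Serre lifts to `R`
    ((∃ E : LiftingSystem (idealA k d) (moduleM k d),
        GrowsLikePow (fun n => Module.length (ringR k d)
          (ringR k d ⧸ fittingIdealZero (ringR k d) (E.obj n))) d) ∧
      IsSerreLiftable (idealA k d) (moduleM k d)) ∧
    -- every lifting system has a nonzero limit of `Tor_1`, and `M` does not lift to `R`
    ((∀ E : LiftingSystem (idealA k d) (moduleM k d), ¬ IsZero (E.limTor 1)) ∧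
      ¬ IsLiftable (idealA k d) (moduleM k d)) := by
  exact ⟨⟨isRegular_polyG k d, ringKrullDim_ringS k d⟩,
    ⟨isFiniteLength_moduleM k d, d, hasProjectiveDimensionLE_moduleM k d hd⟩,
    ⟨⟨standardSystem k d, growsLikePow_standardSystem k d hd⟩, isSerreLiftable_moduleM k d hd⟩,
    not_isZero_limTor k d hd, not_isLiftable_moduleM k d hd⟩
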